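/- Let $(R,\mathfrak m)$ be a commutative noetherian local ring. An $R$-module $M$ with a topology is Hausdorff linearly topologized if it is a Hausdorff topological group whose zero element has a base of neighbourhoods consisting of submodules. Such an $M$ is called linearly compact if every family of closed cosets (cosets of closed submodules) with the finite intersection property has non-empty intersection, and semi-discrete if every submodule of $M$ is closed. For an $R$-module $N$ put $\Gamma_{\mathfrak m}(N)=\bigcup_{t>0}(0:_N\mathfrak m^t)$ and, for $i\ge 0$, let $H^{\mathfrak m}_i(N)=\varprojlim_t \operatorname{Tor}^R_i(R/\mathfrak m^t,N)$ be the $i$-th local homology module. The Noetherian dimension $\operatorname{Ndim} N$ is defined inductively: $\operatorname{Ndim} N=-1$ if $N=0$; and for an ordinal $\alpha$, $\operatorname{Ndim} N=\alpha$ if $\operatorname{Ndim} N<\alpha$ is false and for every ascending chain $N_0\subseteq N_1\subseteq\cdots$ of submodules of $N$ there is $m_0$ with $\operatorname{Ndim}(N_{m+1}/N_m)<\alpha$ for all $m\ge m_0$. **Theorem.** Let $(R,\mathfrak m)$ be a commutative noetherian local ring and $M$ a non-zero semi-discrete linearly compact $R$-module. Then: (i) if $\Gamma_{\mathfrak m}(M)\neq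 0$, then $\operatorname{Ndim}\Gamma_{\mathfrak m}(M)=\max\{\, i \mid H^{\mathfrak m}_i(M)\neq 0\,\}$; (ii) if $\operatorname{Ndim} M\neq 1$, then $\operatorname{Ndim} M=\max\{\, i \mid H^{\mathfrak m}_i(M)\neq 0\,\}$. In both cases the set on the right is non-empty and bounded, so the maximum exists and the dimension on the left is a non-negative integer. -/

import Mathlib

universe u v

namespace LinCpt

section Topology

variable (R : Type u) [CommRing R] (M : Type v) [AddCommGroup M] [Module R M] [TopologicalSpace M]

/-- `M` is a Hausdorff linearly topologized `R`-module: a Hausdorff topological group in which the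
neighbourhoods of zero have a base consisting of `R`-submodules. No topology on `R` is needed: with
such a base `M` is a topological module over the discrete ring `R`, and every Hausdorff linearly
topologized module over `R` with any other ring topology satisfies this definition. -/
structure IsHausdorffLinearlyTopologized : Prop where
  isTopologicalAddGroup : IsTopologicalAddGroup M
  isLinearTopology : IsLinearTopology R M
  t2Space : T2Space M

/-- A Hausdorff linearly topologized module is linearly compact if every family of closed cosets
(cosets of closed submodules) with the finite intersection property has non-empty intersection. -/
structure IsLinearlyCompact : Prop extends IsHausdorffLinearlyTopologized R M where
  sInter_nonempty : ∀ F : Set (Set M),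
    (∀ C ∈ F, ∃ (x : M) (N : Submodule R M), IsClosed (N : Set M) ∧ C = (fun y => x + y) '' (N : Set M)) →
    (∀ G ⊆ F, G.Finite → (⋂₀ G).Nonempty) → (⋂₀ F).Nonempty

/-- A Hausdorff linearly topologized module is semi-discrete if all its submodules are closed. -/
structure IsSemiDiscrete : Prop extends IsHausdorffLinearlyTopologized R M where
  isClosed_submodule : ∀ N : Submodule R M, IsClosed (N : Set M)

end Topology

/-- `HasNdim R M α` says that the Noetherian dimension of the `R`-module `M` is `α`. The possible
values are `⊥` (standing for `-1`) and the ordinals. The dimension is `⊥` when `M = 0`; it is an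
ordinal `α` when it is not smaller than `α` and in every ascending chain `M₀ ⊆ M₁ ⊆ …` of
submodules all but finitely many quotients `Mₘ₊₁ / Mₘ` have dimension smaller than `α`. -/
def HasNdim (R : Type u) [CommRing R] (M : Type v) [AddCommGroup M] [Module R M]
    (α : WithBot Ordinal.{v}) : Prop :=
  (α = ⊥ ∧ Subsingleton M) ∨
  (α ≠ ⊥ ∧ (¬ ∃ (β : WithBot Ordinal.{v}) (_ : β < α), HasNdim R M β) ∧
    ∀ c : ℕ →o Submodule R M, ∃ m₀ : ℕ, ∀ m ≥ m₀, ∃ (β : WithBot Ordinal.{v}) (_ : β < α),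
      HasNdim R (c (m + 1) ⧸ (c m).submoduleOf (c (m + 1))) β)
termination_by wellFounded_lt.wrap α
decreasing_by all_goals exact ‹_ < α›

/-- The local homology module `H^I_i(M) = lim_t Tor_i^R(R/Iᵗ, M)`, the inverse limit being taken
along the maps induced by the projections `R/Iˢ → R/Iᵗ` for `t ≤ s`. -/
noncomputable def localHomology {R : Type u} [CommRing R] (I : Ideal R) (i : ℕ)
    (M : Type u) [AddCommGroup M] [Module R M] : ModuleCat.{u} R :=
  CategoryTheory.Limits.limit
    (CategoryTheory.Functor.comp
      (localCohomology.ringModIdeals (localCohomology.idealPowersDiagram I))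
      ((CategoryTheory.Tor (ModuleCat.{u} R) i).flip.obj (ModuleCat.of R M)))

end LinCpt

-- The topology enters once. A semi-discrete linearly compact module is socle-finite: otherwise an
-- infinite-dimensional subquotient over the residue field `k` would carry a family of cosets with
-- the finite intersection property and no common point. Everything after that is algebra of
-- socle-finite modules. They are stable under submodules, quotients, extensions and `Tor` with
-- finitely generated modules. The `𝔪`-torsion ones are Artinian, and each of them is an extension
-- of an Artinian module by a finitely generated one.
--
-- Hence the modules `Tor_i(R/𝔪ᵗ, M)` are Artinian, and their limit vanishes exactly when the tower
-- is pro-zero. Let `E` be injective with socle `k`. Dualizing into `E` turns the tower into the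
-- direct system `Ext^i(R/𝔪ᵗ, Hom(M, E))`, so `H_i(M) = 0` if and only if `D^i(M) = H^i_𝔪(Hom(M,
-- E))` vanishes (`SocleFinite.subsingleton_localHomology_iff`). The functors `D^i` have long exact
-- sequences, their elements are killed by powers of `𝔪`, and `D^i` vanishes on finitely generated
-- modules for `i > 0`.
--
-- Put `G = Γ_𝔪(M)`, which is Artinian. The module `M/G` has no socle, so some `x ∈ 𝔪` is regular on
-- it with Noetherian cokernel. This gives `D^i(M/G) = 0` for `i > 0` and `Ndim (M/G) ≤ 1`. It
-- remains to see that the last nonzero `D^i(G)` sits at `i = Ndim G`. Vanishing above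
-- (`DualLocCoh.subsingleton_of_ndimLT`) is an induction that replaces `G` by the kernel of a
-- surjective multiplication. For nonvanishing (`DualLocCoh.not_subsingleton_of_ndimLT`), a
-- submodule `B` minimal of full dimension `e + 1` is used. If `D^{e+1}(B) = 0`, a suitable `x` has
-- `D^e(B)/x ≅ D^e(B[x])` killed by a power of `𝔪`, while for `e > 0` a minimal submodule of
-- dimension `e` in `B[x]` makes a quotient of it divisible. So that quotient is zero, against the
-- induction hypothesis.
--
-- For (ii), `Ndim M = Ndim G` once `Ndim G ≥ 1`. Otherwise `Ndim M ≤ 1`, and excluding the value 1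
-- leaves a nonzero Noetherian module, where both sides are 0.

universe w

/-! ### Socle-finite modules and linear compactness -/

section

open IsLocalRing

/-- A module over a local ring is socle-finite if each of its subquotients that is killed by the
maximal ideal is finitely generated. -/
def SocleFinite (R : Type u) [CommRing R] [IsLocalRing R] (M : Type v) [AddCommGroup M]
    [Module R M] : Prop :=
  ∀ K L : Submodule R M, maximalIdeal R • L ≤ K →
    ∃ F : Submodule R M, F.FG ∧ F ≤ L ∧ L ≤ F ⊔ K

theorem Submodule.exists_fg_le_map_eq {R : Type u} [CommRing R] {M : Type v} {N : Type w}
    [AddCommGroup M] [Module R M] [AddCommGroup N] [Module R N] (f : M →ₗ[R] N)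
    {L : Submodule R M} {F : Submodule R N} (hF : F.FG) (hFL : F ≤ L.map f) :
    ∃ G : Submodule R M, G.FG ∧ G ≤ L ∧ G.map f = F := by
  classical
  obtain ⟨S, rfl⟩ := hF
  have hS : (S : Set N) ⊆ f '' (L : Set M) := fun x hx => hFL (Submodule.subset_span hx)
  obtain ⟨T, hTL, rfl⟩ := Finset.subset_set_image_iff.mp hS
  refine ⟨Submodule.span R T, ⟨T, rfl⟩, Submodule.span_le.mpr hTL, ?_⟩
  rw [Submodule.map_span, Finset.coe_image]

namespace SocleFinite

variable {R : Type u} [CommRing R] [IsLocalRing R] {M : Type v} {N : Type w}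
  [AddCommGroup M] [Module R M] [AddCommGroup N] [Module R N]

theorem of_injective (hM : SocleFinite R M) (f : N →ₗ[R] M) (hf : Function.Injective f) :
    SocleFinite R N := by
  intro K L h
  obtain ⟨F, hF, hFL, hL⟩ := hM (K.map f) (L.map f) (by
    rw [← Submodule.map_smul'']; exact Submodule.map_mono h)
  obtain ⟨G, hG, hGL, rfl⟩ := Submodule.exists_fg_le_map_eq f hF hFL
  refine ⟨G, hG, hGL, ?_⟩
  rw [← Submodule.map_sup] at hL
  exact (Submodule.map_le_map_iff_of_injective hf _ _).mp hL

theorem of_surjective (hM : SocleFinite R M) (f : M →ₗ[R] N) (hf : Function.Surjective f) :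
    SocleFinite R N := by
  intro K L h
  obtain ⟨F, hF, hFL, hL⟩ := hM (K.comap f) (L.comap f) (by
    rw [← Submodule.map_le_iff_le_comap, Submodule.map_smul'',
      Submodule.map_comap_eq_of_surjective hf]
    exact h)
  refine ⟨F.map f, hF.map f, Submodule.map_le_iff_le_comap.mpr hFL, ?_⟩
  have := Submodule.map_mono (f := f) hL
  rwa [Submodule.map_sup, Submodule.map_comap_eq_of_surjective hf,
    Submodule.map_comap_eq_of_surjective hf] at this

/-- Generators are lifted from the image of `L` in `P`; what they miss lies in the image of `M` and
is covered by generators of the preimage of `L`. -/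
theorem of_exact {P : Type*} [AddCommGroup P] [Module R P] (hM : SocleFinite R M)
    (hP : SocleFinite R P) (f : M →ₗ[R] N) (g : N →ₗ[R] P) (h : Function.Exact f g) :
    SocleFinite R N := by
  intro K' L hKL
  -- The error terms taken from `K` must stay inside `L`, so `K` is cut down to `L`.
  set K := K' ⊓ L with hK
  have hKL : maximalIdeal R • L ≤ K := le_inf hKL Submodule.smul_le_right
  obtain ⟨F₁, hF₁, hF₁L, h₁⟩ := hP (K.map g) (L.map g) (by
    rw [← Submodule.map_smul'']; exact Submodule.map_mono hKL)
  obtain ⟨G₁, hG₁, hG₁L, rfl⟩ := Submodule.exists_fg_le_map_eq g hF₁ hF₁L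
  obtain ⟨F₂, hF₂, hF₂L, h₂⟩ := hM (K.comap f) (L.comap f) (by
    rw [← Submodule.map_le_iff_le_comap, Submodule.map_smul'']
    exact (smul_mono_right _ (Submodule.map_comap_le _ _)).trans hKL)
  refine ⟨G₁ ⊔ F₂.map f, hG₁.sup (hF₂.map f),
    sup_le hG₁L (Submodule.map_le_iff_le_comap.mpr hF₂L), fun l hl => ?_⟩
  rw [← Submodule.map_sup] at h₁
  obtain ⟨y, hy, hyl⟩ := h₁ (Submodule.mem_map_of_mem hl)
  obtain ⟨a, ha, k, hk, rfl⟩ := Submodule.mem_sup.mp hy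
  obtain ⟨z, hz⟩ := (h (l - (a + k))).mp (by rw [map_sub, hyl, sub_self])
  have hzL : z ∈ L.comap f := by
    rw [Submodule.mem_comap, hz]
    exact L.sub_mem hl (L.add_mem (hG₁L ha) hk.2)
  obtain ⟨b, hb, k', hk', rfl⟩ := Submodule.mem_sup.mp (h₂ hzL)
  have : l = (a + f b) + (k + f k') := by
    rw [map_add] at hz
    rw [eq_sub_iff_add_eq] at hz
    rw [← hz]; abel
  rw [this]
  refine Submodule.add_mem_sup (Submodule.add_mem_sup ha (Submodule.mem_map_of_mem hb)) ?_
  exact add_mem hk.1 (show f k' ∈ K from hk').1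

theorem of_isNoetherian [IsNoetherian R M] : SocleFinite R M :=
  fun _ L _ => ⟨L, IsNoetherian.noetherian L, le_rfl, le_sup_left⟩

theorem pi_fin (hM : SocleFinite R M) (n : ℕ) : SocleFinite R (Fin n → M) := by
  induction n with
  | zero =>
    exact of_isNoetherian
  | succ n ih =>
    refine hM.of_exact ih (LinearMap.single R (fun _ : Fin (n + 1) => M) 0)
      (LinearMap.pi fun i => LinearMap.proj i.succ) fun x => ⟨fun hx => ⟨x 0, ?_⟩, ?_⟩
    · ext i
      refine Fin.cases ?_ (fun i => ?_) i
      · simp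
      · have := congrFun hx i
        simp only [LinearMap.pi_apply, LinearMap.proj_apply, Pi.zero_apply] at this
        simp [this]
    · rintro ⟨y, rfl⟩
      ext i
      simp

end SocleFinite

theorem isArtinian_of_finite_of_smul_eq_zero {R : Type u} [CommRing R] [IsLocalRing R]
    {M : Type v} [AddCommGroup M] [Module R M] [Module.Finite R M]
    (h : ∀ a ∈ maximalIdeal R, ∀ x : M, a • x = 0) : IsArtinian R M := by
  have hM : Module.IsTorsionBySet R M (maximalIdeal R) := fun x a => h a a.2 x
  let := hM.module
  have : IsScalarTower R (R ⧸ maximalIdeal R) M := hM.isScalarTower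
  have := Module.Finite.of_restrictScalars_finite R (R ⧸ maximalIdeal R) M
  let := Ideal.Quotient.field (maximalIdeal R)
  have : IsArtinianRing (R ⧸ maximalIdeal R) := inferInstance
  have : IsArtinian (R ⧸ maximalIdeal R) M := inferInstance
  exact isArtinian_of_surjective_algebraMap (S := R) (R := R ⧸ maximalIdeal R) (M := M)
    Ideal.Quotient.mk_surjective

/-- For the least `t` with `𝔪ᵗx ⊆ K`, any `r ∈ 𝔪ᵗ⁻¹` with `rx ∉ K` works. Thus the socle is
essential in an `𝔪`-torsion module. -/
theorem exists_socle_mem_of_notMem {R : Type u} [CommRing R] [IsLocalRing R]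
    {M : Type v} [AddCommGroup M] [Module R M] {K : Submodule R M} {x : M}
    (hx : ∃ t : ℕ, ∀ a ∈ maximalIdeal R ^ t, a • x = 0) (hxK : x ∉ K) :
    ∃ r : R, r • x ∉ K ∧ ∀ a ∈ maximalIdeal R, a • r • x ∈ K := by
  classical
  have hex : ∃ t : ℕ, ∀ a ∈ maximalIdeal R ^ t, a • x ∈ K := by
    obtain ⟨t, ht⟩ := hx
    exact ⟨t, fun a ha => by rw [ht a ha]; exact K.zero_mem⟩
  have hspec := Nat.find_spec hex
  have hpos : Nat.find hex ≠ 0 := by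
    intro h0
    rw [h0] at hspec
    exact hxK (by simpa using hspec 1 (by simp))
  obtain ⟨t, ht⟩ := Nat.exists_eq_succ_of_ne_zero hpos
  have hlt := Nat.find_min hex (m := t) (by omega)
  push Not at hlt
  obtain ⟨r, hr, hrx⟩ := hlt
  refine ⟨r, hrx, fun a ha => ?_⟩
  rw [← mul_smul]
  refine hspec _ ?_
  rw [ht, pow_succ']
  exact Ideal.mul_mem_mul ha hr

/-- Let `K` be the intersection of a descending chain. The socle of `M/K` is finite-dimensional, so
the traces of the chain on it become stationary. The stationary trace lies in every member, hence is
zero, and essentiality of the socle forces the chain to reach `K`. -/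
theorem SocleFinite.isArtinian {R : Type u} [CommRing R] [IsLocalRing R]
    {M : Type v} [AddCommGroup M] [Module R M] (hM : SocleFinite R M)
    (htors : ∀ x : M, ∃ t : ℕ, ∀ a ∈ maximalIdeal R ^ t, a • x = 0) : IsArtinian R M := by
  rw [← monotone_stabilizes_iff_artinian]
  intro f
  let g : ℕ → Submodule R M := fun n => OrderDual.ofDual (f n)
  have hg : Antitone g := fun i j h => f.monotone h
  set K := ⨅ n, g n with hK
  let L : Submodule R M :=
    { carrier := {x | ∀ a ∈ maximalIdeal R, a • x ∈ K}
      add_mem' := fun {x y} hx hy a ha => by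
        rw [smul_add]; exact K.add_mem (hx a ha) (hy a ha)
      zero_mem' := fun a _ => by rw [smul_zero]; exact K.zero_mem
      smul_mem' := fun r x hx a ha => by
        rw [smul_comm]; exact K.smul_mem r (hx a ha) }
  have hLK : maximalIdeal R • L ≤ K := Submodule.smul_le.mpr fun a ha x hx => hx a ha
  obtain ⟨F, hF, hFL, hL⟩ := hM K L hLK
  let L' : Submodule R (M ⧸ K) := L.map K.mkQ
  have hL'F : L' = F.map K.mkQ := by
    apply le_antisymm
    · refine (Submodule.map_mono hL).trans ?_
      rw [Submodule.map_sup]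
      refine sup_le le_rfl ?_
      rw [Submodule.mkQ_map_self]; exact bot_le
    · exact Submodule.map_mono hFL
  have : Module.Finite R L' := by
    rw [Module.Finite.iff_fg, hL'F]; exact hF.map _
  have : IsArtinian R L' := by
    refine isArtinian_of_finite_of_smul_eq_zero fun a ha x => ?_
    obtain ⟨_, y, hy, rfl⟩ := x
    ext
    change a • K.mkQ y = 0
    rw [← map_smul, Submodule.mkQ_apply, Submodule.Quotient.mk_eq_zero]
    exact hy a ha
  let c : ℕ →o (Submodule R L')ᵒᵈ :=
    ⟨fun n => OrderDual.toDual (((g n).map K.mkQ).comap L'.subtype), fun i j h =>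
      Submodule.comap_mono (Submodule.map_mono (hg h))⟩
  obtain ⟨n, hn⟩ := IsArtinian.monotone_stabilizes c
  have key : g n ≤ K := by
    intro x hx
    by_contra hxK
    obtain ⟨r, hr, hrm⟩ := exists_socle_mem_of_notMem (htors x) hxK
    refine hr ?_
    rw [hK, Submodule.mem_iInf]
    intro m
    rcases le_total m n with hmn | hmn
    · exact hg hmn ((g n).smul_mem r hx)
    · have h1 : ((g n).map K.mkQ).comap L'.subtype = ((g m).map K.mkQ).comap L'.subtype :=
        congrArg OrderDual.ofDual (hn m hmn)
      have h2 : (⟨K.mkQ (r • x), Submodule.mem_map_of_mem hrm⟩ : L') ∈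
          ((g n).map K.mkQ).comap L'.subtype :=
        Submodule.mem_map_of_mem ((g n).smul_mem r hx)
      rw [h1] at h2
      obtain ⟨y, hy, hyx⟩ := h2
      have h3 : y - r • x ∈ K := by
        rw [← Submodule.Quotient.mk_eq_zero, Submodule.Quotient.mk_sub, sub_eq_zero]
        exact hyx
      have h4 : y - r • x ∈ g m := (iInf_le g m) h3
      have := (g m).sub_mem hy h4
      rwa [sub_sub_cancel] at this
  refine ⟨n, fun m hm => ?_⟩
  exact le_antisymm (α := Submodule R M) (key.trans (iInf_le g m)) (hg hm)

/-- A module that is killed by the maximal ideal and not finitely generated has an infinite family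
of linearly independent coordinates. -/
theorem exists_coordinates_of_not_finite {R : Type u} [CommRing R] [IsLocalRing R]
    {V : Type v} [AddCommGroup V] [Module R V] (h : ∀ a ∈ maximalIdeal R, ∀ x : V, a • x = 0)
    (hV : ¬ Module.Finite R V) :
    ∃ (b : ℕ → V) (c : ℕ → V →ₗ[R] R ⧸ maximalIdeal R),
      (∀ i j, c i (b j) = if i = j then 1 else 0) ∧ ∀ x, ∃ i, c i x = 0 := by
  classical
  have hM : Module.IsTorsionBySet R V (maximalIdeal R) := fun x a => h a a.2 x
  let _ := hM.module
  have : IsScalarTower R (R ⧸ maximalIdeal R) V := hM.isScalarTower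
  let _ := Ideal.Quotient.field (maximalIdeal R)
  let B := Module.Basis.ofVectorSpace (R ⧸ maximalIdeal R) V
  have hinf : Infinite (Module.Basis.ofVectorSpaceIndex (R ⧸ maximalIdeal R) V) := by
    by_contra hfin
    rw [not_infinite_iff_finite] at hfin
    have := Module.Finite.of_basis B
    exact hV (Module.Finite.trans (R ⧸ maximalIdeal R) V)
  let e := Infinite.natEmbedding (Module.Basis.ofVectorSpaceIndex (R ⧸ maximalIdeal R) V)
  refine ⟨fun n => B (e n), fun n => (B.coord (e n)).restrictScalars R, fun i j => ?_, fun x => ?_⟩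
  · simp only [LinearMap.coe_restrictScalars, Module.Basis.coord_apply, Module.Basis.repr_self,
      Finsupp.single_apply, e.injective.eq_iff, eq_comm]
  · by_contra! hx
    have : Set.Infinite ((B.repr x).support :
        Set (Module.Basis.ofVectorSpaceIndex (R ⧸ maximalIdeal R) V)) := by
      refine Set.Infinite.mono (s := Set.range e) ?_ (Set.infinite_range_of_injective e.injective)
      rintro _ ⟨n, rfl⟩
      simpa using hx n
    exact this (Finset.finite_toSet _)

/-- In an infinite-dimensional subquotient, the conditions "the first `n` coordinates are 1" define
closed cosets, by semi-discreteness. Any finitely many of them meet, but a common point of all would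
have infinitely many nonzero coordinates. -/
theorem LinCpt.IsLinearlyCompact.socleFinite {R : Type u} [CommRing R] [IsLocalRing R]
    {M : Type v} [AddCommGroup M] [Module R M] [TopologicalSpace M]
    (hlc : LinCpt.IsLinearlyCompact R M) (hsd : LinCpt.IsSemiDiscrete R M) : SocleFinite R M := by
  classical
  intro K L hKL
  by_cases hfin : Module.Finite R (L.map K.mkQ)
  · rw [Module.Finite.iff_fg] at hfin
    obtain ⟨F, hF, hFL, hFe⟩ := Submodule.exists_fg_le_map_eq K.mkQ hfin le_rfl
    refine ⟨F, hF, hFL, fun x hx => ?_⟩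
    have hx' : K.mkQ x ∈ F.map K.mkQ := hFe ▸ Submodule.mem_map_of_mem hx
    obtain ⟨y, hy, hyx⟩ := hx'
    have h3 : x - y ∈ K := by
      rw [← Submodule.Quotient.mk_eq_zero, Submodule.Quotient.mk_sub, sub_eq_zero]
      exact hyx.symm
    rw [← add_sub_cancel y x]
    exact Submodule.add_mem_sup hy h3
  exfalso
  have hkill : ∀ a ∈ maximalIdeal R, ∀ x : L.map K.mkQ, a • x = 0 := by
    rintro a ha ⟨_, y, hy, rfl⟩
    ext
    change a • K.mkQ y = 0
    rw [← map_smul, Submodule.mkQ_apply, Submodule.Quotient.mk_eq_zero]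
    exact hKL (Submodule.smul_mem_smul ha hy)
  obtain ⟨b, c, hbc, hc⟩ := exists_coordinates_of_not_finite hkill hfin
  let π : L →ₗ[R] L.map K.mkQ := K.mkQ.submoduleMap L
  have hπ : Function.Surjective π := K.mkQ.submoduleMap_surjective L
  choose y hy using fun n => hπ (b n)
  let N : ℕ → Submodule R M := fun n => (⨅ i ∈ Finset.range n, (c i ∘ₗ π).ker).map L.subtype
  have hNmem : ∀ n (x : L), (x : M) ∈ N n ↔ ∀ i < n, c i (π x) = 0 := by
    intro n x
    simp [N]
  let u : ℕ → L := fun n => ∑ j ∈ Finset.range n, y j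
  have hu : ∀ n i, i < n → c i (π (u n)) = 1 := by
    intro n i hi
    simp [u, map_sum, hy, hbc, hi]
  let C : ℕ → Set M := fun n => (fun y => (u n : M) + y) '' (N n : Set M)
  have hC : ∀ n (x : M), x ∈ C n ↔ ∃ z : L, (z : M) = x ∧ ∀ i < n, c i (π z) = 1 := by
    intro n x
    constructor
    · rintro ⟨_, ⟨w, hw, rfl⟩, rfl⟩
      refine ⟨u n + w, rfl, fun i hi => ?_⟩
      rw [map_add, map_add, hu n i hi, (hNmem n w).mp ⟨w, hw, rfl⟩ i hi, add_zero]
    · rintro ⟨z, rfl, hz⟩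
      refine ⟨((z - u n : L) : M), (hNmem n _).mpr fun i hi => ?_, by simp⟩
      rw [map_sub, map_sub, hz i hi, hu n i hi, sub_self]
  obtain ⟨x, hx⟩ := hlc.sInter_nonempty (Set.range C)
    (by
      rintro _ ⟨n, rfl⟩
      exact ⟨u n, N n, hsd.isClosed_submodule _, rfl⟩)
    (by
      intro G hG hGfin
      obtain ⟨I, hI⟩ : ∃ I : Set ℕ, I.Finite ∧ G = C '' I := by
        obtain ⟨I, hI, hIe⟩ := Set.exists_subset_image_finite_and.mp
          (⟨G, by rw [Set.image_univ]; exact hG, hGfin, rfl⟩ :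
            ∃ t ⊆ C '' Set.univ, t.Finite ∧ t = G)
        exact ⟨I, hIe.1, hIe.2.symm⟩
      obtain ⟨hIfin, rfl⟩ := hI
      obtain ⟨n, hn⟩ := hIfin.bddAbove
      refine ⟨u n, ?_⟩
      rintro _ ⟨i, hi, rfl⟩
      exact (hC i _).mpr ⟨u n, rfl, fun j hj => hu n j (hj.trans_le (hn hi))⟩)
  have hx' : ∀ n, x ∈ C n := fun n => hx (C n) ⟨n, rfl⟩
  obtain ⟨z, rfl, -⟩ := (hC 0 x).mp (hx' 0)
  obtain ⟨i, hi⟩ := hc (π z)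
  obtain ⟨z', hz', h1⟩ := (hC (i + 1) z).mp (hx' (i + 1))
  rw [Subtype.ext hz', ] at h1
  have := h1 i (Nat.lt_succ_self i)
  rw [hi] at this
  exact zero_ne_one this

/-- As `𝔪` is finitely generated, some `s ∈ 𝔪` has no power sending `y` into `N`. The ideals `(N :
sʲy)` stabilize at some `n`, and `z = sⁿ⁺¹y` works: `bz ∈ N` forces `bsⁿy ∈ N`, so `bz = s(bsⁿy) ∈
𝔪N`. -/
theorem exists_smul_mem_smul_of_not_torsion {R : Type u} [CommRing R] [IsLocalRing R]
    [IsNoetherianRing R] {M : Type v} [AddCommGroup M] [Module R M] {N : Submodule R M} {y : M}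
    (hy : ∀ t : ℕ, ∃ a ∈ maximalIdeal R ^ t, a • y ∉ N) :
    ∃ z : M, z ∉ N ∧ ∀ b : R, b • z ∈ N → b • z ∈ maximalIdeal R • N := by
  classical
  obtain ⟨s, hs, hsy⟩ : ∃ s ∈ maximalIdeal R, ∀ j : ℕ, s ^ j • y ∉ N := by
    by_contra! hcon
    let I : Ideal R := N.comap (LinearMap.toSpanSingleton R M y)
    have hI : maximalIdeal R ≤ I.radical := fun s hs => by
      obtain ⟨j, hj⟩ := hcon s hs
      exact ⟨j, hj⟩
    obtain ⟨t, ht⟩ := Ideal.exists_pow_le_of_le_radical_of_fg hI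
      (IsNoetherian.noetherian (maximalIdeal R))
    obtain ⟨a, ha, hay⟩ := hy t
    exact hay (ht ha)
  let c : ℕ →o Ideal R := ⟨fun j => N.comap (LinearMap.toSpanSingleton R M (s ^ j • y)), by
    refine monotone_nat_of_le_succ fun j r hr => ?_
    change r • s ^ (j + 1) • y ∈ N
    rw [pow_succ', mul_smul, smul_comm]
    exact N.smul_mem s hr⟩
  obtain ⟨n, hn⟩ := monotone_stabilizes_iff_noetherian.mpr (inferInstance : IsNoetherian R R) c
  refine ⟨s • s ^ n • y, ?_, fun b hb => ?_⟩
  · rw [← mul_smul, ← pow_succ']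
    exact hsy _
  · have h1 : b ∈ c (n + 1) := by
      change b • s ^ (n + 1) • y ∈ N
      rwa [pow_succ', mul_smul]
    rw [← hn (n + 1) (Nat.le_succ n)] at h1
    rw [smul_comm]
    exact Submodule.smul_mem_smul hs h1

/-- A socle-finite module over a noetherian local ring is an extension of a torsion module by
a finitely generated module. -/
theorem SocleFinite.exists_fg_torsion_quotient {R : Type u} [CommRing R] [IsLocalRing R]
    [IsNoetherianRing R] {M : Type v} [AddCommGroup M] [Module R M] (hM : SocleFinite R M) :
    ∃ N : Submodule R M, N.FG ∧ ∀ y : M, ∃ t : ℕ, ∀ a ∈ maximalIdeal R ^ t, a • y ∈ N := by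
  classical
  by_contra! hcon
  have step : ∀ N : {N : Submodule R M // N.FG}, ∃ z : M, z ∉ N.1 ∧
      ∀ b : R, b • z ∈ N.1 → b • z ∈ maximalIdeal R • N.1 := fun N => by
    obtain ⟨y, hy⟩ := hcon N.1 N.2
    exact exists_smul_mem_smul_of_not_torsion hy
  choose z hzN hz using step
  -- Adjoining such a `z` again and again gives a strictly increasing chain `Nₙ` of finitely
  -- generated submodules with `Nₙ ∩ 𝔪Nₙ₊₁ = 𝔪Nₙ`. In the union `L`, this gives `Nₙ ∩ 𝔪L = 𝔪Nₙ`.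
  let next : {N : Submodule R M // N.FG} → {N : Submodule R M // N.FG} := fun N =>
    ⟨N.1 ⊔ Submodule.span R {z N}, N.2.sup (Submodule.fg_span_singleton _)⟩
  let c : ℕ → {N : Submodule R M // N.FG} := fun n => next^[n] ⟨⊥, Submodule.fg_bot⟩
  have hc : ∀ n, (c (n + 1)).1 = (c n).1 ⊔ Submodule.span R {z (c n)} := fun n => by
    change (next^[n + 1] _).1 = _
    rw [Function.iterate_succ_apply']
  have hmono : Monotone fun n => (c n).1 := monotone_nat_of_le_succ fun n => by
    rw [hc]; exact le_sup_left
  have hstep : ∀ n x, x ∈ (c n).1 → x ∈ maximalIdeal R • (c (n + 1)).1 →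
      x ∈ maximalIdeal R • (c n).1 := by
    intro n x hx hx'
    rw [hc, Submodule.smul_sup, Submodule.mem_sup] at hx'
    obtain ⟨a, ha, w, hw, rfl⟩ := hx'
    have hw' : w ∈ Submodule.span R {z (c n)} := Submodule.smul_le_right hw
    obtain ⟨b, rfl⟩ := Submodule.mem_span_singleton.mp hw'
    refine add_mem ha (hz _ b ?_)
    rw [← add_sub_cancel_left a (b • z (c n))]
    exact sub_mem hx (Submodule.smul_le_right ha)
  have hstep' : ∀ n k x, x ∈ (c n).1 → x ∈ maximalIdeal R • (c (n + k)).1 →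
      x ∈ maximalIdeal R • (c n).1 := by
    intro n k x hx
    induction k with
    | zero => exact id
    | succ k ih => exact fun hx' => ih (hstep (n + k) x (hmono (Nat.le_add_right n k) hx) hx')
  set L := ⨆ n, (c n).1 with hL
  obtain ⟨F, hF, hFL, hLF⟩ := hM (maximalIdeal R • L) L le_rfl
  have hdir : Directed (· ≤ ·) fun n => (c n).1 := hmono.directed_le
  obtain ⟨n, hn⟩ : ∃ n, F ≤ (c n).1 := by
    obtain ⟨_, ⟨n, rfl⟩, hn⟩ := (Submodule.fg_iff_compact F).mp hF _ L (Set.range_nonempty _)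
      hdir.directedOn_range isLUB_iSup hFL
    exact ⟨n, hn⟩
  have hLm : ∀ x ∈ maximalIdeal R • L, ∃ k, x ∈ maximalIdeal R • (c k).1 := by
    intro x hx
    have hd : Directed (· ≤ ·) fun n => maximalIdeal R • (c n).1 :=
      Monotone.directed_le fun i j h => smul_mono_right _ (hmono h)
    rw [hL, Submodule.smul_iSup] at hx
    exact (Submodule.mem_iSup_of_directed _ hd).mp hx
  -- Socle-finiteness makes `L/𝔪L` finite-dimensional, so a single `Nₙ` spans it; Nakayama's lemma
  -- then contradicts strictness at the next step.
  have hle : (c (n + 1)).1 ≤ (c n).1 ⊔ maximalIdeal R • (c (n + 1)).1 := by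
    intro x hx
    obtain ⟨f, hf, y, hy, rfl⟩ := Submodule.mem_sup.mp (hLF ((le_iSup (fun n => (c n).1) _) hx))
    refine Submodule.add_mem_sup (hn hf) ?_
    obtain ⟨k, hk⟩ := hLm y hy
    have hy' : y ∈ (c (n + 1)).1 := by
      rw [← add_sub_cancel_left f y]
      exact sub_mem hx (hmono (Nat.le_succ n) (hn hf))
    exact hstep' (n + 1) k y hy'
      ((smul_mono_right (maximalIdeal R) (hmono (by omega : k ≤ n + 1 + k))) hk)
  have hfin : (c (n + 1)).1 ≤ (c n).1 :=
    Submodule.le_of_le_smul_of_le_jacobson_bot (c (n + 1)).2 (jacobson_eq_maximalIdeal ⊥ bot_ne_top).ge hle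
  refine hzN (c n) (hfin ?_)
  rw [hc]
  exact Submodule.mem_sup_right (Submodule.mem_span_singleton_self _)

end

/-! ### Noetherian dimension bounded by natural numbers -/

section

open IsLocalRing

namespace Submodule

variable {R : Type u} [CommRing R] {M : Type v} {N : Type w}
  [AddCommGroup M] [Module R M] [AddCommGroup N] [Module R N]

/-- The map induced on subquotients by a linear map. -/
def subquotientMap (f : M →ₗ[R] N) {K L : Submodule R M} {K' L' : Submodule R N}
    (hL : ∀ x ∈ L, f x ∈ L') (hK : ∀ x ∈ L, x ∈ K → f x ∈ K') :
    (L ⧸ K.submoduleOf L) →ₗ[R] L' ⧸ K'.submoduleOf L' :=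
  mapQ _ _ (f.restrict hL) fun x hx => hK x x.2 hx

theorem subquotientMap_mk (f : M →ₗ[R] N) {K L : Submodule R M} {K' L' : Submodule R N}
    (hL : ∀ x ∈ L, f x ∈ L') (hK : ∀ x ∈ L, x ∈ K → f x ∈ K') (x : L) :
    subquotientMap f hL hK (Quotient.mk x) = Quotient.mk ⟨f x, hL x x.2⟩ :=
  rfl

theorem subquotient_mk_eq_zero {K L : Submodule R M} (x : L) :
    (Quotient.mk x : L ⧸ K.submoduleOf L) = 0 ↔ (x : M) ∈ K := by
  rw [Quotient.mk_eq_zero]; rfl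

theorem subquotientMap_injective (f : M →ₗ[R] N) {K L : Submodule R M} {K' L' : Submodule R N}
    (hL : ∀ x ∈ L, f x ∈ L') (hK : ∀ x ∈ L, x ∈ K → f x ∈ K')
    (h : ∀ x ∈ L, f x ∈ K' → x ∈ K) : Function.Injective (subquotientMap f hL hK) := by
  rw [injective_iff_map_eq_zero]
  intro q hq
  induction q using Quotient.induction_on with | _ x
  rw [subquotientMap_mk, subquotient_mk_eq_zero] at hq
  rw [subquotient_mk_eq_zero]
  exact h x x.2 hq

theorem subquotientMap_surjective (f : M →ₗ[R] N) {K L : Submodule R M} {K' L' : Submodule R N}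
    (hL : ∀ x ∈ L, f x ∈ L') (hK : ∀ x ∈ L, x ∈ K → f x ∈ K')
    (h : ∀ y ∈ L', ∃ x ∈ L, y - f x ∈ K') : Function.Surjective (subquotientMap f hL hK) := by
  intro q
  induction q using Quotient.induction_on with | _ y
  obtain ⟨x, hx, hxy⟩ := h y y.2
  refine ⟨Quotient.mk ⟨x, hx⟩, ?_⟩
  rw [subquotientMap_mk, eq_comm, ← sub_eq_zero, ← Quotient.mk_sub, subquotient_mk_eq_zero]
  exact hxy

theorem subsingleton_subquotient_iff {K L : Submodule R M} :
    Subsingleton (L ⧸ K.submoduleOf L) ↔ L ≤ K := by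
  rw [Submodule.Quotient.subsingleton_iff, Submodule.submoduleOf_eq_top]

end Submodule

/-- `NdimLT R n M` says that the Noetherian dimension of `M` is smaller than the natural
number `n`. -/
def NdimLT (R : Type u) [CommRing R] : ℕ → ∀ (M : Type v) [AddCommGroup M] [Module R M], Prop
  | 0, M, _, _ => Subsingleton M
  | n + 1, M, _, _ => ∀ c : ℕ →o Submodule R M, ∃ m₀ : ℕ, ∀ m ≥ m₀,
      NdimLT R n (c (m + 1) ⧸ (c m).submoduleOf (c (m + 1)))

namespace NdimLT

open Submodule

variable {R : Type u} [CommRing R] {n : ℕ} {M N P : Type v}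
  [AddCommGroup M] [Module R M] [AddCommGroup N] [Module R N] [AddCommGroup P] [Module R P]

theorem of_injective (hM : NdimLT R n M) (f : N →ₗ[R] M) (hf : Function.Injective f) :
    NdimLT R n N := by
  induction n generalizing M N with
  | zero =>
    have : Subsingleton M := hM
    exact hf.subsingleton
  | succ n ih =>
    intro c
    obtain ⟨m₀, h⟩ := hM ⟨fun m => (c m).map f, fun i j hij => map_mono (c.monotone hij)⟩
    refine ⟨m₀, fun m hm => ih (h m hm)
      (subquotientMap f (fun x hx => mem_map_of_mem hx) fun x _ hx => mem_map_of_mem hx)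
      (subquotientMap_injective f _ _ fun x _ hx => ?_)⟩
    obtain ⟨y, hy, hyx⟩ := hx
    exact hf hyx ▸ hy

theorem of_surjective (hM : NdimLT R n M) (f : M →ₗ[R] N) (hf : Function.Surjective f) :
    NdimLT R n N := by
  induction n generalizing M N with
  | zero =>
    have : Subsingleton M := hM
    exact hf.subsingleton
  | succ n ih =>
    intro c
    obtain ⟨m₀, h⟩ := hM ⟨fun m => (c m).comap f, fun i j hij => comap_mono (c.monotone hij)⟩
    refine ⟨m₀, fun m hm => ih (h m hm)
      (subquotientMap f (fun x hx => hx) fun x _ hx => hx)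
      (subquotientMap_surjective f _ _ fun y hy => ?_)⟩
    obtain ⟨x, rfl⟩ := hf y
    exact ⟨x, hy, by simp⟩

/-- A chain in `N` is pulled back to `M` and pushed forward to `P`; its successive quotients then
sit in exact sequences of the same kind, to which the induction applies. -/
theorem of_exact (hM : NdimLT R n M) (hP : NdimLT R n P) (f : M →ₗ[R] N) (g : N →ₗ[R] P)
    (hfg : Function.Exact f g) : NdimLT R n N := by
  induction n generalizing M N P with
  | zero =>
    have : Subsingleton M := hM
    have : Subsingleton P := hP
    refine (subsingleton_iff_forall_eq 0).mpr fun x => ?_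
    obtain ⟨y, rfl⟩ := (hfg x).mp (Subsingleton.elim _ _)
    rw [Subsingleton.elim y 0, map_zero]
  | succ n ih =>
    intro c
    obtain ⟨m₀, h⟩ := hM ⟨fun m => (c m).comap f, fun i j hij => comap_mono (c.monotone hij)⟩
    obtain ⟨m₁, h'⟩ := hP ⟨fun m => (c m).map g, fun i j hij => map_mono (c.monotone hij)⟩
    refine ⟨max m₀ m₁, fun m hm => ih (h m (le_trans (le_max_left _ _) hm))
      (h' m (le_trans (le_max_right _ _) hm))
      (subquotientMap f (fun x hx => hx) fun x _ hx => hx)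
      (subquotientMap g (fun x hx => mem_map_of_mem hx) fun x _ hx => mem_map_of_mem hx)
      fun q => ?_⟩
    induction q using Quotient.induction_on with | _ x
    rw [subquotientMap_mk, subquotient_mk_eq_zero]
    constructor
    · rintro ⟨y, hy, hyx⟩
      obtain ⟨a, ha⟩ := (hfg (x - y)).mp (by rw [map_sub, sub_eq_zero]; exact hyx.symm)
      have hac : f a ∈ c (m + 1) := ha ▸ sub_mem x.2 (c.monotone (Nat.le_succ m) hy)
      refine ⟨Submodule.Quotient.mk ⟨a, hac⟩, ?_⟩
      rw [subquotientMap_mk, ← sub_eq_zero, ← Quotient.mk_sub, subquotient_mk_eq_zero]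
      change f a - x ∈ c m
      rw [ha, sub_sub_cancel_left]
      exact neg_mem hy
    · rintro ⟨q, hq⟩
      induction q using Quotient.induction_on with | _ a
      rw [subquotientMap_mk, ← sub_eq_zero, ← Quotient.mk_sub, subquotient_mk_eq_zero] at hq
      refine ⟨x - f a, ?_, ?_⟩
      · have := neg_mem hq
        simpa using this
      · rw [map_sub, hfg.apply_apply_eq_zero, sub_zero]

theorem of_subsingleton [Subsingleton M] : NdimLT R n M := by
  cases n with
  | zero => exact ‹Subsingleton M›
  | succ n =>
    induction n generalizing M with
    | zero => exact fun c => ⟨0, fun m _ => (Submodule.Quotient.mk_surjective _).subsingleton⟩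
    | succ n ih =>
      refine fun c => ⟨0, fun m _ => ?_⟩
      have : Subsingleton (c (m + 1) ⧸ (c m).submoduleOf (c (m + 1))) :=
        (Submodule.Quotient.mk_surjective _).subsingleton
      exact ih

theorem succ (hM : NdimLT R n M) : NdimLT R (n + 1) M := by
  induction n generalizing M with
  | zero =>
    have : Subsingleton M := hM
    exact of_subsingleton
  | succ n ih =>
    intro c
    obtain ⟨m₀, h⟩ := hM c
    exact ⟨m₀, fun m hm => ih (h m hm)⟩

theorem mono {k : ℕ} (hM : NdimLT R n M) (h : n ≤ k) : NdimLT R k M := by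
  induction h with
  | refl => exact hM
  | step _ ih => exact ih.succ

theorem one_iff : NdimLT R 1 M ↔ IsNoetherian R M := by
  rw [← monotone_stabilizes_iff_noetherian]
  have h1 : NdimLT R 1 M ↔ ∀ c : ℕ →o Submodule R M, ∃ m₀ : ℕ, ∀ m ≥ m₀, c (m + 1) ≤ c m := by
    refine forall_congr' fun c => exists_congr fun m₀ => forall_congr' fun m => ?_
    exact imp_congr_right fun _ => subsingleton_subquotient_iff
  rw [h1]
  refine forall_congr' fun c => exists_congr fun m₀ => ⟨fun h m hm => ?_, fun h m hm => ?_⟩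
  · induction hm with
    | refl => rfl
    | step hm ih => exact ih.trans (le_antisymm (c.monotone (Nat.le_succ _)) (h _ hm))
  · rw [← h m hm, ← h (m + 1) (by omega)]

end NdimLT

theorem WithBot.lt_natCast_ordinal {β : WithBot Ordinal.{v}} {n : ℕ} (h : β < n) :
    β = ⊥ ∨ ∃ k < n, β = (k : ℕ) := by
  induction β using WithBot.recBotCoe with
  | bot => exact Or.inl rfl
  | coe o =>
    right
    have h' : o < (n : Ordinal) := WithBot.coe_lt_coe.mp h
    obtain ⟨k, rfl⟩ := Ordinal.lt_omega0.mp (h'.trans (Ordinal.natCast_lt_omega0 n))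
    exact ⟨k, by exact_mod_cast h', rfl⟩

namespace LinCpt

variable {R : Type u} [CommRing R] {M : Type v} [AddCommGroup M] [Module R M]

theorem hasNdim_bot : HasNdim R M ⊥ ↔ Subsingleton M := by
  rw [HasNdim]
  simp

/-- Below a natural number the only possible values are `⊥` and smaller naturals, so the ordinal
recursion collapses to strong induction. The actual value is one less than the least `k` with
`NdimLT R k M`, where `k = 0` corresponds to `⊥`. -/
theorem exists_hasNdim_lt_natCast {n : ℕ} :
    (∃ (β : WithBot Ordinal.{v}) (_ : β < (n : ℕ)), HasNdim R M β) ↔ NdimLT R n M := by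
  induction n using Nat.strong_induction_on generalizing M with
  | _ n ih =>
    have hnat : ∀ k < n, HasNdim R M (k : ℕ) ↔ NdimLT R (k + 1) M ∧ ¬ NdimLT R k M := by
      intro k hk
      rw [HasNdim]
      have hne : ((k : ℕ) : WithBot Ordinal.{v}) ≠ ⊥ := WithBot.coe_ne_bot
      simp only [hne, false_and, false_or, ne_eq, not_false_eq_true, true_and, ih k hk]
      exact and_comm
    constructor
    · rintro ⟨β, hβ, h⟩
      rcases WithBot.lt_natCast_ordinal hβ with rfl | ⟨k, hk, rfl⟩
      · have := hasNdim_bot.mp h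
        exact NdimLT.of_subsingleton
      · exact ((hnat k hk).mp h).1.mono hk
    · intro h
      classical
      have hex : ∃ k, NdimLT R k M := ⟨n, h⟩
      have hle := Nat.find_min' hex h
      have hspec := Nat.find_spec hex
      rcases hk : Nat.find hex with _ | k
      · rw [hk] at hspec
        exact ⟨⊥, WithBot.bot_lt_coe _, hasNdim_bot.mpr hspec⟩
      · rw [hk] at hspec hle
        refine ⟨(k : ℕ), by exact_mod_cast hle, (hnat k hle).mpr ⟨hspec, ?_⟩⟩
        exact Nat.find_min hex (by omega)

theorem hasNdim_natCast {n : ℕ} :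
    HasNdim R M (n : ℕ) ↔ NdimLT R (n + 1) M ∧ ¬ NdimLT R n M := by
  rw [HasNdim]
  have hne : ((n : ℕ) : WithBot Ordinal.{v}) ≠ ⊥ := WithBot.coe_ne_bot
  simp only [hne, false_and, false_or, ne_eq, not_false_eq_true, true_and,
    exists_hasNdim_lt_natCast]
  exact and_comm

end LinCpt

/-! ### Noetherian dimension and multiplication by an element -/

section Multiplication

open Submodule

variable {R : Type u} [CommRing R] {A : Type v} [AddCommGroup A] [Module R A]

/-- Multiplication by `xⁿ` maps `A[xⁿ⁺¹]` to `A[x]` with kernel `A[xⁿ]`. -/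
theorem NdimLT.torsionBy_pow {e : ℕ} {x : R} (h : NdimLT R e (torsionBy R A x)) (n : ℕ) :
    NdimLT R e (torsionBy R A (x ^ n)) := by
  induction n with
  | zero =>
    have : Subsingleton (torsionBy R A (x ^ 0)) := by
      refine (subsingleton_iff_forall_eq 0).mpr fun y => Subtype.ext ?_
      simpa using y.2
    exact of_subsingleton
  | succ n ih =>
    have h1 : torsionBy R A (x ^ n) ≤ torsionBy R A (x ^ (n + 1)) := fun y hy => by
      rw [mem_torsionBy_iff] at hy ⊢
      rw [pow_succ', mul_smul, hy, smul_zero]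
    let g : torsionBy R A (x ^ (n + 1)) →ₗ[R] torsionBy R A x :=
      (LinearMap.lsmul R A (x ^ n)).restrict fun y hy => by
        rw [mem_torsionBy_iff] at hy ⊢
        rw [LinearMap.lsmul_apply, ← mul_smul, ← pow_succ', hy]
    refine ih.of_exact h (inclusion h1) g fun y => ⟨fun hy => ?_, ?_⟩
    · exact ⟨⟨y, congrArg Subtype.val hy⟩, rfl⟩
    · rintro ⟨z, rfl⟩
      exact Subtype.ext z.2

/-- The largest candidate for an `x`-divisible submodule of `N`. -/
def divisiblePart (x : R) (N : Submodule R A) : Submodule R A :=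
  ⨅ n : ℕ, N.map (LinearMap.lsmul R A (x ^ n))

theorem divisiblePart_mono (x : R) {N N' : Submodule R A} (h : N ≤ N') :
    divisiblePart x N ≤ divisiblePart x N' :=
  iInf_mono fun _ => map_mono h

theorem divisiblePart_le (x : R) (N : Submodule R A) : divisiblePart x N ≤ N := by
  refine (iInf_le _ 0).trans ?_
  rintro _ ⟨y, hy, rfl⟩
  simpa using hy

theorem exists_divisiblePart_eq [IsArtinian R A] (x : R) (N : Submodule R A) :
    ∃ n, ∀ m ≥ n, divisiblePart x N = N.map (LinearMap.lsmul R A (x ^ m)) := by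
  have hanti : Antitone fun n : ℕ => N.map (LinearMap.lsmul R A (x ^ n)) := by
    refine antitone_nat_of_succ_le fun n => ?_
    rintro _ ⟨y, hy, rfl⟩
    refine ⟨x • y, N.smul_mem x hy, ?_⟩
    simp only [LinearMap.lsmul_apply]
    rw [← mul_smul, ← pow_succ]
  obtain ⟨n, hn⟩ := IsArtinian.monotone_stabilizes
    (⟨fun n => OrderDual.toDual (N.map (LinearMap.lsmul R A (x ^ n))), fun _ _ h => hanti h⟩ :
      ℕ →o (Submodule R A)ᵒᵈ)
  refine ⟨n, fun m hm => le_antisymm (iInf_le _ m) (le_iInf fun k => ?_)⟩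
  rcases le_total k m with hkm | hkm
  · exact hanti hkm
  · have h1 : N.map (LinearMap.lsmul R A (x ^ n)) = N.map (LinearMap.lsmul R A (x ^ m)) :=
      congrArg OrderDual.ofDual (hn m hm)
    have h2 : N.map (LinearMap.lsmul R A (x ^ n)) = N.map (LinearMap.lsmul R A (x ^ k)) :=
      congrArg OrderDual.ofDual (hn k (hm.trans hkm))
    exact (h1.symm.trans h2).le

theorem exists_smul_eq_of_mem_divisiblePart [IsArtinian R A] {x : R} {N : Submodule R A} {b : A}
    (hb : b ∈ divisiblePart x N) : ∃ b' ∈ divisiblePart x N, x • b' = b := by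
  obtain ⟨n, hn⟩ := exists_divisiblePart_eq x N
  rw [hn (n + 1) (Nat.le_succ n)] at hb
  obtain ⟨y, hy, rfl⟩ := hb
  refine ⟨x ^ n • y, ?_, ?_⟩
  · rw [hn n le_rfl]
    exact ⟨y, hy, rfl⟩
  · rw [← mul_smul, ← pow_succ']; rfl

/-- A Fitting decomposition. When the images `xᵐN` are stationary from `n` on, `xⁿa = x²ⁿy` for some
`y ∈ N`, and `a - xⁿy` is killed by `xⁿ`. -/
theorem exists_sub_mem_torsionBy_pow [IsArtinian R A] (x : R) (N : Submodule R A) :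
    ∃ n : ℕ, ∀ a ∈ N, ∃ b ∈ divisiblePart x N, a - b ∈ torsionBy R A (x ^ n) := by
  obtain ⟨n, hn⟩ := exists_divisiblePart_eq x N
  refine ⟨n, fun a ha => ?_⟩
  have h1 : x ^ n • a ∈ N.map (LinearMap.lsmul R A (x ^ (n + n))) := by
    rw [← hn (n + n) (by omega), hn n le_rfl]
    exact ⟨a, ha, rfl⟩
  obtain ⟨y, hy, hya⟩ := h1
  refine ⟨x ^ n • y, by rw [hn n le_rfl]; exact ⟨y, hy, rfl⟩, ?_⟩
  rw [mem_torsionBy_iff, smul_sub, ← hya, ← mul_smul, ← pow_add, LinearMap.lsmul_apply, sub_self]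

theorem NdimLT.quotient_of_divisiblePart_le [IsArtinian R A] {e : ℕ} {x : R}
    (h : NdimLT R e (torsionBy R A x)) {N K : Submodule R A} (hK : divisiblePart x N ≤ K) :
    NdimLT R e (N ⧸ K.submoduleOf N) := by
  obtain ⟨n, hn⟩ := exists_sub_mem_torsionBy_pow x N
  let L : Submodule R A := N ⊓ torsionBy R A (x ^ n)
  have h1 : NdimLT R e L := (h.torsionBy_pow n).of_injective (inclusion inf_le_right)
    (inclusion_injective _)
  have h2 : NdimLT R e (L ⧸ K.submoduleOf L) := h1.of_surjective _ (mkQ_surjective _)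
  refine h2.of_surjective (subquotientMap LinearMap.id (fun y hy => hy.1) fun y _ hy => hy)
    (subquotientMap_surjective _ _ _ fun a ha => ?_)
  obtain ⟨b, hb, hab⟩ := hn a ha
  refine ⟨a - b, ⟨sub_mem ha (divisiblePart_le x N hb), hab⟩, ?_⟩
  simpa using hK hb

theorem NdimLT.quotient_smul [IsArtinian R A] {e : ℕ} {x : R}
    (h : NdimLT R e (torsionBy R A x)) : NdimLT R e (A ⧸ (LinearMap.lsmul R A x).range) := by
  have h1 := h.quotient_of_divisiblePart_le (N := ⊤) (K := (LinearMap.lsmul R A x).range) (by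
    refine (iInf_le _ 1).trans ?_
    rw [pow_one]
    exact LinearMap.map_le_range)
  refine h1.of_surjective (mapQ _ _ (Submodule.subtype ⊤) fun y hy => hy) ?_
  intro q
  induction q using Submodule.Quotient.induction_on with | _ y
  exact ⟨Submodule.Quotient.mk ⟨y, trivial⟩, rfl⟩

/-- Cutting down by `x` lowers the dimension by at most one. In a chain `cⱼ` with `x`-divisible
parts `Dⱼ`, the quotient of `cₘ₊₁` by `Dₘ₊₁ + cₘ` is controlled by the Fitting decomposition, and
`Dₘ₊₁/Dₘ` by induction on `e`, through its `x`-torsion. -/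
theorem NdimLT.succ_of_torsionBy {e : ℕ} [IsArtinian R A] {x : R}
    (htors : ∀ a : A, ∃ n : ℕ, x ^ n • a = 0) (h : NdimLT R e (torsionBy R A x)) :
    NdimLT R (e + 1) A := by
  induction e generalizing A with
  | zero =>
    have hsub : Subsingleton (torsionBy R A x) := h
    have : Subsingleton A := by
      refine (subsingleton_iff_forall_eq 0).mpr fun a => ?_
      obtain ⟨n, hn⟩ := htors a
      induction n with
      | zero => simpa using hn
      | succ n ih =>
        refine ih ?_
        rw [pow_succ', mul_smul] at hn
        exact congrArg Subtype.val (Subsingleton.elim (⟨x ^ n • a, hn⟩ : torsionBy R A x) 0)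
    exact of_subsingleton
  | succ e ih =>
    intro c
    let D : ℕ → Submodule R A := fun j => divisiblePart x (c j)
    have hD : Monotone D := fun i j hij => divisiblePart_mono x (c.monotone hij)
    obtain ⟨m₀, hm₀⟩ := h ⟨fun j => (D j).comap (torsionBy R A x).subtype,
      fun i j hij => comap_mono (hD hij)⟩
    refine ⟨m₀, fun m hm => ?_⟩
    have h1 := hm₀ m hm
    let Q := D (m + 1) ⧸ (D m).submoduleOf (D (m + 1))
    have hQ : NdimLT R e (torsionBy R Q x) := by
      let L := (D (m + 1)).comap (torsionBy R A x).subtype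
      let K := (D m).comap (torsionBy R A x).subtype
      let f : (L ⧸ K.submoduleOf L) →ₗ[R] Q :=
        subquotientMap (torsionBy R A x).subtype (fun y hy => hy) fun y _ hy => hy
      have hf : ∀ q, f q ∈ torsionBy R Q x := by
        intro q
        induction q using Submodule.Quotient.induction_on with | _ y
        rw [mem_torsionBy_iff, ← map_smul, ← Submodule.Quotient.mk_smul]
        have : x • y = 0 := Subtype.ext (Subtype.ext y.1.2)
        rw [this, Submodule.Quotient.mk_zero, map_zero]
      refine h1.of_surjective (f.codRestrict _ hf) ?_
      rintro ⟨q, hq⟩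
      induction q using Submodule.Quotient.induction_on with | _ b
      rw [mem_torsionBy_iff, ← Submodule.Quotient.mk_smul, subquotient_mk_eq_zero] at hq
      -- Divisibility of `Dₘ` allows the representative `b` to be corrected to one that `x` kills,
      -- so that the `x`-torsion of `Dₘ₊₁/Dₘ` comes from `Dₘ₊₁ ∩ A[x]`.
      obtain ⟨b', hb', hxb'⟩ := exists_smul_eq_of_mem_divisiblePart hq
      have hmem : (b : A) - b' ∈ torsionBy R A x := by
        rw [mem_torsionBy_iff, smul_sub, hxb', sub_eq_zero]; rfl
      refine ⟨Submodule.Quotient.mk ⟨⟨b - b', hmem⟩, sub_mem b.2 (hD (Nat.le_succ m) hb')⟩,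
        Subtype.ext ?_⟩
      change Submodule.Quotient.mk _ = Submodule.Quotient.mk _
      rw [← sub_eq_zero, ← Submodule.Quotient.mk_sub, subquotient_mk_eq_zero]
      change (b : A) - b' - b ∈ D m
      rw [sub_sub_cancel_left]
      exact neg_mem hb'
    have hQ' : NdimLT R (e + 1) Q := by
      refine ih (fun q => ?_) hQ
      induction q using Submodule.Quotient.induction_on with | _ b
      obtain ⟨n, hn⟩ := htors b
      refine ⟨n, ?_⟩
      rw [← Submodule.Quotient.mk_smul, subquotient_mk_eq_zero]
      change x ^ n • (b : A) ∈ D m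
      rw [hn]
      exact zero_mem _
    have hle : c m ≤ c (m + 1) := c.monotone (Nat.le_succ m)
    have h3 := h.quotient_of_divisiblePart_le (N := c (m + 1)) (K := D (m + 1) ⊔ c m) le_sup_left
    refine hQ'.of_exact h3
      (subquotientMap LinearMap.id (fun y hy => divisiblePart_le _ _ hy)
        fun y _ hy => divisiblePart_le _ _ hy)
      (subquotientMap LinearMap.id (fun y hy => hy) fun y _ hy => mem_sup_right hy)
      fun q => ?_
    induction q using Submodule.Quotient.induction_on with | _ y
    rw [subquotientMap_mk, subquotient_mk_eq_zero]
    constructor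
    · intro hy
      obtain ⟨d, hd, z, hz, hdz⟩ := Submodule.mem_sup.mp hy
      refine ⟨Submodule.Quotient.mk ⟨d, hd⟩, ?_⟩
      rw [subquotientMap_mk, ← sub_eq_zero, ← Submodule.Quotient.mk_sub, subquotient_mk_eq_zero]
      change d - (y : A) ∈ c m
      have : d - (y : A) = - z := by
        rw [← show d + z = (y : A) from hdz]; abel
      rw [this]
      exact neg_mem hz
    · rintro ⟨q, hq⟩
      induction q using Submodule.Quotient.induction_on with | _ d
      rw [subquotientMap_mk, ← sub_eq_zero, ← Submodule.Quotient.mk_sub,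
        subquotient_mk_eq_zero] at hq
      have h4 : (y : A) = d - (d - y) := by abel
      change (y : A) ∈ _
      rw [h4]
      exact sub_mem (mem_sup_left d.2) (mem_sup_right hq)

/-- In the chain `A[x] ⊆ A[x²] ⊆ …`, every successive quotient maps onto `A[x]` by a power of `x`,
so one quotient of small dimension suffices. -/
theorem NdimLT.torsionBy_of_smul_surjective {d : ℕ} {x : R}
    (hx : Function.Surjective (LinearMap.lsmul R A x)) (h : NdimLT R (d + 1) A) :
    NdimLT R d (torsionBy R A x) := by
  have hmono : Monotone fun n : ℕ => torsionBy R A (x ^ n) :=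
    monotone_nat_of_le_succ fun n y hy => by
      rw [mem_torsionBy_iff] at hy ⊢
      rw [pow_succ', mul_smul, hy, smul_zero]
  have hpow : ∀ n, Function.Surjective (LinearMap.lsmul R A (x ^ n)) := by
    intro n
    induction n with
    | zero => exact fun a => ⟨a, by simp⟩
    | succ n ih =>
      intro a
      obtain ⟨b, rfl⟩ := ih a
      obtain ⟨c, rfl⟩ := hx b
      exact ⟨c, by rw [pow_succ, LinearMap.lsmul_apply, mul_smul]; rfl⟩
  obtain ⟨m, hm⟩ := h ⟨_, hmono⟩
  let f : torsionBy R A (x ^ (m + 1)) →ₗ[R] torsionBy R A x :=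
    (LinearMap.lsmul R A (x ^ m)).restrict fun y hy => by
      rw [mem_torsionBy_iff] at hy ⊢
      rw [LinearMap.lsmul_apply, ← mul_smul, ← pow_succ', hy]
  refine (hm m le_rfl).of_surjective (liftQ _ f fun y hy => Subtype.ext hy) ?_
  rintro ⟨y, hy⟩
  obtain ⟨z, rfl⟩ := hpow m y
  refine ⟨Submodule.Quotient.mk ⟨z, ?_⟩, rfl⟩
  change x ^ (m + 1) • z = 0
  rw [mem_torsionBy_iff] at hy
  rwa [pow_succ', mul_smul]

end Multiplication

/-! ### Artinian modules over a noetherian local ring -/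

section Local

open Submodule

variable {R : Type u} [CommRing R] [IsLocalRing R] {A : Type v} [AddCommGroup A] [Module R A]

theorem isNoetherian_of_isArtinian_of_smul_eq_zero [IsNoetherianRing R] [IsArtinian R A]
    (h : ∀ a ∈ maximalIdeal R, ∀ x : A, a • x = 0) : IsNoetherian R A := by
  have hM : Module.IsTorsionBySet R A (maximalIdeal R) := fun x a => h a a.2 x
  let _ := hM.module
  have : IsScalarTower R (R ⧸ maximalIdeal R) A := hM.isScalarTower
  let _ := Ideal.Quotient.field (maximalIdeal R)
  have : IsArtinian (R ⧸ maximalIdeal R) A := isArtinian_of_tower R inferInstance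
  have : Module.Finite (R ⧸ maximalIdeal R) A := (IsSemisimpleModule.finite_tfae.out 0 2).mpr this
  have : Module.Finite R A := Module.Finite.trans (R ⧸ maximalIdeal R) A
  exact isNoetherian_of_isNoetherianRing_of_finite R A

variable [IsNoetherianRing R]

/-- The chain `𝔪ᵗ·Rx` becomes stationary, and Nakayama's lemma makes the stationary member zero. -/
theorem IsArtinian.exists_pow_smul_eq_zero [IsArtinian R A] (x : A) :
    ∃ t : ℕ, ∀ a ∈ maximalIdeal R ^ t, a • x = 0 := by
  have hanti : Antitone fun t : ℕ => maximalIdeal R ^ t • span R {x} :=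
    fun i j h => smul_mono_left (Ideal.pow_le_pow_right h)
  obtain ⟨t, ht⟩ := IsArtinian.monotone_stabilizes
    (⟨fun t => OrderDual.toDual (maximalIdeal R ^ t • span R {x}), fun _ _ h => hanti h⟩ :
      ℕ →o (Submodule R A)ᵒᵈ)
  have h1 : maximalIdeal R ^ t • span R {x} = maximalIdeal R ^ (t + 1) • span R {x} :=
    congrArg OrderDual.ofDual (ht (t + 1) (Nat.le_succ t))
  have h2 : maximalIdeal R ^ t • span R {x} = ⊥ := by
    refine eq_bot_of_le_smul_of_le_jacobson_bot (maximalIdeal R) _ ?_ ?_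
      (jacobson_eq_maximalIdeal ⊥ bot_ne_top).ge
    · exact FG.smul (IsNoetherian.noetherian _) (fg_span_singleton x)
    · rw [← mul_smul, ← pow_succ', ← h1]
  refine ⟨t, fun a ha => ?_⟩
  rw [← mem_bot R, ← h2]
  exact smul_mem_smul ha (mem_span_singleton_self x)

/-- Generators of `𝔪` are used one at a time, each costing at most one dimension. What remains is
the socle, which is Noetherian. -/
theorem IsArtinian.exists_ndimLT [IsArtinian R A] : ∃ n, NdimLT R n A := by
  have key : ∀ (l : List R), (∀ x ∈ l, x ∈ maximalIdeal R) → ∀ (A : Type v) [AddCommGroup A]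
      [Module R A] [IsArtinian R A], NdimLT R 1 (torsionBySet R A {x | x ∈ l}) →
      NdimLT R (l.length + 1) A := by
    intro l
    induction l with
    | nil =>
      intro _ A _ _ _ h
      refine h.of_surjective (Submodule.subtype _) fun a => ⟨⟨a, ?_⟩, rfl⟩
      simp [mem_torsionBySet_iff]
    | cons x l ih =>
      intro hl A _ _ _ h
      refine NdimLT.succ_of_torsionBy (x := x) (fun a => ?_)
        (ih (fun y hy => hl y (List.mem_cons_of_mem _ hy)) _ ?_)
      · obtain ⟨t, ht⟩ := IsArtinian.exists_pow_smul_eq_zero (R := R) a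
        exact ⟨t, ht _ (Ideal.pow_mem_pow (hl x List.mem_cons_self) t)⟩
      · refine h.of_injective (((torsionBy R A x).subtype ∘ₗ Submodule.subtype _).codRestrict _
          fun y => ?_) fun y z hyz => Subtype.ext (Subtype.ext ?_)
        · rw [mem_torsionBySet_iff]
          rintro ⟨r, hr⟩
          rcases List.mem_cons.mp hr with rfl | hr
          · exact y.1.2
          · have := (mem_torsionBySet_iff _ _).mp y.2 ⟨r, hr⟩
            exact congrArg Subtype.val this
        · have := congrArg Subtype.val hyz
          exact this
  obtain ⟨s, hs⟩ := (IsNoetherian.noetherian (maximalIdeal R) : (maximalIdeal R).FG)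
  refine ⟨_, key s.toList (fun x hx => ?_) A ?_⟩
  · rw [← hs]
    exact subset_span (Finset.mem_toList.mp hx)
  · rw [NdimLT.one_iff]
    refine isNoetherian_of_isArtinian_of_smul_eq_zero fun a ha y => Subtype.ext ?_
    have h1 : (y : A) ∈ torsionBySet R A (span R (s : Set R) : Ideal R) := by
      rw [← torsionBySet_eq_torsionBySet_span]
      have := y.2
      simpa [Finset.mem_toList] using this
    rw [hs] at h1
    exact (mem_torsionBySet_iff _ _).mp h1 ⟨a, ha⟩

end Local

end

/-! ### Injective modules with one-dimensional socle -/

section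

open IsLocalRing

/-- An injective module over a local ring whose socle is a nonzero cyclic module: an injective hull
of the residue field, up to torsion-free summands. -/
structure IsSocleInjective (R : Type u) [CommRing R] [IsLocalRing R] (E : Type u) [AddCommGroup E]
    [Module R E] : Prop where
  injective : Module.Injective R E
  exists_generator : ∃ e : E, e ≠ 0 ∧ (∀ a ∈ maximalIdeal R, a • e = 0) ∧
    ∀ y : E, (∀ a ∈ maximalIdeal R, a • y = 0) → y ∈ Submodule.span R {e}

section Essential

variable {R : Type u} [CommRing R] {J : Type u} [AddCommGroup J] [Module R J]

/-- An injective module contains with each submodule `k` an injective essential extension of it. -/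
theorem Module.Injective.exists_injective_essential (hJ : Module.Injective R J)
    (k : Submodule R J) :
    ∃ E : Submodule R J, k ≤ E ∧ (∀ N ≤ E, N ⊓ k = ⊥ → N = ⊥) ∧ Module.Injective R E := by
  obtain ⟨E, -, hE⟩ := zorn_le_nonempty₀ {F : Submodule R J | k ≤ F ∧ ∀ N ≤ F, N ⊓ k = ⊥ → N = ⊥}
    (fun c hc hchain y hy => by
      refine ⟨sSup c, ⟨(hc hy).1.trans (le_sSup hy), fun N hN hNk => ?_⟩, fun z => le_sSup⟩
      have h1 : ∀ F ∈ c, N ⊓ F = ⊥ := fun F hF => (hc hF).2 _ inf_le_right (by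
        rw [inf_right_comm, hNk, bot_inf_eq])
      rw [← inf_eq_left.mpr hN, eq_bot_iff]
      rintro x ⟨hxN, hx⟩
      obtain ⟨F, hF, hxF⟩ := (Submodule.mem_sSup_of_directed ⟨y, hy⟩ hchain.directedOn).mp hx
      rw [← h1 F hF]
      exact ⟨hxN, hxF⟩) k ⟨le_rfl, fun N hN h => by rwa [inf_eq_left.mpr hN] at h⟩
  obtain ⟨⟨hkE, hess⟩, hmax⟩ := hE
  -- With `K` maximal among the submodules meeting `E` trivially, `E` embeds essentially in `J/K`.
  -- The extension `φ : J/K → J` of the inclusion then has image an essential extension of `k`,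
  -- which equals `E` by maximality, so `J → J/K → E` is a retraction.
  obtain ⟨K, -, hK⟩ := zorn_le_nonempty₀ {K : Submodule R J | K ⊓ E = ⊥}
    (fun c hc hchain y hy => by
      refine ⟨sSup c, ?_, fun z => le_sSup⟩
      rw [Set.mem_ofPred_eq, eq_bot_iff]
      rintro x ⟨hx, hxE⟩
      obtain ⟨F, hF, hxF⟩ := (Submodule.mem_sSup_of_directed ⟨y, hy⟩ hchain.directedOn).mp hx
      rw [← hc hF]
      exact ⟨hxF, hxE⟩) ⊥ (bot_inf_eq _)
  obtain ⟨hKE, hKmax⟩ := hK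
  have hKE' : ∀ x, x ∈ K → x ∈ E → x = 0 := fun x h1 h2 => by
    have : x ∈ K ⊓ E := ⟨h1, h2⟩
    rwa [show K ⊓ E = ⊥ from hKE] at this
  obtain ⟨φ, hφ⟩ := hJ.out (K.mkQ ∘ₗ E.subtype) (by
    rw [← LinearMap.ker_eq_bot, eq_bot_iff]
    intro x hx
    have : (x : J) ∈ K := by simpa using hx
    exact Subtype.ext (hKE' x this x.2)) E.subtype
  replace hφ : ∀ x ∈ E, φ (K.mkQ x) = x := fun x hx => hφ ⟨x, hx⟩
  have hquot : ∀ N : Submodule R (J ⧸ K), (∀ x ∈ E, K.mkQ x ∈ N → x = 0) → N = ⊥ := by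
    intro N hN
    have h1 : K ≤ N.comap K.mkQ := fun x hx => by
      rw [Submodule.mem_comap, Submodule.mkQ_apply, (Submodule.Quotient.mk_eq_zero K).mpr hx]
      exact zero_mem _
    have h2 : N.comap K.mkQ ≤ K := hKmax (by
      change N.comap K.mkQ ⊓ E = ⊥
      rw [eq_bot_iff]
      rintro x ⟨hx, hxE⟩
      exact hN x hxE hx) h1
    rw [eq_bot_iff]
    intro q hq
    induction q using Submodule.Quotient.induction_on with | _ x
    exact (Submodule.Quotient.mk_eq_zero K).mpr (h2 hq)
  have hrange : φ.range = E := by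
    refine le_antisymm (hmax ⟨?_, fun N hN hNk => ?_⟩ ?_) ?_
    · exact fun x hx => ⟨K.mkQ x, hφ x (hkE hx)⟩
    · have h1 : N ⊓ E = ⊥ := hess _ inf_le_right (by rw [inf_right_comm, hNk, bot_inf_eq])
      have h2 : N.comap φ = ⊥ := hquot _ fun x hx hxN => by
        rw [Submodule.mem_comap, hφ x hx] at hxN
        have : x ∈ N ⊓ E := ⟨hxN, hx⟩
        rwa [h1] at this
      rw [← inf_eq_right.mpr hN, ← Submodule.map_comap_eq, h2, Submodule.map_bot]
    · exact fun x hx => ⟨K.mkQ x, hφ x hx⟩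
    · exact fun x hx => ⟨K.mkQ x, hφ x hx⟩
  refine ⟨E, hkE, hess, ⟨fun X Y _ _ _ _ f hf g => ?_⟩⟩
  obtain ⟨h, hh⟩ := hJ.out f hf (E.subtype ∘ₗ g)
  refine ⟨(φ ∘ₗ K.mkQ ∘ₗ h).codRestrict E fun y => hrange ▸ ⟨_, rfl⟩, fun x => Subtype.ext ?_⟩
  change φ (K.mkQ (h (f x))) = g x
  rw [hh]
  exact hφ _ (g x).2

end Essential

theorem Module.exists_injective_embedding (R : Type u) [CommRing R] (k : Type u) [AddCommGroup k]
    [Module R k] :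
    ∃ (J : Type u) (_ : AddCommGroup J) (_ : Module R J) (ι : k →ₗ[R] J),
      Module.Injective R J ∧ Function.Injective ι := by
  let X : ModuleCat.{u} R := ModuleCat.of R k
  have h : CategoryTheory.Injective (ModuleCat.of R (CategoryTheory.Injective.under X :)) :=
    inferInstanceAs (CategoryTheory.Injective (CategoryTheory.Injective.under X))
  exact ⟨(CategoryTheory.Injective.under X :), inferInstance, inferInstance,
    (CategoryTheory.Injective.ι X).hom, Module.injective_module_of_injective_object _ _,
    (ModuleCat.mono_iff_injective _).mp inferInstance⟩

/-- In an injective essential extension of the residue field, a nonzero socle element has a nonzero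
multiple `ry` in the chosen line. Since `𝔪` kills `y`, the scalar `r` is a unit. -/
theorem exists_isSocleInjective (R : Type u) [CommRing R] [IsLocalRing R] :
    ∃ (E : Type u) (_ : AddCommGroup E) (_ : Module R E), IsSocleInjective R E := by
  obtain ⟨J, _, _, ι, hJ, hι⟩ := Module.exists_injective_embedding R (R ⧸ maximalIdeal R)
  let e : J := ι 1
  obtain ⟨E, hkE, hess, hE⟩ := hJ.exists_injective_essential (Submodule.span R {e})
  have hker : ∀ a ∈ maximalIdeal R, a • e = 0 := fun a ha => by
    have : a • (1 : R ⧸ maximalIdeal R) = 0 := by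
      rw [Algebra.smul_def, mul_one]
      exact Ideal.Quotient.eq_zero_iff_mem.mpr ha
    rw [← map_smul, this, map_zero]
  refine ⟨E, inferInstance, inferInstance, hE, ⟨e, hkE (Submodule.mem_span_singleton_self e)⟩,
    fun h0 => ?_, fun a ha => Subtype.ext (hker a ha), fun y hy => ?_⟩
  · have h1 : ι 1 = ι 0 := (congrArg Subtype.val h0).trans (map_zero _).symm
    exact one_ne_zero (hι h1)
  · by_cases hy0 : y = 0
    · rw [hy0]; exact zero_mem _
    have h1 : Submodule.span R {(y : J)} ⊓ Submodule.span R {e} ≠ ⊥ := fun h => by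
      have := hess (Submodule.span R {(y : J)})
        ((Submodule.span_singleton_le_iff_mem _ _).mpr y.2) h
      rw [Submodule.span_singleton_eq_bot] at this
      exact hy0 (Subtype.ext this)
    obtain ⟨z, ⟨hzy, hze⟩, hz0⟩ := Submodule.exists_mem_ne_zero_of_ne_bot h1
    obtain ⟨r, rfl⟩ := Submodule.mem_span_singleton.mp hzy
    obtain ⟨s, hs⟩ := Submodule.mem_span_singleton.mp hze
    have hr : IsUnit r := by
      by_contra hr
      exact hz0 (congrArg Subtype.val (hy r hr))
    obtain ⟨r, rfl⟩ := hr
    refine Submodule.mem_span_singleton.mpr ⟨(r⁻¹ : Rˣ) * s, Subtype.ext ?_⟩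
    change ((r⁻¹ : Rˣ) * s : R) • e = y
    rw [mul_smul, hs, ← mul_smul, Units.inv_mul, one_smul]

end

/-! ### Local cohomology as a direct limit of Ext -/

section

open IsLocalRing CategoryTheory Abelian

theorem Module.DirectLimit.map_exact {R : Type u} [CommRing R] {G₁ G₂ G₃ : ℕ → Type v}
    [∀ i, AddCommGroup (G₁ i)] [∀ i, Module R (G₁ i)] [∀ i, AddCommGroup (G₂ i)]
    [∀ i, Module R (G₂ i)] [∀ i, AddCommGroup (G₃ i)] [∀ i, Module R (G₃ i)]
    {f₁ : ∀ i j, i ≤ j → G₁ i →ₗ[R] G₁ j} {f₂ : ∀ i j, i ≤ j → G₂ i →ₗ[R] G₂ j}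
    {f₃ : ∀ i j, i ≤ j → G₃ i →ₗ[R] G₃ j} [DirectedSystem G₃ fun i j h => f₃ i j h]
    (a : ∀ i, G₁ i →ₗ[R] G₂ i) (b : ∀ i, G₂ i →ₗ[R] G₃ i)
    (ha : ∀ i j h, a j ∘ₗ f₁ i j h = f₂ i j h ∘ₗ a i)
    (hb : ∀ i j h, b j ∘ₗ f₂ i j h = f₃ i j h ∘ₗ b i) (hab : ∀ i, Function.Exact (a i) (b i)) :
    Function.Exact (Module.DirectLimit.map a ha) (Module.DirectLimit.map b hb) := by
  intro y
  constructor
  · intro hy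
    obtain ⟨i, y, rfl⟩ := Module.DirectLimit.exists_of y
    rw [Module.DirectLimit.map_apply_of] at hy
    obtain ⟨j, hij, hj⟩ := Module.DirectLimit.of.zero_exact hy
    rw [← LinearMap.comp_apply, ← hb] at hj
    obtain ⟨x, hx⟩ := (hab j _).mp hj
    refine ⟨Module.DirectLimit.of R ℕ G₁ f₁ j x, ?_⟩
    rw [Module.DirectLimit.map_apply_of, hx, Module.DirectLimit.of_f]
  · rintro ⟨x, rfl⟩
    obtain ⟨i, x, rfl⟩ := Module.DirectLimit.exists_of x
    rw [Module.DirectLimit.map_apply_of, Module.DirectLimit.map_apply_of,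
      (hab i).apply_apply_eq_zero, map_zero]

section LocalCohomologyExt

variable {R : Type u} [CommRing R] (I : Ideal R)

/-- The projection `R ⧸ I ^ t → R ⧸ I ^ s` for `s ≤ t`. -/
def Ideal.powQuotientProj {s t : ℕ} (h : s ≤ t) :
    ModuleCat.of R (R ⧸ I ^ t) ⟶ ModuleCat.of R (R ⧸ I ^ s) :=
  ModuleCat.ofHom (Submodule.mapQ _ _ LinearMap.id (Ideal.pow_le_pow_right h))

theorem Ideal.powQuotientProj_refl (t : ℕ) : I.powQuotientProj (le_refl t) = 𝟙 _ := by
  ext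
  rfl

theorem Ideal.powQuotientProj_comp {r s t : ℕ} (h : r ≤ s) (h' : s ≤ t) :
    I.powQuotientProj h' ≫ I.powQuotientProj h = I.powQuotientProj (h.trans h') := by
  ext
  rfl

/-- The transition maps of the direct system `Ext R (R ⧸ I ^ t) N i`. -/
noncomputable def extPowTransition (i : ℕ) (N : ModuleCat.{u} R) (s t : ℕ) (h : s ≤ t) :
    Ext (ModuleCat.of R (R ⧸ I ^ s)) N i →ₗ[R] Ext (ModuleCat.of R (R ⧸ I ^ t)) N i :=
  (Ext.mk₀ (I.powQuotientProj h)).precompOfLinear R N (zero_add i)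

theorem extPowTransition_apply (i : ℕ) (N : ModuleCat.{u} R) (s t : ℕ) (h : s ≤ t)
    (x : Ext (ModuleCat.of R (R ⧸ I ^ s)) N i) :
    extPowTransition I i N s t h x = (Ext.mk₀ (I.powQuotientProj h)).comp x (zero_add i) :=
  rfl

instance (i : ℕ) (N : ModuleCat.{u} R) :
    DirectedSystem (fun t : ℕ => Ext (ModuleCat.of R (R ⧸ I ^ t)) N i)
      (fun s t h => extPowTransition I i N s t h) where
  map_self t x := by
    rw [extPowTransition_apply, Ideal.powQuotientProj_refl, Ext.mk₀_id_comp]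
  map_map r s t h h' x := by
    rw [extPowTransition_apply, extPowTransition_apply, extPowTransition_apply,
      ← I.powQuotientProj_comp h h', ← Ext.mk₀_comp_mk₀,
      Ext.comp_assoc _ _ _ (add_zero 0) (zero_add i) (by omega)]

/-- The local cohomology module `colim Ext R (R ⧸ I ^ t) N i`. -/
abbrev ExtLimit (i : ℕ) (N : ModuleCat.{u} R) : Type u :=
  Module.DirectLimit (fun t : ℕ => Ext (ModuleCat.of R (R ⧸ I ^ t)) N i) (extPowTransition I i N)

namespace ExtLimit

variable {I} in
/-- Postcomposition with an element of `Ext`. -/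
noncomputable def postcomp {N N' : ModuleCat.{u} R} {n : ℕ} (e : Ext N N' n) (i j : ℕ)
    (h : i + n = j) : ExtLimit I i N →ₗ[R] ExtLimit I j N' :=
  Module.DirectLimit.map (fun _ => e.postcompOfLinear R _ h) fun s t hst => by
    ext x
    change ((Ext.mk₀ _).comp x (zero_add i)).comp e h = (Ext.mk₀ _).comp (x.comp e h) (zero_add j)
    rw [Ext.comp_assoc _ _ _ (zero_add i) h (by omega)]

theorem postcomp_of {N N' : ModuleCat.{u} R} {n : ℕ} (e : Ext N N' n) (i j : ℕ)
    (h : i + n = j) (t : ℕ) (x : Ext (ModuleCat.of R (R ⧸ I ^ t)) N i) :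
    postcomp e i j h (Module.DirectLimit.of R ℕ _ (extPowTransition I i N) t x) =
      Module.DirectLimit.of R ℕ _ (extPowTransition I j N') t (x.comp e h) :=
  Module.DirectLimit.map_apply_of _ _ _

theorem postcomp_mk₀_smul_id (N : ModuleCat.{u} R) (i : ℕ) (r : R) (v : ExtLimit I i N) :
    postcomp (Ext.mk₀ (r • 𝟙 N)) i i (add_zero i) v = r • v := by
  obtain ⟨t, x, rfl⟩ := Module.DirectLimit.exists_of v
  rw [postcomp_of, ← Ext.smul_eq_comp_mk₀, map_smul]

theorem postcomp_mk₀_comp {N N' N'' : ModuleCat.{u} R} (f : N ⟶ N') (g : N' ⟶ N'') (i : ℕ)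
    (v : ExtLimit I i N) :
    postcomp (Ext.mk₀ g) i i (add_zero i) (postcomp (Ext.mk₀ f) i i (add_zero i) v) =
      postcomp (Ext.mk₀ (f ≫ g)) i i (add_zero i) v := by
  obtain ⟨t, x, rfl⟩ := Module.DirectLimit.exists_of v
  rw [postcomp_of, postcomp_of, postcomp_of, ← Ext.mk₀_comp_mk₀,
    Ext.comp_assoc_of_second_deg_zero]

/-- A class coming from stage `t` is killed by `Iᵗ`, because `Iᵗ` kills the first argument of `Ext`.
-/
theorem exists_pow_smul_eq_zero {N : ModuleCat.{u} R} {i : ℕ} (v : ExtLimit I i N) :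
    ∃ t : ℕ, ∀ a ∈ I ^ t, a • v = 0 := by
  obtain ⟨t, x, rfl⟩ := Module.DirectLimit.exists_of v
  refine ⟨t, fun a ha => ?_⟩
  rw [← map_smul]
  have h0 : a • 𝟙 (ModuleCat.of R (R ⧸ I ^ t)) = 0 := by
    ext
    change a • (1 : R ⧸ I ^ t) = 0
    rw [Algebra.smul_def, mul_one]
    exact Ideal.Quotient.eq_zero_iff_mem.mpr ha
  rw [← Ext.mk₀_id_comp x, ← Ext.smul_comp, ← Ext.mk₀_smul, h0, Ext.mk₀_zero, Ext.zero_comp,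
    map_zero]

theorem subsingleton_of_injective (N : ModuleCat.{u} R) [Injective N] (i : ℕ) :
    Subsingleton (ExtLimit I (i + 1) N) := by
  refine (subsingleton_iff_forall_eq 0).mpr fun v => ?_
  obtain ⟨t, x, rfl⟩ := Module.DirectLimit.exists_of v
  rw [Ext.eq_zero_of_injective x, map_zero]

theorem exact₂ {S : ShortComplex (ModuleCat.{u} R)} (hS : S.ShortExact) (i : ℕ) :
    Function.Exact (postcomp (I := I) (Ext.mk₀ S.f) i i (add_zero i))
      (postcomp (Ext.mk₀ S.g) i i (add_zero i)) :=
  Module.DirectLimit.map_exact _ _ _ _ fun t =>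
    (ShortComplex.ab_exact_iff_function_exact _).mp
      (Ext.covariant_sequence_exact₂' (ModuleCat.of R (R ⧸ I ^ t)) hS i)

theorem exact₃ {S : ShortComplex (ModuleCat.{u} R)} (hS : S.ShortExact) (i j : ℕ)
    (h : i + 1 = j) :
    Function.Exact (postcomp (I := I) (Ext.mk₀ S.g) i i (add_zero i))
      (postcomp hS.extClass i j h) :=
  Module.DirectLimit.map_exact _ _ _ _ fun t =>
    (ShortComplex.ab_exact_iff_function_exact _).mp
      (Ext.covariant_sequence_exact₃' (ModuleCat.of R (R ⧸ I ^ t)) hS i j h)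

theorem exact₁ {S : ShortComplex (ModuleCat.{u} R)} (hS : S.ShortExact) (i j : ℕ)
    (h : i + 1 = j) :
    Function.Exact (postcomp (I := I) hS.extClass i j h)
      (postcomp (Ext.mk₀ S.f) j j (add_zero j)) :=
  Module.DirectLimit.map_exact _ _ _ _ fun t =>
    (ShortComplex.ab_exact_iff_function_exact _).mp
      (Ext.covariant_sequence_exact₁' (ModuleCat.of R (R ⧸ I ^ t)) hS i j h)

/-- Evaluation of an element of `Ext R (R ⧸ I ^ t) N 0` at `1`. -/
noncomputable def extZeroEval (N : ModuleCat.{u} R) (t : ℕ) :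
    Ext (ModuleCat.of R (R ⧸ I ^ t)) N 0 →ₗ[R] N where
  toFun x := (Ext.linearEquiv₀ (R := R) x).hom (1 : R ⧸ I ^ t)
  map_add' x y := by rw [map_add]; rfl
  map_smul' r x := by rw [map_smul]; rfl

theorem extZeroEval_mk₀ (N : ModuleCat.{u} R) (t : ℕ) (f : ModuleCat.of R (R ⧸ I ^ t) ⟶ N) :
    extZeroEval I N t (Ext.mk₀ f) = f.hom (1 : R ⧸ I ^ t) := by
  have : Ext.linearEquiv₀ (R := R) (Ext.mk₀ f) = f :=
    (Ext.linearEquiv₀ (R := R)).apply_symm_apply f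
  change (Ext.linearEquiv₀ (R := R) (Ext.mk₀ f)).hom (1 : R ⧸ I ^ t) = _
  rw [this]

/-- The embedding of the zeroth local cohomology of `N` in `N`. -/
noncomputable def zeroEval (N : ModuleCat.{u} R) : ExtLimit I 0 N →ₗ[R] N :=
  Module.DirectLimit.lift R ℕ _ _ (extZeroEval I N) fun s t h x => by
    obtain ⟨f, rfl⟩ := (Ext.linearEquiv₀ (R := R)).symm.surjective x
    rw [extPowTransition_apply, Ext.linearEquiv₀_symm_apply, Ext.mk₀_comp_mk₀, extZeroEval_mk₀,
      extZeroEval_mk₀]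
    rfl

theorem zeroEval_of_mk₀ (N : ModuleCat.{u} R) (t : ℕ) (f : ModuleCat.of R (R ⧸ I ^ t) ⟶ N) :
    zeroEval I N (Module.DirectLimit.of R ℕ _ (extPowTransition I 0 N) t (Ext.mk₀ f)) =
      f.hom (1 : R ⧸ I ^ t) := by
  rw [zeroEval, Module.DirectLimit.lift_of, extZeroEval_mk₀]

theorem exists_of_mk₀ {N : ModuleCat.{u} R} (v : ExtLimit I 0 N) :
    ∃ (t : ℕ) (f : ModuleCat.of R (R ⧸ I ^ t) ⟶ N),
      v = Module.DirectLimit.of R ℕ _ (extPowTransition I 0 N) t (Ext.mk₀ f) := by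
  obtain ⟨t, x, rfl⟩ := Module.DirectLimit.exists_of v
  obtain ⟨f, rfl⟩ := (Ext.linearEquiv₀ (R := R)).symm.surjective x
  exact ⟨t, f, by rw [Ext.linearEquiv₀_symm_apply]⟩

theorem zeroEval_injective (N : ModuleCat.{u} R) : Function.Injective (zeroEval I N) := by
  rw [injective_iff_map_eq_zero]
  intro v hv
  obtain ⟨t, f, rfl⟩ := exists_of_mk₀ I v
  rw [zeroEval_of_mk₀] at hv
  have : f = 0 := by
    ext
    exact hv
  rw [this, Ext.mk₀_zero, map_zero]

theorem mem_range_zeroEval_iff (N : ModuleCat.{u} R) (n : N) :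
    n ∈ (zeroEval I N).range ↔ ∃ t : ℕ, ∀ a ∈ I ^ t, a • n = 0 := by
  constructor
  · rintro ⟨v, rfl⟩
    obtain ⟨t, ht⟩ := exists_pow_smul_eq_zero I v
    exact ⟨t, fun a ha => by rw [← map_smul, ht a ha, map_zero]⟩
  · rintro ⟨t, ht⟩
    refine ⟨Module.DirectLimit.of R ℕ _ (extPowTransition I 0 N) t (Ext.mk₀ (ModuleCat.ofHom
      (Submodule.liftQ (I ^ t) (LinearMap.toSpanSingleton R N n) ht))), ?_⟩
    rw [zeroEval_of_mk₀]
    exact one_smul R n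

theorem zeroEval_postcomp {N N' : ModuleCat.{u} R} (f : N ⟶ N') (v : ExtLimit I 0 N) :
    zeroEval I N' (postcomp (Ext.mk₀ f) 0 0 (add_zero 0) v) = f.hom (zeroEval I N v) := by
  obtain ⟨t, g, rfl⟩ := exists_of_mk₀ I v
  rw [postcomp_of, Ext.mk₀_comp_mk₀, zeroEval_of_mk₀, zeroEval_of_mk₀]
  rfl

end ExtLimit

end LocalCohomologyExt

end

/-! ### Local cohomology of the dual and its long exact sequence -/

section

open IsLocalRing CategoryTheory Abelian

section Dual

variable {R : Type u} [CommRing R] (I : Ideal R) (E : Type u) [AddCommGroup E] [Module R E]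

/-- The dual of `M` with respect to `E`, as an object of the category of modules. -/
abbrev dualObj (M : Type u) [AddCommGroup M] [Module R M] : ModuleCat.{u} R :=
  ModuleCat.of R (M →ₗ[R] E)

/-- The transpose of a linear map with respect to `E`. -/
abbrev dualMap {M N : Type u} [AddCommGroup M] [Module R M] [AddCommGroup N] [Module R N]
    (f : M →ₗ[R] N) : dualObj (R := R) E N ⟶ dualObj (R := R) E M :=
  ModuleCat.ofHom
    { toFun := fun φ : N →ₗ[R] E => φ ∘ₗ f
      map_add' := fun _ _ => rfl
      map_smul' := fun _ _ => rfl }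

/-- The local cohomology of the dual of a module; this is a dual of local homology. -/
def DualLocCoh (i : ℕ) (M : Type u) [AddCommGroup M] [Module R M] : Type u :=
  ExtLimit I i (dualObj (R := R) E M)

noncomputable instance (i : ℕ) (M : Type u) [AddCommGroup M] [Module R M] :
    AddCommGroup (DualLocCoh I E i M) :=
  inferInstanceAs (AddCommGroup (ExtLimit I i (dualObj (R := R) E M)))

noncomputable instance (i : ℕ) (M : Type u) [AddCommGroup M] [Module R M] :
    Module R (DualLocCoh I E i M) :=
  inferInstanceAs (Module R (ExtLimit I i (dualObj (R := R) E M)))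

namespace DualLocCoh

variable {M N P : Type u} [AddCommGroup M] [Module R M] [AddCommGroup N] [Module R N]
  [AddCommGroup P] [Module R P]

/-- The map on the local cohomology of the dual induced by a linear map. -/
noncomputable def map (i : ℕ) (f : M →ₗ[R] N) : DualLocCoh I E i N →ₗ[R] DualLocCoh I E i M :=
  ExtLimit.postcomp (Ext.mk₀ (dualMap E f)) i i (add_zero i)

theorem map_lsmul (i : ℕ) (r : R) : map I E i (LinearMap.lsmul R M r) = LinearMap.lsmul R _ r := by
  ext1 v
  have : dualMap E (LinearMap.lsmul R M r) = r • 𝟙 (dualObj (R := R) E M) := by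
    ext φ x
    exact map_smul φ r x
  rw [map, this]
  exact ExtLimit.postcomp_mk₀_smul_id I (dualObj (R := R) E M) i r v

theorem map_map (i : ℕ) (f : M →ₗ[R] N) (g : N →ₗ[R] P) (v : DualLocCoh I E i P) :
    map I E i f (map I E i g v) = map I E i (g ∘ₗ f) v :=
  ExtLimit.postcomp_mk₀_comp I (dualMap E g) (dualMap E f) i v

theorem map_id (i : ℕ) (v : DualLocCoh I E i M) : map I E i LinearMap.id v = v := by
  have h : (LinearMap.id : M →ₗ[R] M) = LinearMap.lsmul R M 1 := by ext; simp
  rw [h, map_lsmul]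
  exact one_smul R v

theorem subsingleton_of_linearEquiv {i : ℕ} (e : M ≃ₗ[R] N)
    (h : Subsingleton (DualLocCoh I E i M)) : Subsingleton (DualLocCoh I E i N) := by
  refine (subsingleton_iff_forall_eq 0).mpr fun v => ?_
  have : (e.toLinearMap ∘ₗ e.symm.toLinearMap) = LinearMap.id := by ext; simp
  rw [← map_id I E i v, ← this, ← map_map, Subsingleton.elim (map I E i e.toLinearMap v) 0, map_zero]

/-- The short complex of duals. -/
abbrev dualComplex (E : Type u) [AddCommGroup E] [Module R E] (f : M →ₗ[R] N) (g : N →ₗ[R] P) (hfg : Function.Exact f g) :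
    ShortComplex (ModuleCat.{u} R) :=
  ShortComplex.mk (dualMap E g) (dualMap E f) (by
    ext φ x
    change φ (g (f x)) = 0
    rw [hfg.apply_apply_eq_zero, map_zero])

variable {E}

theorem dualComplex_shortExact (hE : Module.Injective R E) {f : M →ₗ[R] N} {g : N →ₗ[R] P}
    (hf : Function.Injective f) (hfg : Function.Exact f g) (hg : Function.Surjective g) :
    (dualComplex E f g hfg).ShortExact := by
  refine ShortComplex.ShortExact.mk' ?_ ?_ ?_
  · rw [ShortComplex.moduleCat_exact_iff]
    intro φ hφ
    have hker : g.ker ≤ LinearMap.ker (show N →ₗ[R] E from φ) := by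
      intro x hx
      obtain ⟨y, rfl⟩ := (hfg x).mp hx
      exact LinearMap.congr_fun hφ y
    refine ⟨(Submodule.liftQ _ (show N →ₗ[R] E from φ) hker) ∘ₗ
      (g.quotKerEquivOfSurjective hg).symm.toLinearMap, ?_⟩
    refine LinearMap.ext fun x => ?_
    change Submodule.liftQ _ (show N →ₗ[R] E from φ) hker
      ((g.quotKerEquivOfSurjective hg).symm (g x)) = φ x
    rw [show (g.quotKerEquivOfSurjective hg).symm (g x) = Submodule.Quotient.mk x from
      (LinearEquiv.symm_apply_eq _).mpr rfl]
    rfl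
  · rw [ModuleCat.mono_iff_injective]
    intro φ ψ h
    refine LinearMap.ext fun x => ?_
    obtain ⟨y, rfl⟩ := hg x
    exact LinearMap.congr_fun h y
  · rw [ModuleCat.epi_iff_surjective]
    intro φ
    obtain ⟨ψ, hψ⟩ := hE.out f hf φ
    exact ⟨ψ, LinearMap.ext hψ⟩

theorem exact_map_map (hE : Module.Injective R E) {f : M →ₗ[R] N} {g : N →ₗ[R] P}
    (hf : Function.Injective f) (hfg : Function.Exact f g) (hg : Function.Surjective g) (i : ℕ) :
    Function.Exact (map I E i g) (map I E i f) :=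
  ExtLimit.exact₂ I (dualComplex_shortExact hE hf hfg hg) i

/-- The connecting homomorphism. -/
noncomputable def δ (hE : Module.Injective R E) {f : M →ₗ[R] N} {g : N →ₗ[R] P}
    (hf : Function.Injective f) (hfg : Function.Exact f g) (hg : Function.Surjective g) (i : ℕ) :
    DualLocCoh I E i M →ₗ[R] DualLocCoh I E (i + 1) P :=
  ExtLimit.postcomp (I := I) (dualComplex_shortExact hE hf hfg hg).extClass i (i + 1) rfl

theorem exact_map_δ (hE : Module.Injective R E) {f : M →ₗ[R] N} {g : N →ₗ[R] P}
    (hf : Function.Injective f) (hfg : Function.Exact f g) (hg : Function.Surjective g) (i : ℕ) :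
    Function.Exact (map I E i f) (δ I hE hf hfg hg i) :=
  ExtLimit.exact₃ I (dualComplex_shortExact hE hf hfg hg) i (i + 1) rfl

theorem exact_δ_map (hE : Module.Injective R E) {f : M →ₗ[R] N} {g : N →ₗ[R] P}
    (hf : Function.Injective f) (hfg : Function.Exact f g) (hg : Function.Surjective g) (i : ℕ) :
    Function.Exact (δ I hE hf hfg hg i) (map I E (i + 1) g) :=
  ExtLimit.exact₁ I (dualComplex_shortExact hE hf hfg hg) i (i + 1) rfl

theorem exists_pow_smul_eq_zero {i : ℕ} (v : DualLocCoh I E i M) :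
    ∃ t : ℕ, ∀ a ∈ I ^ t, a • v = 0 :=
  ExtLimit.exists_pow_smul_eq_zero I v

end DualLocCoh

end Dual

end

/-! ### Dimension shifting, flat modules and finitely generated modules -/

section

open IsLocalRing CategoryTheory Abelian

/-- By adjunction, `Hom(-, Hom(F, E))` is `Hom(- ⊗ F, E)`, a composite of exact functors. -/
theorem Module.Injective.linearMap_of_flat {R : Type u} [CommRing R] {E F : Type u}
    [AddCommGroup E] [Module R E] [AddCommGroup F] [Module R F] (hE : Module.Injective R E)
    [Module.Flat R F] : Module.Injective R (F →ₗ[R] E) := by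
  refine ⟨fun X Y _ _ _ _ f hf g => ?_⟩
  obtain ⟨h, hh⟩ := hE.out (f.rTensor F) (Module.Flat.rTensor_preserves_injective_linearMap f hf)
    (TensorProduct.lift g)
  refine ⟨TensorProduct.curry h, fun x => LinearMap.ext fun y => ?_⟩
  exact hh (x ⊗ₜ y)

namespace DualLocCoh

variable {R : Type u} [CommRing R] (I : Ideal R) (E : Type u) [AddCommGroup E] [Module R E]
  {K F M : Type u} [AddCommGroup K] [Module R K] [AddCommGroup F] [Module R F]
  [AddCommGroup M] [Module R M]

/-- The embedding of the zeroth local cohomology of the dual in the dual. -/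
noncomputable def zeroEval (M : Type u) [AddCommGroup M] [Module R M] :
    DualLocCoh I E 0 M →ₗ[R] M →ₗ[R] E :=
  ExtLimit.zeroEval I (dualObj (R := R) E M)

theorem zeroEval_injective : Function.Injective (zeroEval I E M) :=
  ExtLimit.zeroEval_injective I (dualObj (R := R) E M)

theorem mem_range_zeroEval_iff (φ : M →ₗ[R] E) :
    φ ∈ (zeroEval I E M).range ↔ ∃ t : ℕ, ∀ a ∈ I ^ t, a • φ = 0 :=
  ExtLimit.mem_range_zeroEval_iff I (dualObj (R := R) E M) φ

theorem zeroEval_map (f : K →ₗ[R] M) (v : DualLocCoh I E 0 M) :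
    zeroEval I E K (map I E 0 f v) = zeroEval I E M v ∘ₗ f :=
  ExtLimit.zeroEval_postcomp I (dualMap E f) v

theorem subsingleton_zero_iff :
    Subsingleton (DualLocCoh I E 0 M) ↔
      ∀ φ : M →ₗ[R] E, (∃ t : ℕ, ∀ a ∈ I ^ t, a • φ = 0) → φ = 0 := by
  constructor
  · intro h φ hφ
    obtain ⟨v, rfl⟩ := (mem_range_zeroEval_iff I E φ).mpr hφ
    rw [Subsingleton.elim v 0, map_zero]
  · intro h
    refine (subsingleton_iff_forall_eq 0).mpr fun v => zeroEval_injective I E ?_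
    rw [map_zero]
    exact h _ ((mem_range_zeroEval_iff I E _).mp ⟨v, rfl⟩)

theorem map_zero_surjective_iff (f : K →ₗ[R] F) :
    Function.Surjective (map I E 0 f) ↔
      ∀ φ : K →ₗ[R] E, (∃ t : ℕ, ∀ a ∈ I ^ t, a • φ = 0) →
        ∃ ψ : F →ₗ[R] E, (∃ s : ℕ, ∀ a ∈ I ^ s, a • ψ = 0) ∧ ψ ∘ₗ f = φ := by
  constructor
  · intro h φ hφ
    obtain ⟨v, rfl⟩ := (mem_range_zeroEval_iff I E φ).mpr hφ
    obtain ⟨w, rfl⟩ := h v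
    exact ⟨zeroEval I E F w, (mem_range_zeroEval_iff I E _).mp ⟨w, rfl⟩,
      (zeroEval_map I E f w).symm⟩
  · intro h v
    obtain ⟨ψ, hψ, hψf⟩ := h _ ((mem_range_zeroEval_iff I E _).mp ⟨v, rfl⟩)
    obtain ⟨w, rfl⟩ := (mem_range_zeroEval_iff I E ψ).mpr hψ
    exact ⟨w, zeroEval_injective I E ((zeroEval_map I E f w).trans hψf)⟩

variable {E}

theorem subsingleton_of_flat (hE : Module.Injective R E) [Module.Flat R F] (i : ℕ) :
    Subsingleton (DualLocCoh I E (i + 1) F) := by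
  have := hE.linearMap_of_flat (F := F)
  have : Injective (dualObj (R := R) E F) := Module.injective_object_of_injective_module R _
  exact ExtLimit.subsingleton_of_injective I (dualObj (R := R) E F) i

/-- The dual of `F` is injective, so `D^{i+1}(M)` is the cokernel of `D^i(F) → D^i(K)`. In degree 0
this turns vanishing into an extension problem for torsion homomorphisms. -/
theorem subsingleton_succ_iff (hE : Module.Injective R E) [Module.Flat R F] {f : K →ₗ[R] F}
    {g : F →ₗ[R] M} (hf : Function.Injective f) (hfg : Function.Exact f g)
    (hg : Function.Surjective g) (i : ℕ) :
    Subsingleton (DualLocCoh I E (i + 1) M) ↔ Function.Surjective (map I E i f) := by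
  have h1 := exact_map_δ I hE hf hfg hg i
  have h2 := exact_δ_map I hE hf hfg hg i
  have := subsingleton_of_flat (F := F) I hE i
  constructor
  · intro h v
    exact (h1 v).mp (Subsingleton.elim _ _)
  · intro h
    refine (subsingleton_iff_forall_eq 0).mpr fun v => ?_
    obtain ⟨w, rfl⟩ := (h2 v).mp (Subsingleton.elim _ _)
    exact (h1 w).mpr (h w)

theorem subsingleton_succ_succ_iff (hE : Module.Injective R E) [Module.Flat R F] {f : K →ₗ[R] F}
    {g : F →ₗ[R] M} (hf : Function.Injective f) (hfg : Function.Exact f g)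
    (hg : Function.Surjective g) (i : ℕ) :
    Subsingleton (DualLocCoh I E (i + 2) M) ↔ Subsingleton (DualLocCoh I E (i + 1) K) := by
  rw [subsingleton_succ_iff I hE hf hfg hg (i + 1)]
  have := subsingleton_of_flat (F := F) I hE i
  constructor
  · intro h
    exact h.subsingleton
  · intro h v
    exact ⟨0, Subsingleton.elim _ _⟩

/-- Homomorphisms that are killed by a power of `I` extend from a submodule of a finitely
generated module. -/
theorem exists_extension_of_finite [IsNoetherianRing R] (hE : Module.Injective R E)
    [Module.Finite R F] (N : Submodule R F) (φ : N →ₗ[R] E) (t : ℕ)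
    (hφ : ∀ a ∈ I ^ t, a • φ = 0) :
    ∃ ψ : F →ₗ[R] E, (∃ s : ℕ, ∀ a ∈ I ^ s, a • ψ = 0) ∧ ψ ∘ₗ N.subtype = φ := by
  -- By Artin–Rees, `I^(k+t)F ∩ N ⊆ IᵗN ⊆ ker φ`. So `φ` descends to a submodule of `F/I^(k+t)F`,
  -- and an extension to that quotient is automatically torsion.
  obtain ⟨k, hk⟩ := Ideal.exists_pow_inf_eq_pow_smul I N
  set J : Submodule R F := I ^ (k + t) • ⊤ with hJ
  have hker : I ^ t • (⊤ : Submodule R N) ≤ φ.ker := Submodule.smul_le.mpr fun a ha n _ => by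
    rw [LinearMap.mem_ker, map_smul]
    exact LinearMap.congr_fun (hφ a ha) n
  have hJN : J.comap N.subtype ≤ φ.ker := by
    intro x hx
    have h1 : (x : F) ∈ I ^ t • N := by
      have h2 : (x : F) ∈ I ^ (k + t) • ⊤ ⊓ N := ⟨hx, x.2⟩
      rw [hk (k + t) (Nat.le_add_right k t), Nat.add_sub_cancel_left] at h2
      exact (smul_mono_right (I ^ t) inf_le_right : _ ≤ I ^ t • N) h2
    have h3 : (I ^ t • (⊤ : Submodule R N)).map N.subtype = I ^ t • N := by
      rw [Submodule.map_smul'', Submodule.map_subtype_top]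
    rw [← h3] at h1
    obtain ⟨y, hy, hyx⟩ := h1
    exact Subtype.ext hyx ▸ hker hy
  obtain ⟨h, hh⟩ := hE.out (Submodule.mapQ (J.comap N.subtype) J N.subtype le_rfl) (by
    rw [injective_iff_map_eq_zero]
    intro q hq
    induction q using Submodule.Quotient.induction_on with | _ x
    exact (Submodule.Quotient.mk_eq_zero _).mpr ((Submodule.Quotient.mk_eq_zero J).mp hq))
    (Submodule.liftQ _ φ hJN)
  refine ⟨h ∘ₗ J.mkQ, ⟨k + t, fun a ha => LinearMap.ext fun x => ?_⟩,
    LinearMap.ext fun x => hh (Submodule.Quotient.mk x)⟩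
  change a • h (J.mkQ x) = 0
  rw [← map_smul, ← map_smul, Submodule.mkQ_apply, (Submodule.Quotient.mk_eq_zero J).mpr
    (Submodule.smul_mem_smul ha trivial), map_zero]

theorem subsingleton_of_finite [IsNoetherianRing R] (hE : Module.Injective R E) (i : ℕ)
    (M : Type u) [AddCommGroup M] [Module R M] [Module.Finite R M] :
    Subsingleton (DualLocCoh I E (i + 1) M) := by
  induction i generalizing M with
  | zero =>
    obtain ⟨n, g, hg⟩ := Module.Finite.exists_fin' R M
    rw [subsingleton_succ_iff I hE g.ker.injective_subtype (LinearMap.exact_subtype_ker_map g) hg,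
      map_zero_surjective_iff]
    rintro φ ⟨t, ht⟩
    exact exists_extension_of_finite I hE g.ker φ t ht
  | succ i ih =>
    obtain ⟨n, g, hg⟩ := Module.Finite.exists_fin' R M
    rw [subsingleton_succ_succ_iff I hE g.ker.injective_subtype
      (LinearMap.exact_subtype_ker_map g) hg]
    exact ih _

end DualLocCoh

/-! ### Duals into a module with one-dimensional socle -/

section SocleInjective

variable {R : Type u} [CommRing R] [IsLocalRing R] {E : Type u} [AddCommGroup E] [Module R E]

/-- The class of `x` spans a copy of the residue field in `M/N`; it maps to the socle of `E`, and
injectivity extends this map. -/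
theorem IsSocleInjective.exists_ne_zero (hE : IsSocleInjective R E) {M : Type u} [AddCommGroup M]
    [Module R M] {N : Submodule R M} {x : M} (hx : x ∉ N) (hxm : ∀ a ∈ maximalIdeal R, a • x ∈ N) :
    ∃ φ : M →ₗ[R] E, N ≤ φ.ker ∧ φ x ≠ 0 := by
  obtain ⟨e, he0, hem, -⟩ := hE.exists_generator
  let g : R ⧸ maximalIdeal R →ₗ[R] M ⧸ N := Submodule.liftQ (maximalIdeal R)
    (LinearMap.toSpanSingleton R _ (N.mkQ x)) fun a ha => by
      rw [LinearMap.mem_ker, LinearMap.toSpanSingleton_apply, ← map_smul, Submodule.mkQ_apply,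
        Submodule.Quotient.mk_eq_zero]
      exact hxm a ha
  let h : R ⧸ maximalIdeal R →ₗ[R] E := Submodule.liftQ (maximalIdeal R)
    (LinearMap.toSpanSingleton R _ e) fun a ha => hem a ha
  obtain ⟨φ, hφ⟩ := hE.injective.out g (by
    rw [injective_iff_map_eq_zero]
    intro q hq
    induction q using Submodule.Quotient.induction_on with | _ r
    have h1 : r • x ∈ N := by
      rw [← Submodule.Quotient.mk_eq_zero]
      exact hq
    rw [Submodule.Quotient.mk_eq_zero]
    by_contra hr
    exact hx ((N.smul_mem_iff_of_isUnit (by simpa using hr)).mp h1)) h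
  refine ⟨φ ∘ₗ N.mkQ, fun y hy => ?_, fun h0 => he0 ?_⟩
  · rw [LinearMap.mem_ker, LinearMap.comp_apply, Submodule.mkQ_apply,
      (Submodule.Quotient.mk_eq_zero N).mpr hy, map_zero]
  · have h1 := hφ (Submodule.Quotient.mk 1)
    have h2 : g (Submodule.Quotient.mk 1) = N.mkQ x := one_smul R (N.mkQ x)
    rw [h2] at h1
    exact (one_smul R e).symm.trans (h1.symm.trans h0)

namespace DualLocCoh

variable {M : Type u} [AddCommGroup M] [Module R M]

/-- A functional killed by `𝔪ᵗ` vanishes on `𝔪ᵗM`, which is `M` when `𝔪M = M`; otherwise `M/𝔪M` has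
a nonzero functional. -/
theorem subsingleton_zero_iff_smul_top (hE : IsSocleInjective R E) :
    Subsingleton (DualLocCoh (maximalIdeal R) E 0 M) ↔
      maximalIdeal R • (⊤ : Submodule R M) = ⊤ := by
  rw [subsingleton_zero_iff]
  constructor
  · intro h
    by_contra hne
    obtain ⟨x, -, hx⟩ := SetLike.exists_of_lt (lt_top_iff_ne_top.mpr hne)
    obtain ⟨φ, hφ, hφx⟩ := hE.exists_ne_zero hx fun a ha => Submodule.smul_mem_smul ha trivial
    refine hφx ?_
    rw [h φ ⟨1, fun a ha => LinearMap.ext fun y => ?_⟩, LinearMap.zero_apply]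
    rw [pow_one] at ha
    rw [LinearMap.smul_apply, ← map_smul]
    exact hφ (Submodule.smul_mem_smul ha trivial)
  · rintro h φ ⟨t, ht⟩
    have h1 : ∀ t : ℕ, maximalIdeal R ^ t • (⊤ : Submodule R M) = ⊤ := fun t => by
      induction t with
      | zero => rw [pow_zero, Ideal.one_eq_top, Submodule.top_smul]
      | succ t ih => rw [pow_succ, mul_smul, h, ih]
    have h2 : maximalIdeal R ^ t • (⊤ : Submodule R M) ≤ φ.ker :=
      Submodule.smul_le.mpr fun a ha y _ => by
        rw [LinearMap.mem_ker, map_smul]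
        exact LinearMap.congr_fun (ht a ha) y
    rw [h1] at h2
    exact LinearMap.ext fun x => h2 trivial

theorem isArtinian_of_finite_of_smul_eq_zero [IsNoetherianRing R] (hE : IsSocleInjective R E)
    [Module.Finite R M] (h : ∀ a ∈ maximalIdeal R, ∀ x : M, a • x = 0) (i : ℕ) :
    IsArtinian R (DualLocCoh (maximalIdeal R) E i M) := by
  rcases i with _ | i
  · obtain ⟨e, -, -, he⟩ := hE.exists_generator
    obtain ⟨n, g, hg⟩ := Module.Finite.exists_fin' R M
    let j : (M →ₗ[R] E) →ₗ[R] Fin n → Submodule.span R {e} :=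
      { toFun := fun φ i => ⟨φ (g (Pi.single i 1)), he _ fun a ha => by
          rw [← map_smul, h a ha, map_zero]⟩
        map_add' := fun _ _ => rfl
        map_smul' := fun _ _ => rfl }
    have hj : Function.Injective j := by
      intro φ ψ hφψ
      have h1 : φ ∘ₗ g = ψ ∘ₗ g := by
        refine LinearMap.pi_ext' fun i => LinearMap.ext_ring ?_
        exact congrArg Subtype.val (congrFun hφψ i)
      exact LinearMap.ext fun x => by
        obtain ⟨y, rfl⟩ := hg x
        exact LinearMap.congr_fun h1 y
    have : IsNoetherian R (M →ₗ[R] E) := isNoetherian_of_injective j hj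
    have : IsArtinian R (M →ₗ[R] E) := _root_.isArtinian_of_finite_of_smul_eq_zero
      fun a ha φ => LinearMap.ext fun x => by
        rw [LinearMap.smul_apply, ← map_smul, h a ha, map_zero, LinearMap.zero_apply]
    exact isArtinian_of_injective (zeroEval _ E M) (zeroEval_injective _ E)
  · have := subsingleton_of_finite (maximalIdeal R) hE.injective i M
    infer_instance

end DualLocCoh

end SocleInjective

end

/-! ### Artinianness criterion, attached primes, minimal submodules -/

section

open IsLocalRing Submodule

section Artinian

variable {R : Type u} [CommRing R] {V : Type v} [AddCommGroup V] [Module R V]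

theorem exact_subtype_torsionBy_lsmul (x : R) :
    Function.Exact (torsionBy R V x).subtype (LinearMap.lsmul R V x) := fun y =>
  ⟨fun hy => ⟨⟨y, hy⟩, rfl⟩, by rintro ⟨z, rfl⟩; exact z.2⟩

/-- A module in which each element is killed by a power of `x` is Artinian if the submodule of
elements killed by `x` is. -/
theorem isArtinian_of_isArtinian_torsionBy (x : R) (htors : ∀ a : V, ∃ n : ℕ, x ^ n • a = 0)
    [IsArtinian R (torsionBy R V x)] : IsArtinian R V := by
  rw [← monotone_stabilizes_iff_artinian]
  intro f
  let L : ℕ → Submodule R V := fun n => OrderDual.ofDual (f n)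
  have hL : Antitone L := fun i j h => f.monotone h
  -- `c j n = xⁿ(Lⱼ ∩ V[xⁿ⁺¹])` collects the leading terms in `V[x]` of elements of `Lⱼ`. It
  -- decreases in both indices.
  let c : ℕ → ℕ → Submodule R (torsionBy R V x) := fun j n =>
    ((L j ⊓ torsionBy R V (x ^ (n + 1))).map (LinearMap.lsmul R V (x ^ n))).comap
      (torsionBy R V x).subtype
  have hcj : ∀ {j k n}, j ≤ k → c k n ≤ c j n := fun h =>
    comap_mono (map_mono (inf_le_inf_right _ (hL h)))
  have hcn' : ∀ j n, c j (n + 1) ≤ c j n := by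
    rintro j n ⟨y, hy⟩ ⟨z, ⟨hzL, hz⟩, hzy⟩
    refine ⟨x • z, ⟨(L j).smul_mem x hzL, ?_⟩, ?_⟩
    · rw [SetLike.mem_coe, mem_torsionBy_iff] at hz ⊢
      rwa [← mul_smul, ← pow_succ]
    · rw [← hzy, LinearMap.lsmul_apply, LinearMap.lsmul_apply, ← mul_smul, ← pow_succ]
  have hcn : ∀ {j n k}, n ≤ k → c j k ≤ c j n := fun {j} _ _ h =>
    antitone_nat_of_succ_le (f := c j) (hcn' j) h
  have hstab : ∃ j₀, ∀ j ≥ j₀, ∀ n, c j₀ n ≤ c j n := by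
    obtain ⟨N, hN⟩ := IsArtinian.monotone_stabilizes
      (⟨fun n => OrderDual.toDual (c n n), fun i j h => (hcn h).trans (hcj h)⟩ :
        ℕ →o (Submodule R (torsionBy R V x))ᵒᵈ)
    have hfix : ∀ n, ∃ j₀, ∀ j ≥ j₀, c j₀ n ≤ c j n := fun n => by
      obtain ⟨j₀, h⟩ := IsArtinian.monotone_stabilizes
        (⟨fun j => OrderDual.toDual (c j n), fun i j h => hcj h⟩ :
          ℕ →o (Submodule R (torsionBy R V x))ᵒᵈ)
      exact ⟨j₀, fun j hj => (show c j₀ n = c j n from congrArg OrderDual.ofDual (h j hj)).le⟩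
    choose g hg using hfix
    -- The stationary diagonal handles all `n ≥ N` at once; each of the finitely many `n < N` has
    -- its own bound.
    refine ⟨max N ((Finset.range N).sup g), fun j hj n => ?_⟩
    rcases lt_or_ge n N with hn | hn
    · have h1 : g n ≤ max N ((Finset.range N).sup g) :=
        le_trans (Finset.le_sup (Finset.mem_range.mpr hn)) (le_max_right _ _)
      exact (hcj h1).trans (hg n j (h1.trans hj))
    · have h1 : c N N = c (max j n) (max j n) := congrArg OrderDual.ofDual
        (hN (max j n) (hn.trans (le_max_right _ _)))
      calc c _ n ≤ c N n := hcj (le_max_left _ _)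
        _ ≤ c N N := hcn hn
        _ = c (max j n) (max j n) := h1
        _ ≤ c j (max j n) := hcj (le_max_left _ _)
        _ ≤ c j n := hcn (le_max_right _ _)
  obtain ⟨j₀, hj₀⟩ := hstab
  refine ⟨j₀, fun j hj => le_antisymm (α := Submodule R V) ?_ (hL hj)⟩
  -- Subtracting an element of `Lⱼ` with the same leading term lowers the power of `x` that kills
  -- `y`.
  have key : ∀ n, ∀ y ∈ L j₀, x ^ n • y = 0 → y ∈ L j := by
    intro n
    induction n with
    | zero =>
      intro y _ hy
      rw [pow_zero, one_smul] at hy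
      rw [hy]
      exact zero_mem _
    | succ n ih =>
      intro y hyL hy
      have hmem : x ^ n • y ∈ torsionBy R V x := by
        rw [mem_torsionBy_iff, ← mul_smul, ← pow_succ', hy]
      obtain ⟨z, ⟨hzL, -⟩, hz⟩ := hj₀ j hj n
        (show (⟨x ^ n • y, hmem⟩ : torsionBy R V x) ∈ c j₀ n from ⟨y, ⟨hyL, hy⟩, rfl⟩)
      have h1 := ih (y - z) (sub_mem hyL (hL hj hzL)) (by
        rw [smul_sub, sub_eq_zero]
        exact hz.symm)
      exact (sub_add_cancel y z) ▸ add_mem h1 hzL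
  intro y hy
  obtain ⟨n, hn⟩ := htors y
  exact key n y hy hn

/-- Induction on Artinian modules: a property of modules holds if it is inherited from the proper
submodules. -/
theorem IsArtinian.module_induction {P : ∀ (M : Type v) [AddCommGroup M] [Module R M], Prop}
    (hequiv : ∀ (M N : Type v) [AddCommGroup M] [Module R M] [AddCommGroup N] [Module R N],
      (M ≃ₗ[R] N) → P M → P N)
    (step : ∀ (M : Type v) [AddCommGroup M] [Module R M] [IsArtinian R M],
      (∀ N : Submodule R M, N < ⊤ → P N) → P M) [IsArtinian R V] : P V := by
  have key : ∀ B : Submodule R V, P B := fun B => by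
    induction B using WellFoundedLT.induction with | _ B ih
    refine step B fun N hN => ?_
    refine hequiv _ _ (B.equivSubtypeMap N).symm (ih _ (lt_of_le_of_ne (map_subtype_le B N) ?_))
    intro h
    refine hN.ne (map_injective_of_injective B.injective_subtype ?_)
    rw [h, map_subtype_top]
  exact hequiv _ _ Submodule.topEquiv (key ⊤)

/-- A finite set of primes, in the role of the attached primes of an Artinian module `V`: an element
outside of them acts surjectively on `V`, up to submodules killed by a power of `m`. -/
theorem IsArtinian.exists_finset_prime [IsArtinian R V] (m : Ideal R) (hm : m.FG) :
    ∃ S : Finset (Ideal R), (∀ p ∈ S, p.IsPrime ∧ ¬ m ≤ p) ∧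
      ∀ x : R, (∀ p ∈ S, x ∉ p) → ∃ k : ℕ, ∀ a ∈ m ^ k, ∀ v : V, ∃ w : V, a • v = x • w := by
  classical
  have key : ∀ N : Submodule R V, ∃ S : Finset (Ideal R), (∀ p ∈ S, p.IsPrime ∧ ¬ m ≤ p) ∧
      ∀ x : R, (∀ p ∈ S, x ∉ p) → ∃ k : ℕ, m ^ k • N ≤ N.map (LinearMap.lsmul R V x) := by
    intro N
    induction N using WellFoundedLT.induction with | _ N ih
    by_cases hred : ∃ N₁ < N, ∃ N₂ < N, N ≤ N₁ ⊔ N₂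
    · obtain ⟨N₁, h₁, N₂, h₂, hN⟩ := hred
      obtain ⟨S₁, hS₁, hx₁⟩ := ih N₁ h₁
      obtain ⟨S₂, hS₂, hx₂⟩ := ih N₂ h₂
      refine ⟨S₁ ∪ S₂, fun p hp => (Finset.mem_union.mp hp).elim (hS₁ p) (hS₂ p), fun x hx => ?_⟩
      obtain ⟨k₁, hk₁⟩ := hx₁ x fun p hp => hx p (Finset.mem_union_left _ hp)
      obtain ⟨k₂, hk₂⟩ := hx₂ x fun p hp => hx p (Finset.mem_union_right _ hp)
      refine ⟨max k₁ k₂, (smul_mono_right _ hN).trans ?_⟩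
      rw [smul_sup]
      refine sup_le ?_ ?_
      · exact (smul_mono_left (Ideal.pow_le_pow_right (le_max_left _ _))).trans
          (hk₁.trans (map_mono h₁.le))
      · exact (smul_mono_left (Ideal.pow_le_pow_right (le_max_right _ _))).trans
          (hk₂.trans (map_mono h₂.le))
    -- When `N` is not a sum of two proper submodules, one summand in its Fitting decomposition is
    -- all of `N`, so each `x` acts surjectively or nilpotently. This makes the radical of the
    -- annihilator prime, unless it contains `m`.
    · have hirr : ∀ x : R, N ≤ N.map (LinearMap.lsmul R V x) ∨ ∃ n, N ≤ torsionBy R V (x ^ n) := by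
        intro x
        obtain ⟨n, hn⟩ := exists_sub_mem_torsionBy_pow x N
        by_contra! hcon
        refine hred ⟨divisiblePart x N, lt_of_le_of_ne (divisiblePart_le x N) fun h => hcon.1 ?_,
          N ⊓ torsionBy R V (x ^ n), lt_of_le_of_ne inf_le_left fun h => hcon.2 n ?_, fun a ha => ?_⟩
        · intro b hb
          rw [← h] at hb
          obtain ⟨b', hb', hxb⟩ := exists_smul_eq_of_mem_divisiblePart hb
          exact ⟨b', divisiblePart_le x N hb', hxb⟩
        · rw [← h]; exact inf_le_right
        · obtain ⟨b, hb, hab⟩ := hn a ha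
          rw [← add_sub_cancel b a]
          exact add_mem_sup hb ⟨sub_mem ha (divisiblePart_le x N hb), hab⟩
      by_cases hmp : m ≤ N.annihilator.radical
      · obtain ⟨k, hk⟩ := Ideal.exists_pow_le_of_le_radical_of_fg hmp hm
        refine ⟨∅, by simp, fun x _ => ⟨k, ?_⟩⟩
        refine smul_le.mpr fun a ha v hv => ?_
        rw [mem_annihilator.mp (hk ha) v hv]
        exact zero_mem _
      · have hnil : ∀ x, (∃ n, N ≤ torsionBy R V (x ^ n)) → x ∈ N.annihilator.radical := by
          rintro x ⟨n, hn⟩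
          exact ⟨n, mem_annihilator.mpr fun v hv => hn hv⟩
        have hprime : (N.annihilator.radical).IsPrime := by
          refine ⟨fun h => hmp (h ▸ le_top), fun {x y} hxy => ?_⟩
          by_contra! hcon
          have hx := (hirr x).resolve_right fun h => hcon.1 (hnil x h)
          have hy := (hirr y).resolve_right fun h => hcon.2 (hnil y h)
          obtain ⟨n, hn⟩ := hxy
          have h1 : ∀ n : ℕ, ∀ v ∈ N, ∃ w ∈ N, (x * y) ^ n • w = v := by
            intro n
            induction n with
            | zero => exact fun v hv => ⟨v, hv, by simp⟩
            | succ n ih =>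
              intro v hv
              obtain ⟨w, hw, rfl⟩ := ih v hv
              obtain ⟨w', hw', rfl⟩ := hx hw
              obtain ⟨w'', hw'', rfl⟩ := hy hw'
              exact ⟨w'', hw'', by
                simp only [LinearMap.lsmul_apply, ← mul_smul, pow_succ]⟩
          have hbot : N.annihilator = ⊤ := by
            rw [annihilator_eq_top_iff, eq_bot_iff]
            intro v hv
            obtain ⟨w, hw, rfl⟩ := h1 n v hv
            exact (mem_annihilator.mp hn w hw)
          exact hmp (by rw [hbot, Ideal.radical_top]; exact le_top)
        refine ⟨{N.annihilator.radical}, by simpa using ⟨hprime, hmp⟩, fun x hx => ⟨0, ?_⟩⟩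
        rw [pow_zero, Ideal.one_eq_top, top_smul]
        exact (hirr x).resolve_right fun h => hx _ (Finset.mem_singleton_self _) (hnil x h)
  obtain ⟨S, hS, h⟩ := key ⊤
  refine ⟨S, hS, fun x hx => ?_⟩
  obtain ⟨k, hk⟩ := h x hx
  refine ⟨k, fun a ha v => ?_⟩
  obtain ⟨w, -, hw⟩ := hk (smul_mem_smul ha (mem_top (x := v)))
  exact ⟨w, hw.symm⟩

/-- An Artinian module whose dimension is not smaller than `d` contains a submodule which is minimal
with this property. -/
theorem IsArtinian.exists_minimal_not_ndimLT [IsArtinian R V] {d : ℕ} (h : ¬ NdimLT R d V) :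
    ∃ B : Submodule R V, ¬ NdimLT R d B ∧ ∀ C : Submodule R B, C < ⊤ → NdimLT R d C := by
  obtain ⟨B, hB, hmin⟩ := IsArtinian.set_has_minimal {B : Submodule R V | ¬ NdimLT R d B}
    ⟨⊤, fun h' => h (h'.of_surjective Submodule.topEquiv.toLinearMap
      Submodule.topEquiv.surjective)⟩
  refine ⟨B, hB, fun C hC => ?_⟩
  by_contra hCd
  refine hmin (C.map B.subtype) (fun h' => hCd (h'.of_injective
    (B.equivSubtypeMap C).toLinearMap (B.equivSubtypeMap C).injective))
    (lt_of_le_of_ne (map_subtype_le B C) fun h => ?_)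
  refine hC.ne (map_injective_of_injective B.injective_subtype ?_)
  rw [h, map_subtype_top]

/-- Otherwise `V[x]` and `xV` are both proper, hence of dimension below `d`, and so is their
extension `V`. -/
theorem smul_surjective_or_eq_zero {d : ℕ} (h : ¬ NdimLT R d V)
    (hmin : ∀ C : Submodule R V, C < ⊤ → NdimLT R d C) (x : R) :
    Function.Surjective (LinearMap.lsmul R V x) ∨ ∀ v : V, x • v = 0 := by
  by_contra! hcon
  obtain ⟨hs, v, hv⟩ := hcon
  refine h (NdimLT.of_exact (hmin (torsionBy R V x) (lt_top_iff_ne_top.mpr fun ht => hv ?_))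
    (hmin (LinearMap.lsmul R V x).range (lt_top_iff_ne_top.mpr fun ht => hs
      (LinearMap.range_eq_top.mp ht))) (torsionBy R V x).subtype
      (LinearMap.lsmul R V x).rangeRestrict fun y => ?_)
  · have : v ∈ torsionBy R V x := ht ▸ mem_top
    exact this
  · rw [← exact_subtype_torsionBy_lsmul x y]
    exact Subtype.ext_iff

end Artinian

end

/-! ### Vanishing and nonvanishing for Artinian modules -/

section

open IsLocalRing Submodule

theorem Ideal.exists_mem_notMem_of_finset {R : Type u} [CommRing R] {I : Ideal R}
    {S : Finset (Ideal R)} (h : ∀ p ∈ S, p.IsPrime ∧ ¬ I ≤ p) : ∃ x ∈ I, ∀ p ∈ S, x ∉ p := by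
  have h1 := (Ideal.subset_union_prime (s := S) (f := id) ⊥ ⊥ (I := I)
    fun p hp _ _ => (h p hp).1).not.mpr fun ⟨p, hp, hle⟩ => (h p hp).2 hle
  obtain ⟨x, hx, hxS⟩ := Set.not_subset.mp h1
  refine ⟨x, hx, fun p hp hxp => hxS ?_⟩
  exact Set.mem_biUnion hp hxp

namespace DualLocCoh

variable {R : Type u} [CommRing R] {I : Ideal R} {E : Type u} [AddCommGroup E] [Module R E]
  {M : Type u} [AddCommGroup M] [Module R M]

theorem exact_subtype_torsionBy_rangeRestrict (x : R) :
    Function.Exact (torsionBy R M x).subtype (LinearMap.lsmul R M x).rangeRestrict := fun y => by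
  rw [← exact_subtype_torsionBy_lsmul x y]
  exact Subtype.ext_iff

theorem exists_pow_smul_eq_zero_of_mem {i : ℕ} {x : R} (hx : x ∈ I) (v : DualLocCoh I E i M) :
    ∃ n : ℕ, x ^ n • v = 0 := by
  obtain ⟨t, ht⟩ := exists_pow_smul_eq_zero I v
  exact ⟨t, ht _ (Ideal.pow_mem_pow hx t)⟩

/-- Every element is killed by a power of `x`, so an injective action of `x` leaves only zero. -/
theorem subsingleton_of_smul_injective {i : ℕ} {x : R} (hx : x ∈ I)
    (h : ∀ v : DualLocCoh I E i M, x • v = 0 → v = 0) : Subsingleton (DualLocCoh I E i M) := by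
  refine (subsingleton_iff_forall_eq 0).mpr fun v => ?_
  obtain ⟨n, hn⟩ := exists_pow_smul_eq_zero_of_mem hx v
  induction n with
  | zero => rwa [pow_zero, one_smul] at hn
  | succ n ih =>
    rw [pow_succ', mul_smul] at hn
    exact ih (h _ hn)

theorem smul_eq_zero_iff_of_smul_surjective (hE : Module.Injective R E) {x : R}
    (hx : Function.Surjective (LinearMap.lsmul R M x)) (i : ℕ) (v : DualLocCoh I E (i + 1) M) :
    x • v = 0 ↔ v ∈ (δ I hE (torsionBy R M x).injective_subtype
      (exact_subtype_torsionBy_lsmul x) hx i).range := by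
  have h := exact_δ_map I hE (torsionBy R M x).injective_subtype
    (exact_subtype_torsionBy_lsmul x) hx i v
  rw [map_lsmul] at h
  exact h

theorem subsingleton_zero_of_smul_surjective {x : R} (hxI : x ∈ I)
    (hx : Function.Surjective (LinearMap.lsmul R M x)) : Subsingleton (DualLocCoh I E 0 M) := by
  refine subsingleton_of_smul_injective hxI fun v hv => zeroEval_injective I E ?_
  refine LinearMap.ext fun a => ?_
  obtain ⟨b, rfl⟩ := hx a
  rw [map_zero, LinearMap.zero_apply, LinearMap.lsmul_apply, map_smul, ← LinearMap.smul_apply,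
    ← map_smul, hv, map_zero, LinearMap.zero_apply]

theorem subsingleton_of_smul_surjective (hE : Module.Injective R E) {x : R} (hxI : x ∈ I)
    (hx : Function.Surjective (LinearMap.lsmul R M x)) (i : ℕ)
    (h : Subsingleton (DualLocCoh I E i (torsionBy R M x))) :
    Subsingleton (DualLocCoh I E (i + 1) M) := by
  refine subsingleton_of_smul_injective hxI fun v hv => ?_
  obtain ⟨w, rfl⟩ := (smul_eq_zero_iff_of_smul_surjective hE hx i v).mp hv
  rw [Subsingleton.elim w 0, map_zero]

theorem exists_pow_smul_eq_of_smul_surjective (hE : Module.Injective R E) {x : R}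
    (hx : Function.Surjective (LinearMap.lsmul R M x)) (i : ℕ)
    (h : Subsingleton (DualLocCoh I E i (torsionBy R M x))) (n : ℕ) (v : DualLocCoh I E i M) :
    ∃ w, x ^ n • w = v := by
  have hex := exact_map_map I hE (torsionBy R M x).injective_subtype
    (exact_subtype_torsionBy_lsmul x) hx i
  induction n generalizing v with
  | zero => exact ⟨v, by rw [pow_zero, one_smul]⟩
  | succ n ih =>
    obtain ⟨w, rfl⟩ := ih v
    obtain ⟨w, rfl⟩ := (hex w).mp (Subsingleton.elim _ _)
    refine ⟨w, ?_⟩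
    rw [map_lsmul, LinearMap.lsmul_apply, pow_succ, mul_smul]

variable [IsLocalRing R] [IsNoetherianRing R]

/-- Induction over proper submodules, for `x ∈ 𝔪` not killing `M`. If `x` is surjective on `M`, the
`x`-torsion of `D^{i+1}(M)` is an image of `D^i(M[x])`, and the criterion by `x`-torsion applies. If
not, `M[x]` and `xM` are both proper. -/
theorem isArtinian (hE : IsSocleInjective R E) [IsArtinian R M] (i : ℕ) :
    IsArtinian R (DualLocCoh (maximalIdeal R) E i M) := by
  refine IsArtinian.module_induction (R := R) (V := M)
    (P := fun M _ _ => ∀ i, IsArtinian R (DualLocCoh (maximalIdeal R) E i M)) ?_ ?_ i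
  · intro M N _ _ _ _ e h i
    have := h i
    refine isArtinian_of_surjective _ (map (maximalIdeal R) E i e.symm.toLinearMap) fun v => ?_
    refine ⟨map _ E i e.toLinearMap v, ?_⟩
    rw [map_map]
    simpa using map_id _ E i v
  · intro M _ _ _ ih i
    by_cases hm : ∀ a ∈ maximalIdeal R, ∀ y : M, a • y = 0
    · have := isNoetherian_of_isArtinian_of_smul_eq_zero hm
      exact isArtinian_of_finite_of_smul_eq_zero hE hm i
    push Not at hm
    obtain ⟨x, hxm, y, hy⟩ := hm
    have hK : torsionBy R M x < ⊤ := lt_top_iff_ne_top.mpr fun h =>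
      hy (show y ∈ torsionBy R M x from h ▸ mem_top)
    by_cases hx : Function.Surjective (LinearMap.lsmul R M x)
    · rcases i with _ | i
      · have := subsingleton_zero_of_smul_surjective (E := E) hxm hx
        infer_instance
      · have := ih _ hK i
        have h1 : torsionBy R (DualLocCoh (maximalIdeal R) E (i + 1) M) x ≤ _ := fun v hv =>
          (smul_eq_zero_iff_of_smul_surjective hE.injective hx i v).mp hv
        have : IsArtinian R (torsionBy R (DualLocCoh (maximalIdeal R) E (i + 1) M) x) :=
          isArtinian_of_le h1
        exact isArtinian_of_isArtinian_torsionBy x (exists_pow_smul_eq_zero_of_mem hxm)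
    · have h1 := ih _ hK i
      have h2 := ih (LinearMap.lsmul R M x).range (lt_top_iff_ne_top.mpr fun h =>
        hx (LinearMap.range_eq_top.mp h)) i
      exact isArtinian_of_range_eq_ker _ _ (LinearMap.exact_iff.mp (exact_map_map (maximalIdeal R)
        hE.injective (torsionBy R M x).injective_subtype (exact_subtype_torsionBy_rangeRestrict x)
        (LinearMap.lsmul R M x).surjective_rangeRestrict i)).symm

/-- The same case distinction; when `x` acts surjectively, `M[x]` has smaller dimension, so
`D^{i-1}(M[x]) = 0` and `x` is injective on `D^i(M)`. -/
theorem subsingleton_of_ndimLT (hE : Module.Injective R E) {n : ℕ} [IsArtinian R M]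
    (hn : NdimLT R n M) {i : ℕ} (hi : n ≤ i) :
    Subsingleton (DualLocCoh (maximalIdeal R) E i M) := by
  induction n generalizing M i with
  | zero =>
    have : Subsingleton M := hn
    have : Subsingleton (DualLocCoh (maximalIdeal R) E i M) := by
      have h0 : (LinearMap.id : M →ₗ[R] M) = LinearMap.lsmul R M 0 := by
        ext; exact Subsingleton.elim _ _
      refine (subsingleton_iff_forall_eq 0).mpr fun v => ?_
      rw [← map_id _ E i v, h0, map_lsmul]
      exact zero_smul R v
    exact this
  | succ n ihn =>
    refine IsArtinian.module_induction (R := R) (V := M) (P := fun M _ _ => NdimLT R (n + 1) M →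
      ∀ i, n + 1 ≤ i → Subsingleton (DualLocCoh (maximalIdeal R) E i M)) ?_ ?_ hn i hi
    · intro M N _ _ _ _ e h hN i hi
      exact subsingleton_of_linearEquiv _ E e (h (hN.of_injective e.toLinearMap e.injective) i hi)
    · intro M _ _ _ ih hM i hi
      obtain ⟨i, rfl⟩ := Nat.exists_eq_add_of_le' (Nat.le_of_add_left_le hi : 1 ≤ i)
      by_cases hm : ∀ a ∈ maximalIdeal R, ∀ y : M, a • y = 0
      · have := isNoetherian_of_isArtinian_of_smul_eq_zero hm
        exact subsingleton_of_finite _ hE i M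
      push Not at hm
      obtain ⟨x, hxm, y, hy⟩ := hm
      have hK : torsionBy R M x < ⊤ := lt_top_iff_ne_top.mpr fun h =>
        hy (show y ∈ torsionBy R M x from h ▸ mem_top)
      by_cases hx : Function.Surjective (LinearMap.lsmul R M x)
      · exact subsingleton_of_smul_surjective hE hxm hx i
          (ihn (hM.torsionBy_of_smul_surjective hx) (by omega))
      · have h1 := ih _ hK (hM.of_injective _ (torsionBy R M x).injective_subtype) _ hi
        have h2 := ih (LinearMap.lsmul R M x).range (lt_top_iff_ne_top.mpr fun h =>
          hx (LinearMap.range_eq_top.mp h)) (hM.of_injective _ (injective_subtype _)) _ hi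
        have h3 := exact_map_map (maximalIdeal R)
          hE (torsionBy R M x).injective_subtype (exact_subtype_torsionBy_rangeRestrict x)
          (LinearMap.lsmul R M x).surjective_rangeRestrict (i + 1)
        refine (subsingleton_iff_forall_eq 0).mpr fun v => ?_
        obtain ⟨w, rfl⟩ := (h3 v).mp (Subsingleton.elim _ _)
        rw [Subsingleton.elim w 0, map_zero]

theorem exists_pow_smul_eq_of_ndimLT (hE : Module.Injective R E) {x : R} [IsArtinian R M]
    (hx : Function.Surjective (LinearMap.lsmul R M x)) {d : ℕ} (hM : NdimLT R (d + 1) M) (n : ℕ)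
    (v : DualLocCoh (maximalIdeal R) E d M) : ∃ w, x ^ n • w = v :=
  exists_pow_smul_eq_of_smul_surjective hE hx d
    (subsingleton_of_ndimLT hE (hM.torsionBy_of_smul_surjective hx) le_rfl) n v

/-- The obstruction lies in `D^{d+1}(M/B)`, which vanishes for reasons of dimension. -/
theorem map_subtype_surjective (hE : Module.Injective R E) {d : ℕ} [IsArtinian R M]
    (hM : NdimLT R (d + 1) M) (B : Submodule R M) :
    Function.Surjective (map (maximalIdeal R) E d B.subtype) := fun v => by
  have h : NdimLT R (d + 1) (M ⧸ B) := hM.of_surjective B.mkQ B.mkQ_surjective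
  have := subsingleton_of_ndimLT hE h le_rfl
  exact (exact_map_δ (maximalIdeal R) hE B.injective_subtype (LinearMap.exact_subtype_mkQ B)
    B.mkQ_surjective d v).mp (Subsingleton.elim _ _)

/-- By minimality each element acts surjectively or as zero, so the annihilator is prime. It does
not contain `𝔪`, since otherwise `M` would be Noetherian, of dimension at most 0. Prime avoidance
can therefore include it. -/
theorem exists_smul_surjective_of_minimal [IsArtinian R M] {e : ℕ} (h : ¬ NdimLT R (e + 1) M)
    (hmin : ∀ C : Submodule R M, C < ⊤ → NdimLT R (e + 1) C) {S : Finset (Ideal R)}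
    (hS : ∀ p ∈ S, p.IsPrime ∧ ¬ maximalIdeal R ≤ p) :
    ∃ x ∈ maximalIdeal R, (∀ p ∈ S, x ∉ p) ∧ Function.Surjective (LinearMap.lsmul R M x) := by
  classical
  have hdich := smul_surjective_or_eq_zero h hmin
  have hM : Nontrivial M := not_subsingleton_iff_nontrivial.mp fun _ =>
    h NdimLT.of_subsingleton
  have hann : (Module.annihilator R M).IsPrime ∧ ¬ maximalIdeal R ≤ Module.annihilator R M := by
    refine ⟨⟨fun h1 => ?_, fun {x y} hxy => ?_⟩, fun h1 => ?_⟩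
    · exact not_subsingleton M (Module.annihilator_eq_top_iff.mp h1)
    · by_contra! hcon
      have hx := (hdich x).resolve_right fun h => hcon.1 (Module.mem_annihilator.mpr h)
      have hy := (hdich y).resolve_right fun h => hcon.2 (Module.mem_annihilator.mpr h)
      refine not_subsingleton M ((subsingleton_iff_forall_eq 0).mpr fun v => ?_)
      obtain ⟨v, rfl⟩ := hx v
      obtain ⟨v, rfl⟩ := hy v
      rw [LinearMap.lsmul_apply, LinearMap.lsmul_apply, ← mul_smul]
      exact Module.mem_annihilator.mp hxy v
    · have := isNoetherian_of_isArtinian_of_smul_eq_zero (R := R) (A := M)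
        fun a ha => Module.mem_annihilator.mp (h1 ha)
      exact h ((NdimLT.one_iff.mpr this).mono (by omega))
  obtain ⟨x, hx, hxS⟩ := Ideal.exists_mem_notMem_of_finset (I := maximalIdeal R)
    (S := insert (Module.annihilator R M) S) fun p hp => by
      rcases Finset.mem_insert.mp hp with rfl | hp
      · exact hann
      · exact hS p hp
  refine ⟨x, hx, fun p hp => hxS p (Finset.mem_insert_of_mem hp), (hdich x).resolve_right
    fun h => hxS _ (Finset.mem_insert_self _ _) (Module.mem_annihilator.mpr h)⟩

/-- The local cohomology of the dual of an Artinian module does not vanish in the degree of the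
Noetherian dimension. -/
theorem not_subsingleton_of_ndimLT (hE : IsSocleInjective R E) {d : ℕ} [IsArtinian R M]
    (hM : NdimLT R (d + 1) M) (hM' : ¬ NdimLT R d M) :
    ¬ Subsingleton (DualLocCoh (maximalIdeal R) E d M) := by
  induction d generalizing M with
  | zero =>
    intro h
    rw [subsingleton_zero_iff_smul_top hE] at h
    have := NdimLT.one_iff.mp hM
    refine hM' ?_
    have h1 : (⊤ : Submodule R M) = ⊥ := Submodule.eq_bot_of_le_smul_of_le_jacobson_bot
      (maximalIdeal R) ⊤ Module.Finite.fg_top h.ge (maximalIdeal_le_jacobson ⊥)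
    exact (Submodule.subsingleton_iff R).mp (subsingleton_of_bot_eq_top h1.symm)
  | succ e ih =>
    intro hsub
    obtain ⟨B, hB, hmin⟩ := IsArtinian.exists_minimal_not_ndimLT hM'
    have hB' : NdimLT R (e + 2) B := hM.of_injective _ B.injective_subtype
    have hBsub : Subsingleton (DualLocCoh (maximalIdeal R) E (e + 1) B) :=
      (map_subtype_surjective hE.injective hM B).subsingleton
    have := isArtinian hE (M := B) e
    -- Avoiding these primes makes `D^e(B)/xD^e(B)` killed by a power of `𝔪`. As `D^{e+1}(B) = 0`,
    -- this quotient is `D^e(B[x])`.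
    obtain ⟨S, hS, hSx⟩ := IsArtinian.exists_finset_prime (R := R)
      (V := DualLocCoh (maximalIdeal R) E e B) (maximalIdeal R) (IsNoetherian.noetherian _)
    obtain ⟨x, hxm, hxS, hx⟩ := exists_smul_surjective_of_minimal hB hmin hS
    obtain ⟨k, hk⟩ := hSx x hxS
    have hex₁ := exact_map_map (maximalIdeal R) hE.injective (torsionBy R B x).injective_subtype
      (exact_subtype_torsionBy_lsmul x) hx e
    have hex₂ := exact_map_δ (maximalIdeal R) hE.injective (torsionBy R B x).injective_subtype
      (exact_subtype_torsionBy_lsmul x) hx e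
    have hK : NdimLT R (e + 1) (torsionBy R B x) := hB'.torsionBy_of_smul_surjective hx
    have hK' : ¬ NdimLT R e (torsionBy R B x) := fun h => hB (h.succ_of_torsionBy fun a => by
      obtain ⟨t, ht⟩ := IsArtinian.exists_pow_smul_eq_zero (R := R) a
      exact ⟨t, ht _ (Ideal.pow_mem_pow hxm t)⟩)
    have hsurj : Function.Surjective (map (maximalIdeal R) E e (torsionBy R B x).subtype) :=
      fun v => (hex₂ v).mp (Subsingleton.elim _ _)
    rcases e with _ | e
    · have := subsingleton_zero_of_smul_surjective (E := E) hxm hx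
      exact ih hK hK' hsurj.subsingleton
    · have hkill : ∀ a ∈ maximalIdeal R ^ k,
          ∀ v : DualLocCoh (maximalIdeal R) E (e + 1) (torsionBy R B x), a • v = 0 := by
        intro a ha v
        obtain ⟨v, rfl⟩ := hsurj v
        obtain ⟨w, hw⟩ := hk a ha v
        rw [← map_smul, hw]
        refine (hex₁ _).mpr ⟨w, ?_⟩
        rw [map_lsmul]
        rfl
      -- The top-degree module of `C` is a quotient of that of `B[x]`, hence killed by `yᵏ`. It is
      -- also `y`-divisible, so it vanishes, against the induction hypothesis.
      obtain ⟨C, hC, hCmin⟩ := IsArtinian.exists_minimal_not_ndimLT hK'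
      have hC' : NdimLT R (e + 2) C := hK.of_injective _ C.injective_subtype
      obtain ⟨y, hym, -, hy⟩ := exists_smul_surjective_of_minimal hC hCmin (S := ∅) (by simp)
      have hCsurj := map_subtype_surjective hE.injective hK C
      have hdiv := exists_pow_smul_eq_of_ndimLT hE.injective hy hC' k
      refine ih hC' hC ((subsingleton_iff_forall_eq 0).mpr fun v => ?_)
      obtain ⟨w, rfl⟩ := hdiv v
      obtain ⟨w, rfl⟩ := hCsurj w
      rw [← map_smul, hkill _ (Ideal.pow_mem_pow hym k), map_zero]

end DualLocCoh

end

/-! ### Tor computed by chains of a projective resolution -/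

section

open CategoryTheory MonoidalCategory TensorProduct

namespace HomologicalComplex

variable {R : Type u} [CommRing R] {ι : Type*} {c : ComplexShape ι}
  (K L : HomologicalComplex (ModuleCat.{u} R) c)

/-- The cycle `y` represents the homology class `h`. -/
def Represents (i : ι) (y : K.X i) (h : K.homology i) : Prop :=
  ∃ z : K.cycles i, K.iCycles i z = y ∧ K.homologyπ i z = h

variable {K L} {i : ι}

theorem exists_represents (h : K.homology i) : ∃ y, K.Represents i y h := by
  obtain ⟨z, hz⟩ := (ModuleCat.epi_iff_surjective (K.homologyπ i)).mp inferInstance h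
  exact ⟨K.iCycles i z, z, rfl, hz⟩

theorem exists_represents_of_d_eq_zero {j : ι} (hj : c.next i = j) {y : K.X i}
    (hy : K.d i j y = 0) : ∃ h, K.Represents i y h := by
  have hex := (ShortComplex.moduleCat_exact_iff _).mp
    (ShortComplex.exact_of_f_is_kernel (ShortComplex.mk _ _ (K.iCycles_d i j))
      (K.cyclesIsKernel i j hj))
  obtain ⟨z, hz⟩ := hex y hy
  exact ⟨_, z, hz, rfl⟩

namespace Represents

variable {y y' : K.X i} {h h' : K.homology i}

theorem of_eq (hy : K.Represents i y h) (hyy' : y = y') (hh' : h = h') : K.Represents i y' h' :=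
  hyy' ▸ hh' ▸ hy

theorem d_eq_zero (hy : K.Represents i y h) (j : ι) : K.d i j y = 0 := by
  obtain ⟨z, rfl, -⟩ := hy
  exact ConcreteCategory.congr_hom (K.iCycles_d i j) z

theorem eq_zero_iff (hy : K.Represents i y h) {k : ι} (hk : c.prev i = k) :
    h = 0 ↔ ∃ w, K.d k i w = y := by
  obtain ⟨z, rfl, rfl⟩ := hy
  have hex := (ShortComplex.moduleCat_exact_iff _).mp
    (ShortComplex.exact_of_g_is_cokernel (ShortComplex.mk _ _ (K.toCycles_comp_homologyπ k i))
      (K.homologyIsCokernel k i hk))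
  have htoc : ∀ w, K.iCycles i (K.toCycles k i w) = K.d k i w := fun w =>
    ConcreteCategory.congr_hom (K.toCycles_i k i) w
  constructor
  · intro hz
    obtain ⟨w, rfl⟩ := hex z hz
    exact ⟨w, (htoc w).symm⟩
  · rintro ⟨w, hw⟩
    rw [← htoc] at hw
    rw [← (ModuleCat.mono_iff_injective (K.iCycles i)).mp inferInstance hw]
    exact ConcreteCategory.congr_hom (K.toCycles_comp_homologyπ k i) w

theorem smul (hy : K.Represents i y h) (a : R) : K.Represents i (a • y) (a • h) := by
  obtain ⟨z, rfl, rfl⟩ := hy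
  exact ⟨a • z, map_smul _ _ _, map_smul _ _ _⟩

theorem sub (hy : K.Represents i y h) (hy' : K.Represents i y' h') :
    K.Represents i (y - y') (h - h') := by
  obtain ⟨z, rfl, rfl⟩ := hy
  obtain ⟨z', rfl, rfl⟩ := hy'
  exact ⟨z - z', map_sub _ _ _, map_sub _ _ _⟩

theorem map (hy : K.Represents i y h) (φ : K ⟶ L) :
    L.Represents i (φ.f i y) (homologyMap φ i h) := by
  obtain ⟨z, rfl, rfl⟩ := hy
  refine ⟨cyclesMap φ i z, ?_, ?_⟩
  · exact ConcreteCategory.congr_hom (cyclesMap_i φ i) z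
  · exact (ConcreteCategory.congr_hom (homologyπ_naturality φ i) z).symm

end Represents

end HomologicalComplex

section Quotient

variable {R : Type u} [CommRing R] (J : Ideal R) {N : Type u} [AddCommGroup N] [Module R N]

theorem Ideal.exists_one_tmul_eq (x : (R ⧸ J) ⊗[R] N) : ∃ z : N, (1 : R ⧸ J) ⊗ₜ[R] z = x := by
  induction x with
  | zero => exact ⟨0, tmul_zero _ _⟩
  | tmul q z =>
    obtain ⟨r, rfl⟩ := Ideal.Quotient.mk_surjective q
    refine ⟨r • z, ?_⟩
    rw [tmul_smul, smul_tmul', ← Ideal.Quotient.algebraMap_eq, Algebra.algebraMap_eq_smul_one]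
  | add x y hx hy =>
    obtain ⟨z, rfl⟩ := hx
    obtain ⟨z', rfl⟩ := hy
    exact ⟨z + z', tmul_add _ _ _⟩

theorem Ideal.one_tmul_eq_zero_iff (z : N) :
    (1 : R ⧸ J) ⊗ₜ[R] z = 0 ↔ z ∈ J • (⊤ : Submodule R N) := by
  rw [← (quotTensorEquivQuotSMul N J).map_eq_zero_iff]
  have : (quotTensorEquivQuotSMul N J) ((1 : R ⧸ J) ⊗ₜ[R] z) = Submodule.Quotient.mk z := by
    have := quotTensorEquivQuotSMul_mk_tmul J (1 : R) z
    rw [one_smul] at this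
    exact this
  rw [this, Submodule.Quotient.mk_eq_zero]

end Quotient

section Tor

variable {R : Type u} [CommRing R] {M : ModuleCat.{u} R} (P : ProjectiveResolution M)

/-- The projective resolution tensored with a module. -/
noncomputable abbrev CategoryTheory.ProjectiveResolution.tensorComplex (X : ModuleCat.{u} R) :
    ChainComplex (ModuleCat.{u} R) ℕ :=
  (((tensoringLeft (ModuleCat.{u} R)).obj X).mapHomologicalComplex _).obj P.complex

/-- The torsion product is the homology of the tensored resolution. -/
noncomputable def CategoryTheory.ProjectiveResolution.torIso (X : ModuleCat.{u} R) (i : ℕ) :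
    ((Tor (ModuleCat.{u} R) i).obj X).obj M ≅ (P.tensorComplex X).homology i :=
  P.isoLeftDerivedObj ((tensoringLeft (ModuleCat.{u} R)).obj X) i

theorem CategoryTheory.ProjectiveResolution.torIso_naturality {X Y : ModuleCat.{u} R} (f : X ⟶ Y)
    (i : ℕ) : ((Tor (ModuleCat.{u} R) i).map f).app M ≫ (P.torIso Y i).hom =
      (P.torIso X i).hom ≫ HomologicalComplex.homologyMap ((NatTrans.mapHomologicalComplex
        ((tensoringLeft (ModuleCat.{u} R)).map f) _).app P.complex) i := by
  have h := ProjectiveResolution.leftDerived_app_eq ((tensoringLeft (ModuleCat.{u} R)).map f) P i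
  rw [← Iso.eq_comp_inv, Category.assoc]
  exact h

/-- The element `z` of the projective resolution represents the element `h` of the torsion product
with `R ⧸ J`. -/
def CategoryTheory.ProjectiveResolution.RepresentsTor (J : Ideal R) (i : ℕ) (z : P.complex.X i)
    (h : ((Tor (ModuleCat.{u} R) i).obj (ModuleCat.of R (R ⧸ J))).obj M) : Prop :=
  (P.tensorComplex (ModuleCat.of R (R ⧸ J))).Represents i
    ((1 : R ⧸ J) ⊗ₜ[R] z : (R ⧸ J) ⊗[R] P.complex.X i)
    ((P.torIso (ModuleCat.of R (R ⧸ J)) i).hom h)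

namespace CategoryTheory.ProjectiveResolution

variable {P} {J : Ideal R} {i : ℕ}

theorem exists_representsTor (h : ((Tor (ModuleCat.{u} R) i).obj (ModuleCat.of R (R ⧸ J))).obj M) :
    ∃ z, P.RepresentsTor J i z h := by
  obtain ⟨y, hy⟩ := HomologicalComplex.exists_represents ((P.torIso (ModuleCat.of R (R ⧸ J)) i).hom h)
  obtain ⟨z, rfl⟩ := J.exists_one_tmul_eq (N := P.complex.X i) y
  exact ⟨z, hy⟩

theorem tensorComplex_d_one_tmul (j : ℕ) (z : P.complex.X i) :
    (P.tensorComplex (ModuleCat.of R (R ⧸ J))).d i j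
      ((1 : R ⧸ J) ⊗ₜ[R] z : (R ⧸ J) ⊗[R] P.complex.X i) =
      ((1 : R ⧸ J) ⊗ₜ[R] (P.complex.d i j z) : (R ⧸ J) ⊗[R] P.complex.X j) := rfl

theorem exists_representsTor_of_mem {z : P.complex.X i} {j : ℕ}
    (hj : (ComplexShape.down ℕ).next i = j)
    (hz : P.complex.d i j z ∈ J • (⊤ : Submodule R (P.complex.X j))) :
    ∃ h, P.RepresentsTor J i z h := by
  obtain ⟨h, hh⟩ := HomologicalComplex.exists_represents_of_d_eq_zero
    (K := P.tensorComplex (ModuleCat.of R (R ⧸ J))) hj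
    (y := ((1 : R ⧸ J) ⊗ₜ[R] z : (R ⧸ J) ⊗[R] P.complex.X i))
    ((tensorComplex_d_one_tmul j z).trans ((J.one_tmul_eq_zero_iff _).mpr hz))
  refine ⟨(P.torIso _ i).inv h, ?_⟩
  exact hh.of_eq rfl
    (ConcreteCategory.congr_hom (P.torIso (ModuleCat.of R (R ⧸ J)) i).inv_hom_id h).symm

namespace RepresentsTor

variable {z z' : P.complex.X i}
  {h h' : ((Tor (ModuleCat.{u} R) i).obj (ModuleCat.of R (R ⧸ J))).obj M}

theorem d_mem (hz : P.RepresentsTor J i z h) (j : ℕ) :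
    P.complex.d i j z ∈ J • (⊤ : Submodule R (P.complex.X j)) :=
  (J.one_tmul_eq_zero_iff _).mp
    ((tensorComplex_d_one_tmul j z).symm.trans (HomologicalComplex.Represents.d_eq_zero hz j))

/-- Every chain over `R/J` has the form `1 ⊗ w`, so boundaries lift to the resolution itself, up to
`J`-multiples. -/
theorem eq_zero_iff (hz : P.RepresentsTor J i z h) :
    h = 0 ↔ z ∈ (P.complex.d (i + 1) i).hom.range ⊔ J • (⊤ : Submodule R (P.complex.X i)) := by
  have h1 := HomologicalComplex.Represents.eq_zero_iff hz (k := i + 1) (by simp)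
  have h2 : (P.torIso (ModuleCat.of R (R ⧸ J)) i).hom h = 0 ↔ h = 0 :=
    (P.torIso (ModuleCat.of R (R ⧸ J)) i).toLinearEquiv.map_eq_zero_iff
  rw [← h2, h1, Submodule.mem_sup]
  constructor
  · rintro ⟨w, hw⟩
    obtain ⟨w, rfl⟩ := J.exists_one_tmul_eq (N := P.complex.X (i + 1)) w
    rw [tensorComplex_d_one_tmul] at hw
    refine ⟨_, ⟨w, rfl⟩, z - P.complex.d (i + 1) i w, ?_, add_sub_cancel _ _⟩
    rw [← J.one_tmul_eq_zero_iff, tmul_sub]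
    exact sub_eq_zero.mpr hw.symm
  · rintro ⟨_, ⟨w, rfl⟩, y, hy, rfl⟩
    refine ⟨((1 : R ⧸ J) ⊗ₜ[R] w : (R ⧸ J) ⊗[R] P.complex.X (i + 1)), ?_⟩
    rw [tensorComplex_d_one_tmul, tmul_add, (J.one_tmul_eq_zero_iff y).mpr hy]
    exact (add_zero _).symm

theorem smul (hz : P.RepresentsTor J i z h) (a : R) : P.RepresentsTor J i (a • z) (a • h) := by
  have h1 := HomologicalComplex.Represents.smul hz a
  exact h1.of_eq (tmul_smul a (1 : R ⧸ J) z).symm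
    ((P.torIso (ModuleCat.of R (R ⧸ J)) i).hom.hom.map_smul a h).symm

theorem sub (hz : P.RepresentsTor J i z h) (hz' : P.RepresentsTor J i z' h') :
    P.RepresentsTor J i (z - z') (h - h') := by
  have h1 := HomologicalComplex.Represents.sub hz hz'
  exact h1.of_eq (tmul_sub (1 : R ⧸ J) z z').symm
    ((P.torIso (ModuleCat.of R (R ⧸ J)) i).hom.hom.map_sub h h').symm

/-- Representatives are chains of the resolution itself, so transition maps between different
quotients leave them unchanged. -/
theorem map (hz : P.RepresentsTor J i z h) {J' : Ideal R} (hJ : J ≤ J') :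
    P.RepresentsTor J' i z (((Tor (ModuleCat.{u} R) i).flip.obj M).map
      (ModuleCat.ofHom (Submodule.mapQ J J' LinearMap.id hJ)) h) := by
  have h1 := HomologicalComplex.Represents.map hz ((NatTrans.mapHomologicalComplex
    ((tensoringLeft (ModuleCat.{u} R)).map
      (ModuleCat.ofHom (Submodule.mapQ J J' LinearMap.id hJ))) _).app P.complex)
  exact h1.of_eq rfl (ConcreteCategory.congr_hom (P.torIso_naturality
    (ModuleCat.ofHom (Submodule.mapQ J J' LinearMap.id hJ)) i) h).symm

end RepresentsTor

end CategoryTheory.ProjectiveResolution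

end Tor

end

/-! ### Inverse limits of towers of Artinian modules -/

section

open CategoryTheory Limits Opposite

namespace ModuleCat

variable {R : Type u} [CommRing R] (F : ℕᵒᵖ ⥤ ModuleCat.{u} R)

/-- The transition map of a tower of modules. -/
def towerMap {s t : ℕ} (h : t ≤ s) : F.obj (op s) →ₗ[R] F.obj (op t) :=
  (F.map (homOfLE h).op).hom

theorem towerMap_towerMap {r s t : ℕ} (h : t ≤ s) (h' : s ≤ r) (x : F.obj (op r)) :
    towerMap F h (towerMap F h' x) = towerMap F (h.trans h') x := by
  have : F.map (homOfLE (h.trans h')).op = F.map (homOfLE h').op ≫ F.map (homOfLE h).op := by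
    rw [← F.map_comp]
    rfl
  exact (ConcreteCategory.congr_hom this x).symm

theorem towerMap_self {t : ℕ} (x : F.obj (op t)) : towerMap F le_rfl x = x :=
  ConcreteCategory.congr_hom (F.map_id (op t)) x

/-- The elements of a module of the tower which come from all the later modules. -/
def stableImage (t : ℕ) : Submodule R (F.obj (op t)) :=
  ⨅ (s : ℕ) (h : t ≤ s), (towerMap F h).range

theorem exists_stableImage_eq (t : ℕ) [IsArtinian R (F.obj (op t))] :
    ∃ (s : ℕ) (h : t ≤ s), (towerMap F h).range = stableImage F t := by
  have hanti : ∀ {r s : ℕ} (h : t ≤ s) (h' : s ≤ r),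
      (towerMap F (h.trans h')).range ≤ (towerMap F h).range := by
    rintro r s h h' _ ⟨x, rfl⟩
    exact ⟨towerMap F h' x, towerMap_towerMap F h h' x⟩
  obtain ⟨n, hn⟩ := IsArtinian.monotone_stabilizes
    (⟨fun n => OrderDual.toDual (towerMap F (Nat.le_add_right t n)).range, fun _ _ h =>
      hanti (Nat.le_add_right _ _) (Nat.add_le_add_left h t)⟩ :
      ℕ →o (Submodule R (F.obj (op t)))ᵒᵈ)
  refine ⟨t + n, Nat.le_add_right t n, le_antisymm (le_iInf₂ fun s hs => ?_) (iInf₂_le _ _)⟩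
  obtain ⟨k, rfl⟩ := Nat.exists_eq_add_of_le hs
  have h1 : (towerMap F (Nat.le_add_right t n)).range =
    (towerMap F (Nat.le_add_right t (max n k))).range :=
    congrArg OrderDual.ofDual (hn (max n k) (le_max_left _ _))
  rw [h1]
  exact hanti hs (Nat.add_le_add_left (le_max_right _ _) t)

/-- The element is lifted to a stage `s` at which the image in stage `t + 1` is already stable, then
pushed down to `t + 1`. -/
theorem exists_mem_stableImage {t : ℕ} [IsArtinian R (F.obj (op (t + 1)))] {x : F.obj (op t)}
    (hx : x ∈ stableImage F t) :
    ∃ y ∈ stableImage F (t + 1), towerMap F t.le_succ y = x := by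
  obtain ⟨s, hs, h⟩ := exists_stableImage_eq F (t + 1)
  obtain ⟨z, rfl⟩ := (Submodule.mem_iInf _).mp ((Submodule.mem_iInf _).mp hx s) (t.le_succ.trans hs)
  exact ⟨towerMap F hs z, h ▸ ⟨z, rfl⟩, towerMap_towerMap F _ _ z⟩

theorem exists_limit_π_eq (x : ∀ t : ℕ, F.obj (op t))
    (hx : ∀ (s t : ℕ) (h : t ≤ s), towerMap F h (x s) = x t) :
    ∃ y : (limit F : ModuleCat.{u} R), ∀ t, limit.π F (op t) y = x t := by
  let c : Cone F :=
    { pt := ModuleCat.of R R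
      π :=
        { app := fun t => ModuleCat.ofHom (LinearMap.toSpanSingleton R _ (x t.unop))
          naturality := fun s t f => by
            ext
            have := hx _ _ (leOfHom f.unop)
            have h1 : F.map f (x s.unop) = x t.unop := this
            simp [h1] } }
  refine ⟨limit.lift F c (1 : R), fun t => ?_⟩
  have h := ConcreteCategory.congr_hom (limit.lift_π c (op t)) (1 : R)
  exact h.trans (one_smul R (x t))

/-- A form of the Mittag-Leffler condition for towers of Artinian modules: the limit vanishes if and
only if the tower is trivial as a pro-object. -/
theorem subsingleton_limit_iff [∀ t, IsArtinian R (F.obj (op t))] :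
    Subsingleton (limit F : ModuleCat.{u} R) ↔
      ∀ t, ∃ (s : ℕ) (h : t ≤ s), ∀ x, towerMap F h x = 0 := by
  constructor
  · intro hsub t
    obtain ⟨s, hs, h⟩ := exists_stableImage_eq F t
    refine ⟨s, hs, fun x => ?_⟩
    have hx : towerMap F hs x ∈ stableImage F t := h ▸ ⟨x, rfl⟩
    -- Successive lifts of a stable element at stage `t` form a compatible family, hence a point of
    -- the limit; since the limit is zero, so is the element.
    choose nxt hnxt using fun (t : ℕ) (z : stableImage F t) => exists_mem_stableImage F z.2
    let a : ∀ n : ℕ, stableImage F (t + n) := fun n =>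
      Nat.rec (motive := fun n => stableImage F (t + n)) ⟨_, hx⟩
        (fun n z => ⟨nxt (t + n) z, (hnxt (t + n) z).1⟩) n
    have ha : ∀ n, towerMap F (t + n).le_succ (a (n + 1)).1 = (a n).1 := fun n =>
      (hnxt (t + n) (a n)).2
    have ha' : ∀ n m (h : n ≤ m), towerMap F (Nat.add_le_add_left h t) (a m).1 = (a n).1 := by
      intro n m h
      induction m, h using Nat.le_induction with
      | base => exact towerMap_self F _
      | succ m h ih =>
        rw [← ih, ← ha m, towerMap_towerMap]
    obtain ⟨y, hy⟩ := exists_limit_π_eq F (fun n => towerMap F (Nat.le_add_left n t) (a n).1) (by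
      intro r n h
      rw [← ha' n r h, towerMap_towerMap, towerMap_towerMap])
    have h0 := hy t
    rw [Subsingleton.elim y 0, map_zero] at h0
    exact (ha' 0 t t.zero_le).symm.trans h0.symm
  · intro h
    refine (subsingleton_iff_forall_eq 0).mpr fun y => Concrete.limit_ext _ _ _ fun t => ?_
    obtain ⟨s, hs, h⟩ := h t.unop
    rw [map_zero, ← limit.w F (homOfLE hs).op]
    exact h (limit.π F (op s) y)

end ModuleCat

end

/-! ### Artinianness of Tor for socle-finite modules -/

section

open CategoryTheory MonoidalCategory TensorProduct IsLocalRing Limits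

section TorSocleFinite

variable {R : Type u} [CommRing R] {M : ModuleCat.{u} R} (P : ProjectiveResolution M)

namespace CategoryTheory.ProjectiveResolution

instance flat_X (n : ℕ) : Module.Flat R (P.complex.X n) :=
  have : Module.Projective R (P.complex.X n) :=
    (IsProjective.iff_projective (R := R) (P.complex.X n)).mpr (P.projective n)
  inferInstance

theorem exact_d_d (n : ℕ) :
    Function.Exact (P.complex.d (n + 2) (n + 1)).hom (P.complex.d (n + 1) n).hom :=
  (ShortComplex.ShortExact.moduleCat_exact_iff_function_exact _).mp (P.exact_succ n)

theorem subsingleton_homology_tensorComplex (X : ModuleCat.{u} R) [Module.Flat R X] (n : ℕ) :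
    Subsingleton ((P.tensorComplex X).homology (n + 1)) := by
  refine (subsingleton_iff_forall_eq 0).mpr fun h => ?_
  obtain ⟨y, hy⟩ := HomologicalComplex.exists_represents h
  rw [hy.eq_zero_iff (k := n + 2) (by simp)]
  exact (Module.Flat.lTensor_exact X (P.exact_d_d n) y).mp (hy.d_eq_zero n)

/-- The short complex of tensored resolutions. -/
noncomputable abbrev tensorShortComplex (S : ShortComplex (ModuleCat.{u} R)) :
    ShortComplex (ChainComplex (ModuleCat.{u} R) ℕ) :=
  ShortComplex.mk
    ((NatTrans.mapHomologicalComplex ((tensoringLeft (ModuleCat.{u} R)).map S.f) _).app P.complex)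
    ((NatTrans.mapHomologicalComplex ((tensoringLeft (ModuleCat.{u} R)).map S.g) _).app P.complex)
    (by
      ext n : 1
      change S.f ▷ P.complex.X n ≫ S.g ▷ P.complex.X n = 0
      rw [← comp_whiskerRight, S.zero, MonoidalPreadditive.zero_whiskerRight])

theorem tensorShortComplex_shortExact {S : ShortComplex (ModuleCat.{u} R)} (hS : S.ShortExact) :
    (P.tensorShortComplex S).ShortExact := by
  refine HomologicalComplex.shortExact_of_degreewise_shortExact _ fun n => ?_
  refine ShortComplex.ShortExact.mk' ?_ ?_ ?_
  · exact (ShortComplex.ShortExact.moduleCat_exact_iff_function_exact _).mpr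
      (Module.Flat.rTensor_exact (P.complex.X n)
        ((ShortComplex.ShortExact.moduleCat_exact_iff_function_exact _).mp hS.exact))
  · rw [ModuleCat.mono_iff_injective]
    exact Module.Flat.rTensor_preserves_injective_linearMap S.f.hom hS.moduleCat_injective_f
  · rw [ModuleCat.epi_iff_surjective]
    exact LinearMap.rTensor_surjective (P.complex.X n) hS.moduleCat_surjective_g

/-- Dimension shifting in the first variable of `Tor`: the flat middle term contributes nothing in
positive degree, so the connecting map is injective. -/
theorem exists_injective_homology {S : ShortComplex (ModuleCat.{u} R)} (hS : S.ShortExact)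
    [Module.Flat R S.X₂] (n : ℕ) :
    ∃ f : (P.tensorComplex S.X₃).homology (n + 1) →ₗ[R] (P.tensorComplex S.X₁).homology n,
      Function.Injective f := by
  have hT := P.tensorShortComplex_shortExact hS
  have hrel : (ComplexShape.down ℕ).Rel (n + 1) n := by simp
  have hex := (ShortComplex.moduleCat_exact_iff _).mp (hT.homology_exact₃ (n + 1) n hrel)
  have := P.subsingleton_homology_tensorComplex S.X₂ n
  refine ⟨(hT.δ (n + 1) n hrel).hom, (injective_iff_map_eq_zero _).mpr fun x hx => ?_⟩
  obtain ⟨y, rfl⟩ := hex x hx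
  rw [Subsingleton.elim (α := (P.tensorComplex S.X₂).homology (n + 1)) y 0]
  exact map_zero _

variable [IsLocalRing R]

theorem socleFinite_tensor {N X : Type u} [AddCommGroup N] [Module R N] [AddCommGroup X]
    [Module R X] [Module.Finite R X] (hN : SocleFinite R N) : SocleFinite R (X ⊗[R] N) := by
  obtain ⟨n, g, hg⟩ := Module.Finite.exists_fin' R X
  refine (hN.pi_fin n).of_surjective (LinearMap.lsum R (fun _ => N) R fun i =>
    TensorProduct.mk R X N (g (Pi.single i 1))) fun x => ?_
  induction x with
  | zero => exact ⟨0, map_zero _⟩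
  | tmul q z =>
    obtain ⟨c, rfl⟩ := hg q
    refine ⟨fun i => c i • z, ?_⟩
    have hc : g c = ∑ i, c i • g (Pi.single i 1) := by
      conv_lhs => rw [pi_eq_sum_univ' c, map_sum]
      simp only [map_smul]
    rw [hc, sum_tmul, LinearMap.lsum_apply, LinearMap.sum_apply]
    refine Finset.sum_congr rfl fun i _ => ?_
    exact (tmul_smul _ _ _).trans (smul_tmul' _ _ _)
  | add x y hx hy =>
    obtain ⟨z, rfl⟩ := hx
    obtain ⟨z', rfl⟩ := hy
    exact ⟨z + z', map_add _ _ _⟩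

variable [IsNoetherianRing R]

/-- Degree 0 is `X ⊗ M`, a quotient of some `Mᵏ`. Higher degrees embed in the previous one for the
kernel of a finite free cover of `X`. -/
theorem socleFinite_homology_tensorComplex (hM : SocleFinite R M) (n : ℕ) (X : ModuleCat.{u} R)
    [Module.Finite R X] : SocleFinite R ((P.tensorComplex X).homology n) := by
  induction n generalizing X with
  | zero =>
    have h1 : SocleFinite R (X ⊗[R] M : Type u) := socleFinite_tensor hM
    have e := (P.torIso X 0).symm ≪≫
      ((tensoringLeft (ModuleCat.{u} R)).obj X).leftDerivedZeroIsoSelf.app M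
    exact h1.of_injective e.hom.hom e.toLinearEquiv.injective
  | succ n ih =>
    obtain ⟨k, g, hg⟩ := Module.Finite.exists_fin' R X
    let S : ShortComplex (ModuleCat.{u} R) := ShortComplex.mk
      (ModuleCat.ofHom ((LinearMap.ker (g ∘ₗ ULift.moduleEquiv.toLinearMap :
        ULift.{u} (Fin k → R) →ₗ[R] X)).subtype))
      (ModuleCat.ofHom (Y := X) (g ∘ₗ ULift.moduleEquiv.toLinearMap)) (by ext x; exact x.2)
    have hS : S.ShortExact := by
      refine ShortComplex.ShortExact.mk' ?_ ?_ ?_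
      · rw [ShortComplex.moduleCat_exact_iff]
        exact fun x hx => ⟨⟨x, hx⟩, rfl⟩
      · rw [ModuleCat.mono_iff_injective]
        exact Submodule.injective_subtype _
      · rw [ModuleCat.epi_iff_surjective]
        exact hg.comp ULift.moduleEquiv.surjective
    have : Module.Flat R S.X₂ := inferInstanceAs (Module.Flat R (ULift.{u} (Fin k → R)))
    have : Module.Finite R S.X₁ := inferInstanceAs (Module.Finite R (LinearMap.ker
      (g ∘ₗ ULift.moduleEquiv.toLinearMap : ULift.{u} (Fin k → R) →ₗ[R] X)))
    obtain ⟨f, hf⟩ := P.exists_injective_homology hS n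
    exact (ih S.X₁).of_injective f hf

theorem isArtinian_tor (hM : SocleFinite R M) (n t : ℕ) :
    IsArtinian R (((Tor (ModuleCat.{u} R) n).obj
      (ModuleCat.of R (R ⧸ maximalIdeal R ^ t))).obj M) := by
  obtain ⟨P⟩ : Nonempty (ProjectiveResolution M) := ⟨projectiveResolution M⟩
  have h1 := P.socleFinite_homology_tensorComplex hM n (ModuleCat.of R (R ⧸ maximalIdeal R ^ t))
  refine (h1.of_injective (P.torIso _ n).hom.hom (P.torIso _ n).toLinearEquiv.injective).isArtinian
    fun x => ⟨t, fun a ha => ?_⟩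
  obtain ⟨z, hz⟩ := P.exists_representsTor (i := n) x
  exact (hz.smul a).eq_zero_iff.mpr
    (Submodule.mem_sup_right (Submodule.smul_mem_smul ha Submodule.mem_top))

end CategoryTheory.ProjectiveResolution

end TorSocleFinite

end

/-! ### Comparison of local homology with the local cohomology of the dual -/

section

open CategoryTheory IsLocalRing Limits Opposite

theorem Module.Injective.exists_comp_eq_of_ker_le {R : Type u} [CommRing R] {E X Y : Type u}
    [AddCommGroup E] [Module R E] [AddCommGroup X] [Module R X] [AddCommGroup Y] [Module R Y]
    (hE : Module.Injective R E) (f : X →ₗ[R] Y) (φ : X →ₗ[R] E) (h : f.ker ≤ φ.ker) :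
    ∃ ψ : Y →ₗ[R] E, ψ ∘ₗ f = φ := by
  obtain ⟨ψ, hψ⟩ := hE.out (f.ker.liftQ f le_rfl) (LinearMap.ker_eq_bot.mp
    (Submodule.ker_liftQ_eq_bot' _ _ rfl)) (f.ker.liftQ φ h)
  exact ⟨ψ, LinearMap.ext fun x => hψ (Submodule.Quotient.mk x)⟩

section Bridge

variable {R : Type u} [CommRing R] {M : ModuleCat.{u} R} (P : ProjectiveResolution M)
  (I : Ideal R) (E : Type u) [AddCommGroup E] [Module R E]

namespace CategoryTheory.ProjectiveResolution

/-- The homomorphisms from the resolution to `E` which are killed by a power of `I` form an exact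
complex at `i`. -/
def TorsionDualExact (i : ℕ) : Prop :=
  ∀ φ : P.complex.X i →ₗ[R] E, φ ∘ₗ (P.complex.d (i + 1) i).hom = 0 →
    (∃ t : ℕ, ∀ a ∈ I ^ t, a • φ = 0) →
    ∃ ψ : P.complex.X ((ComplexShape.down ℕ).next i) →ₗ[R] E, (∃ s : ℕ, ∀ a ∈ I ^ s, a • ψ = 0) ∧
      ψ ∘ₗ (P.complex.d i ((ComplexShape.down ℕ).next i)).hom = φ

theorem exists_augmentation : ∃ π : P.complex.X 0 →ₗ[R] M,
    Function.Exact (P.complex.d 1 0).hom π ∧ Function.Surjective π := by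
  have h := P.exact₀
  rw [ShortComplex.ShortExact.moduleCat_exact_iff_function_exact] at h
  exact ⟨(P.π.f 0).hom, h, (ModuleCat.epi_iff_surjective (P.π.f 0)).mp inferInstance⟩

/-- The modules of boundaries in the resolution. -/
abbrev boundaries (n : ℕ) : Submodule R (P.complex.X n) := (P.complex.d (n + 1) n).hom.range

theorem exact_boundaries (n : ℕ) : Function.Exact (P.boundaries (n + 1)).subtype
    (P.complex.d (n + 1) n).hom.rangeRestrict := fun x => by
  refine Subtype.ext_iff.trans ((P.exact_d_d n x).trans ?_)
  simp

variable {E}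

/-- Shifting along the resolution reduces degree `i + 1` to extending torsion homomorphisms from the
boundaries `Bᵢ` to `Pᵢ`. Homomorphisms on `Bᵢ` are those on `Pᵢ₊₁` that vanish on `Bᵢ₊₁`. -/
theorem subsingleton_dualLocCoh_iff (hE : Module.Injective R E) (i : ℕ) :
    Subsingleton (DualLocCoh I E i M) ↔ P.TorsionDualExact I E i := by
  obtain ⟨π, hπ, hπs⟩ := P.exists_augmentation
  have hπ' : Function.Exact (P.boundaries 0).subtype π := fun x => by
    rw [hπ x]
    simp
  have hshift : ∀ n k, Subsingleton (DualLocCoh I E (k + n + 2) M) ↔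
      Subsingleton (DualLocCoh I E (k + 1) (P.boundaries n)) := by
    intro n
    induction n with
    | zero =>
      intro k
      exact DualLocCoh.subsingleton_succ_succ_iff I hE (Submodule.injective_subtype _) hπ' hπs k
    | succ n ih =>
      intro k
      rw [← DualLocCoh.subsingleton_succ_succ_iff I hE (Submodule.injective_subtype _)
        (P.exact_boundaries n) (LinearMap.surjective_rangeRestrict _) k, ← ih (k + 1)]
      rw [show k + 1 + n + 2 = k + (n + 1) + 2 by omega]
  have hsurj : ∀ n, Subsingleton (DualLocCoh I E (n + 1) M) ↔
      Function.Surjective (DualLocCoh.map I E 0 (P.boundaries n).subtype) := by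
    intro n
    rcases n with _ | n
    · exact DualLocCoh.subsingleton_succ_iff I hE (Submodule.injective_subtype _) hπ' hπs 0
    · rw [← DualLocCoh.subsingleton_succ_iff I hE (Submodule.injective_subtype _)
        (P.exact_boundaries n) (LinearMap.surjective_rangeRestrict _) 0, ← hshift n 0, Nat.zero_add]
  rcases i with _ | i
  -- Here `(ComplexShape.down ℕ).next 0` is 0 and the differential is zero, so exactness says that
  -- torsion homomorphisms on `P₀` vanishing on boundaries are zero.
  · rw [DualLocCoh.subsingleton_zero_iff]
    constructor
    · rintro h φ hφ ⟨t, ht⟩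
      obtain ⟨ψ, rfl⟩ := hE.exists_comp_eq_of_ker_le π φ fun x hx => by
        obtain ⟨y, rfl⟩ := (hπ x).mp hx
        exact LinearMap.congr_fun hφ y
      refine ⟨0, ⟨0, by simp⟩, ?_⟩
      rw [h ψ ⟨t, fun a ha => LinearMap.ext fun x => ?_⟩, LinearMap.zero_comp, LinearMap.zero_comp]
      obtain ⟨x, rfl⟩ := hπs x
      exact LinearMap.congr_fun (ht a ha) x
    · rintro h φ ⟨t, ht⟩
      obtain ⟨ψ, -, hψ⟩ := h (φ ∘ₗ π) (by
        rw [LinearMap.comp_assoc, hπ.linearMap_comp_eq_zero, LinearMap.comp_zero])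
        ⟨t, fun a ha => by rw [← LinearMap.smul_comp, ht a ha, LinearMap.zero_comp]⟩
      rw [P.complex.shape _ _ (by simp), ModuleCat.hom_zero, LinearMap.comp_zero] at hψ
      refine LinearMap.ext fun x => ?_
      obtain ⟨x, rfl⟩ := hπs x
      exact (LinearMap.congr_fun hψ x).symm
  · rw [hsurj, DualLocCoh.map_zero_surjective_iff]
    unfold TorsionDualExact
    rw [show (ComplexShape.down ℕ).next (i + 1) = i from ChainComplex.next_nat_succ i]
    constructor
    · rintro h φ hφ ⟨t, ht⟩
      obtain ⟨ψ, rfl⟩ := hE.exists_comp_eq_of_ker_le (P.complex.d (i + 1) i).hom.rangeRestrict φ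
        fun x hx => by
          obtain ⟨⟨_, y, rfl⟩, rfl⟩ := (P.exact_boundaries i x).mp hx
          exact LinearMap.congr_fun hφ y
      obtain ⟨θ, hθ, rfl⟩ := h ψ ⟨t, fun a ha => LinearMap.ext fun x => by
        obtain ⟨x, rfl⟩ := LinearMap.surjective_rangeRestrict _ x
        exact LinearMap.congr_fun (ht a ha) x⟩
      exact ⟨θ, hθ, rfl⟩
    · rintro h φ ⟨t, ht⟩
      obtain ⟨ψ, hψ, hψφ⟩ := h (φ ∘ₗ (P.complex.d (i + 1) i).hom.rangeRestrict) (by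
        ext x
        have h1 : (P.complex.d (i + 1) i).hom.rangeRestrict ((P.complex.d (i + 2) (i + 1)).hom x) =
          0 := Subtype.ext ((P.exact_d_d i).apply_apply_eq_zero x)
        change φ ((P.complex.d (i + 1) i).hom.rangeRestrict
          ((P.complex.d (i + 2) (i + 1)).hom x)) = 0
        rw [h1, map_zero])
        ⟨t, fun a ha => by rw [← LinearMap.smul_comp, ht a ha, LinearMap.zero_comp]⟩
      refine ⟨ψ, hψ, LinearMap.ext fun x => ?_⟩
      obtain ⟨x, rfl⟩ := LinearMap.surjective_rangeRestrict _ x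
      exact LinearMap.congr_fun hψφ x

/-- A chain `z` with `dz` in `Iˢ` times the next term is a `Tor` class at stage `s`. It dies at
stage `t`, so `z` is a boundary modulo `Iᵗ` and `φ z = 0`. Thus `φ` factors through `d` modulo `Iˢ`,
and the extension is torsion. -/
theorem torsionDualExact_of_forall_exists (hE : Module.Injective R E) (i : ℕ)
    (h : ∀ t, ∃ (s : ℕ) (hts : t ≤ s),
      ∀ x, ((Tor (ModuleCat.{u} R) i).flip.obj M).map (ModuleCat.ofHom
        (Submodule.mapQ (I ^ s) (I ^ t) LinearMap.id (Ideal.pow_le_pow_right hts))) x = 0) :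
    P.TorsionDualExact I E i := by
  rintro φ hφ ⟨t, ht⟩
  obtain ⟨s, hts, hs⟩ := h t
  set Q : Submodule R (P.complex.X ((ComplexShape.down ℕ).next i)) := I ^ s • ⊤ with hQ
  obtain ⟨ψ, hψ⟩ := hE.exists_comp_eq_of_ker_le
    (Q.mkQ ∘ₗ (P.complex.d i ((ComplexShape.down ℕ).next i)).hom) φ fun z hz => by
      obtain ⟨x, hx⟩ := exists_representsTor_of_mem (J := I ^ s) rfl
        ((Submodule.Quotient.mk_eq_zero Q).mp hz)
      have h1 := (hx.map (Ideal.pow_le_pow_right hts)).eq_zero_iff.mp (hs x)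
      refine (sup_le ?_ ?_ : _ ≤ φ.ker) h1
      · rintro _ ⟨w, rfl⟩
        exact LinearMap.congr_fun hφ w
      · refine Submodule.smul_le.mpr fun a ha y _ => ?_
        rw [LinearMap.mem_ker, map_smul]
        exact LinearMap.congr_fun (ht a ha) y
  refine ⟨ψ ∘ₗ Q.mkQ, ⟨s, fun a ha => LinearMap.ext fun x => ?_⟩, hψ⟩
  change a • ψ (Q.mkQ x) = 0
  rw [← map_smul, ← map_smul, Submodule.mkQ_apply, (Submodule.Quotient.mk_eq_zero Q).mpr
    (Submodule.smul_mem_smul ha trivial), map_zero]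

end CategoryTheory.ProjectiveResolution

end Bridge

section LocalHomology

variable {R : Type u} [CommRing R] [IsLocalRing R] {E : Type u} [AddCommGroup E] [Module R E]

/-- If `x ≠ 0`, some multiple `rx` is a nonzero socle element, detected by a functional `φ = ψ ∘ d`
with `ψ` killed by `𝔪ˢ`. But `rx` also comes from a later stage, so it has a representative whose
differential lies in `ker ψ`. -/
theorem CategoryTheory.ProjectiveResolution.TorsionDualExact.eq_zero {M : ModuleCat.{u} R}
    {P : ProjectiveResolution M} {i : ℕ} (h : P.TorsionDualExact (maximalIdeal R) E i)
    (hE : IsSocleInjective R E) {t : ℕ} (x : ((Tor (ModuleCat.{u} R) i).obj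
      (ModuleCat.of R (R ⧸ maximalIdeal R ^ t))).obj M)
    (hx : ∀ s (hts : t ≤ s), ∃ y, ((Tor (ModuleCat.{u} R) i).flip.obj M).map
      (ModuleCat.ofHom (Submodule.mapQ (maximalIdeal R ^ s) (maximalIdeal R ^ t) LinearMap.id
        (Ideal.pow_le_pow_right hts))) y = x) : x = 0 := by
  by_contra hx0
  have hkill : ∀ a ∈ maximalIdeal R ^ t, a • x = 0 := fun a ha => by
    obtain ⟨z, hz⟩ := P.exists_representsTor (i := i) x
    exact (hz.smul a).eq_zero_iff.mpr
      (Submodule.mem_sup_right (Submodule.smul_mem_smul ha Submodule.mem_top))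
  obtain ⟨r, hr0, hr⟩ := exists_socle_mem_of_notMem (K := ⊥) ⟨t, hkill⟩ hx0
  obtain ⟨z, hz⟩ := P.exists_representsTor (i := i) (r • x)
  set N : Submodule R (P.complex.X i) :=
    (P.complex.d (i + 1) i).hom.range ⊔ maximalIdeal R ^ t • ⊤ with hN
  obtain ⟨φ, hφN, hφz⟩ := hE.exists_ne_zero (N := N) (x := z)
    (fun hzN => hr0 (hz.eq_zero_iff.mpr hzN)) fun a ha => (hz.smul a).eq_zero_iff.mp (hr a ha)
  obtain ⟨ψ, ⟨s, hs⟩, hψ⟩ := h φ (LinearMap.ext fun w => hφN (Submodule.mem_sup_left ⟨w, rfl⟩))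
    ⟨t, fun a ha => LinearMap.ext fun y => by
      rw [LinearMap.smul_apply, ← map_smul]
      exact hφN (Submodule.mem_sup_right (Submodule.smul_mem_smul ha Submodule.mem_top))⟩
  obtain ⟨y, rfl⟩ := hx (max s t) (le_max_right s t)
  obtain ⟨z', hz'⟩ := P.exists_representsTor (i := i) (r • y)
  have h1 := hz'.map (Ideal.pow_le_pow_right (le_max_right s t))
  rw [map_smul] at h1
  have h2 : φ (z - z') = 0 := hφN ((hz.sub h1).eq_zero_iff.mp (sub_self _))
  rw [map_sub, sub_eq_zero] at h2
  refine hφz (h2.trans ?_)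
  rw [← hψ]
  have h3 : maximalIdeal R ^ (max s t) • ⊤ ≤ ψ.ker := Submodule.smul_le.mpr fun a ha y _ => by
    rw [LinearMap.mem_ker, map_smul]
    exact LinearMap.congr_fun (hs a (Ideal.pow_le_pow_right (le_max_left s t) ha)) y
  exact h3 (hz'.d_mem _)

/-- Local homology vanishes if and only if its dual does. -/
theorem SocleFinite.subsingleton_localHomology_iff [IsNoetherianRing R] {M : Type u}
    [AddCommGroup M] [Module R M] (hM : SocleFinite R M) (hE : IsSocleInjective R E) (i : ℕ) :
    Subsingleton (LinCpt.localHomology (maximalIdeal R) i M) ↔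
      Subsingleton (DualLocCoh (maximalIdeal R) E i M) := by
  let P := projectiveResolution (ModuleCat.of R M)
  let F := localCohomology.ringModIdeals (localCohomology.idealPowersDiagram (maximalIdeal R)) ⋙
    (Tor (ModuleCat.{u} R) i).flip.obj (ModuleCat.of R M)
  have hF : ∀ t, IsArtinian R (F.obj (op t)) := fun t =>
    ProjectiveResolution.isArtinian_tor (M := ModuleCat.of R M) hM i t
  have h1 := ModuleCat.subsingleton_limit_iff F
  have h2 := P.subsingleton_dualLocCoh_iff (maximalIdeal R) hE.injective i
  refine h1.trans (Iff.trans ?_ h2.symm)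
  constructor
  · intro h
    exact P.torsionDualExact_of_forall_exists _ hE.injective i h
  · intro h t
    obtain ⟨s, hs, hst⟩ := ModuleCat.exists_stableImage_eq F t
    refine ⟨s, hs, fun x => h.eq_zero hE _ fun r hr => ?_⟩
    have h3 : ModuleCat.towerMap F hs x ∈ ModuleCat.stableImage F t := hst ▸ ⟨x, rfl⟩
    exact (Submodule.mem_iInf _).mp ((Submodule.mem_iInf _).mp h3 r) hr

end LocalHomology

end

/-! ### The torsion submodule and the socle-free quotient -/

section

open IsLocalRing Submodule

section PrimaryComponent

variable {R : Type u} [CommRing R] {M : Type v} [AddCommGroup M] [Module R M]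

theorem Ideal.mem_primaryComponent_iff {I : Ideal R} {x : M} :
    x ∈ I.primaryComponent M ↔ ∃ n : ℕ, ∀ a ∈ I ^ n, a • x = 0 := by
  simp [Ideal.primaryComponent_mem]

/-- In the Noetherian module `Rx` a single power `Iⁿ` kills all the torsion, in particular `Ix`;
hence `Iⁿ⁺¹x = 0`. -/
theorem Ideal.mem_primaryComponent_of_smul_mem [IsNoetherianRing R] {I : Ideal R} {x : M}
    (hx : ∀ a ∈ I, a • x ∈ I.primaryComponent M) : x ∈ I.primaryComponent M := by
  let W := Submodule.span R {x}
  obtain ⟨n, hn⟩ := monotone_stabilizes_iff_noetherian.mpr (inferInstance : IsNoetherian R W)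
    ⟨fun k => (torsionBySet R M (I ^ k : Ideal R)).comap W.subtype, fun i j h =>
      Submodule.comap_mono (torsionBySet_le_torsionBySet_of_subset (Ideal.pow_le_pow_right h))⟩
  have key : ∀ y ∈ W, y ∈ I.primaryComponent M → ∀ a ∈ I ^ n, a • y = 0 := by
    intro y hyW hy a ha
    obtain ⟨k, hk⟩ := (Ideal.primaryComponent_mem _ _ _).mp hy
    have h1 : (⟨y, hyW⟩ : W) ∈ (torsionBySet R M (I ^ (max n k) : Ideal R)).comap W.subtype :=
      torsionBySet_le_torsionBySet_of_subset (Ideal.pow_le_pow_right (le_max_right n k)) hk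
    have h2 : (torsionBySet R M (I ^ n : Ideal R)).comap W.subtype =
      (torsionBySet R M (I ^ (max n k) : Ideal R)).comap W.subtype := hn _ (le_max_left _ _)
    rw [← h2] at h1
    exact (mem_torsionBySet_iff _ _).mp h1 ⟨a, ha⟩
  refine Ideal.mem_primaryComponent_iff.mpr ⟨n + 1, fun a ha => ?_⟩
  rw [pow_succ] at ha
  induction ha using Submodule.mul_induction_on' with
  | mem_mul_mem b hb c hc =>
    rw [mul_smul]
    exact key _ (W.smul_mem c (Submodule.mem_span_singleton_self x)) (hx c hc) b hb
  | add b _ c _ hb hc => rw [add_smul, hb, hc, add_zero]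

theorem SocleFinite.isArtinian_primaryComponent [IsLocalRing R] (hM : SocleFinite R M) :
    IsArtinian R ((maximalIdeal R).primaryComponent M) :=
  (hM.of_injective _ (injective_subtype _)).isArtinian fun x => by
    obtain ⟨n, hn⟩ := Ideal.mem_primaryComponent_iff.mp x.2
    exact ⟨n, fun a ha => Subtype.ext (hn a ha)⟩

end PrimaryComponent

section SocleFree

variable {R : Type u} [CommRing R] [IsLocalRing R] [IsNoetherianRing R] {M : Type u}
  [AddCommGroup M] [Module R M]

/-- Without socle no associated prime contains `𝔪`, and prime avoidance yields a non-zero-divisor.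
-/
theorem exists_smul_injective_of_finite [Module.Finite R M]
    (h : ∀ y : M, (∀ a ∈ maximalIdeal R, a • y = 0) → y = 0) :
    ∃ x ∈ maximalIdeal R, ∀ y : M, x • y = 0 → y = 0 := by
  have hfin := associatedPrimes.finite R M
  obtain ⟨x, hx, hxS⟩ := Ideal.exists_mem_notMem_of_finset (I := maximalIdeal R)
    (S := hfin.toFinset) fun p hp => by
      rw [Set.Finite.mem_toFinset, AssociatedPrimes.mem_iff, isAssociatedPrime_iff] at hp
      obtain ⟨hp, y, rfl⟩ := hp
      refine ⟨hp, fun hle => hp.ne_top ?_⟩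
      rw [h y fun a ha => mem_colon_singleton.mp (hle ha), eq_top_iff]
      exact fun a _ => mem_colon_singleton.mpr (by simp)
  refine ⟨x, hx, fun y hy => ?_⟩
  by_contra hy0
  have h1 : x ∈ ⋃ p ∈ associatedPrimes R M, (p : Set R) := by
    rw [biUnion_associatedPrimes_eq_zero_divisors]
    exact ⟨y, hy0, hy⟩
  obtain ⟨p, hp, hxp⟩ := Set.mem_iUnion₂.mp h1
  exact hxS p (hfin.mem_toFinset.mpr hp) hxp

/-- A socle-finite module without socle has a regular element of the maximal ideal, its quotient by
this element is Noetherian, and its dimension is at most one. -/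
theorem SocleFinite.exists_smul_injective (hM : SocleFinite R M)
    (h : ∀ y : M, (∀ a ∈ maximalIdeal R, a • y = 0) → y = 0) :
    ∃ x ∈ maximalIdeal R, (∀ y : M, x • y = 0 → y = 0) ∧
      IsNoetherian R (M ⧸ (LinearMap.lsmul R M x).range) ∧ NdimLT R 2 M := by
  obtain ⟨N, hN, hNtors⟩ := hM.exists_fg_torsion_quotient
  have : Module.Finite R N := Module.Finite.iff_fg.mpr hN
  obtain ⟨x, hxm, hx⟩ := exists_smul_injective_of_finite (R := R) (M := N) fun y hy =>
    Subtype.ext (h y fun a ha => congrArg Subtype.val (hy a ha))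
  -- Regularity on `N` passes to `M`: if `xy = 0`, then `𝔪ᵗy` lies in `N` and is killed by `x`,
  -- hence is zero, and a nonzero `y` would produce a socle element.
  have hxM : ∀ y : M, x • y = 0 → y = 0 := by
    intro y hy
    obtain ⟨t, ht⟩ := hNtors y
    by_contra hy0
    have h1 : ∀ a ∈ maximalIdeal R ^ t, a • y = 0 := fun a ha => congrArg Subtype.val
      (hx ⟨a • y, ht a ha⟩ (Subtype.ext (by
        change x • a • y = 0
        rw [smul_comm, hy, smul_zero])))
    obtain ⟨r, hr0, hr⟩ := exists_socle_mem_of_notMem (K := ⊥) ⟨t, h1⟩ hy0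
    exact hr0 (h _ hr)
  have hA : IsArtinian R (M ⧸ N) :=
    (hM.of_surjective N.mkQ N.mkQ_surjective).isArtinian fun q => by
      obtain ⟨y, rfl⟩ := N.mkQ_surjective q
      obtain ⟨t, ht⟩ := hNtors y
      exact ⟨t, fun a ha => by
        rw [← map_smul]
        exact (Submodule.Quotient.mk_eq_zero N).mpr (ht a ha)⟩
  -- `(M/N)[x]` is an image of `(N : x)`, which embeds in the Noetherian module `N` by
  -- multiplication by `x`.
  have hAx : NdimLT R 1 (torsionBy R (M ⧸ N) x) := by
    let L : Submodule R M := N.comap (LinearMap.lsmul R M x)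
    have hL : NdimLT R 1 L := (NdimLT.one_iff.mpr (isNoetherian_of_fg_of_noetherian N hN)).of_injective
      ((LinearMap.lsmul R M x).restrict fun y hy => hy) fun y y' hyy' => by
        have h1 : x • (y : M) = x • (y' : M) := congrArg Subtype.val hyy'
        rw [← sub_eq_zero, ← smul_sub] at h1
        exact Subtype.ext (sub_eq_zero.mp (hxM _ h1))
    refine hL.of_surjective (N.mkQ.restrict fun y hy => ?_) ?_
    · rw [mem_torsionBy_iff, ← map_smul]
      exact (Submodule.Quotient.mk_eq_zero N).mpr hy
    · rintro ⟨q, hq⟩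
      obtain ⟨y, rfl⟩ := N.mkQ_surjective q
      rw [mem_torsionBy_iff, ← map_smul] at hq
      exact ⟨⟨y, (Submodule.Quotient.mk_eq_zero N).mp hq⟩, rfl⟩
  have hA2 : NdimLT R 2 (M ⧸ N) := NdimLT.succ_of_torsionBy (fun q => by
    obtain ⟨t, ht⟩ := IsArtinian.exists_pow_smul_eq_zero (R := R) q
    exact ⟨t, ht _ (Ideal.pow_mem_pow hxm t)⟩) hAx
  have hN1 : NdimLT R 1 N := NdimLT.one_iff.mpr (isNoetherian_of_fg_of_noetherian N hN)
  refine ⟨x, hxm, hxM, NdimLT.one_iff.mp ?_, hN1.succ.of_exact hA2 N.subtype N.mkQ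
    (LinearMap.exact_subtype_mkQ N)⟩
  let S := (LinearMap.lsmul R M x).range
  have hle : S ≤ (LinearMap.lsmul R (M ⧸ N) x).range.comap N.mkQ := by
    rintro _ ⟨y, rfl⟩
    exact ⟨N.mkQ y, (map_smul N.mkQ x y).symm⟩
  refine hN1.of_exact hAx.quotient_smul (S.mkQ ∘ₗ N.subtype) (S.mapQ _ N.mkQ hle) fun q => ?_
  obtain ⟨y, rfl⟩ := S.mkQ_surjective q
  constructor
  · intro hy
    obtain ⟨q, hq⟩ := (Submodule.Quotient.mk_eq_zero _).mp hy
    obtain ⟨y', rfl⟩ := N.mkQ_surjective q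
    have h1 : y - x • y' ∈ N := by
      rw [← Submodule.Quotient.mk_eq_zero, Submodule.Quotient.mk_sub, sub_eq_zero]
      exact hq.symm.trans (map_smul N.mkQ x y').symm
    refine ⟨⟨y - x • y', h1⟩, ?_⟩
    change S.mkQ (y - x • y') = S.mkQ y
    rw [map_sub, sub_eq_self]
    exact (Submodule.Quotient.mk_eq_zero S).mpr ⟨y', rfl⟩
  · rintro ⟨n, hn⟩
    rw [← hn]
    change Submodule.Quotient.mk (N.mkQ n) = _
    rw [N.mkQ_apply, (Submodule.Quotient.mk_eq_zero N).mpr n.2]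
    rfl

variable {E : Type u} [AddCommGroup E] [Module R E]

/-- For the regular `x` above, `M/xM` is finitely generated and its positive-degree `D` vanish, so
`x` acts injectively on `D^{i+1}(M)`. -/
theorem SocleFinite.subsingleton_dualLocCoh (hE : Module.Injective R E) (hM : SocleFinite R M)
    (h : ∀ y : M, (∀ a ∈ maximalIdeal R, a • y = 0) → y = 0) (i : ℕ) :
    Subsingleton (DualLocCoh (maximalIdeal R) E (i + 1) M) := by
  obtain ⟨x, hxm, hx, hQ, -⟩ := hM.exists_smul_injective h
  have := DualLocCoh.subsingleton_of_finite (maximalIdeal R) hE i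
    (M ⧸ (LinearMap.lsmul R M x).range)
  have hex := DualLocCoh.exact_map_map (maximalIdeal R) hE (f := LinearMap.lsmul R M x)
    ((injective_iff_map_eq_zero _).mpr hx) (LinearMap.exact_map_mkQ_range _)
    (mkQ_surjective _) (i + 1)
  refine DualLocCoh.subsingleton_of_smul_injective hxm fun v hv => ?_
  rw [DualLocCoh.map_lsmul] at hex
  obtain ⟨w, rfl⟩ := (hex v).mp hv
  rw [Subsingleton.elim w 0, map_zero]

/-- The quotient of a module by its torsion has no socle. -/
theorem eq_zero_of_smul_eq_zero_quotient_primaryComponent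
    (y : M ⧸ (maximalIdeal R).primaryComponent M) (hy : ∀ a ∈ maximalIdeal R, a • y = 0) :
    y = 0 := by
  obtain ⟨y, rfl⟩ := mkQ_surjective _ y
  refine (Submodule.Quotient.mk_eq_zero _).mpr (Ideal.mem_primaryComponent_of_smul_mem
    fun a ha => (Submodule.Quotient.mk_eq_zero _).mp ?_)
  exact (map_smul _ a y).trans (hy a ha)

theorem SocleFinite.isGreatest_primaryComponent (hM : SocleFinite R M) {d : ℕ}
    (hd : NdimLT R (d + 1) ((maximalIdeal R).primaryComponent M))
    (hd' : ¬ NdimLT R d ((maximalIdeal R).primaryComponent M)) :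
    IsGreatest {i : ℕ | Nontrivial (LinCpt.localHomology (maximalIdeal R) i M)} d := by
  obtain ⟨E, _, _, hE⟩ := exists_isSocleInjective R
  let G := (maximalIdeal R).primaryComponent M
  have := hM.isArtinian_primaryComponent
  have hquot : ∀ i, Subsingleton (DualLocCoh (maximalIdeal R) E (i + 1) (M ⧸ G)) := fun i =>
    (hM.of_surjective G.mkQ G.mkQ_surjective).subsingleton_dualLocCoh hE.injective
      eq_zero_of_smul_eq_zero_quotient_primaryComponent i
  constructor
  · rw [Set.mem_ofPred_eq, ← not_subsingleton_iff_nontrivial,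
      hM.subsingleton_localHomology_iff hE d]
    intro hsub
    refine DualLocCoh.not_subsingleton_of_ndimLT hE hd hd' ?_
    have h1 := DualLocCoh.exact_map_δ (maximalIdeal R) hE.injective G.injective_subtype
      (LinearMap.exact_subtype_mkQ G) G.mkQ_surjective d
    have := hquot d
    have h2 : Function.Surjective (DualLocCoh.map (maximalIdeal R) E d G.subtype) :=
      fun v => (h1 v).mp (Subsingleton.elim _ _)
    exact h2.subsingleton
  · intro i hi
    by_contra! hlt
    rw [Set.mem_ofPred_eq, ← not_subsingleton_iff_nontrivial,
      hM.subsingleton_localHomology_iff hE i] at hi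
    refine hi ?_
    obtain ⟨i, rfl⟩ := Nat.exists_eq_add_of_le' (Nat.succ_le_of_lt (d.zero_le.trans_lt hlt))
    have h1 := DualLocCoh.exact_map_map (maximalIdeal R) hE.injective G.injective_subtype
      (LinearMap.exact_subtype_mkQ G) G.mkQ_surjective (i + 1)
    have := hquot i
    have := DualLocCoh.subsingleton_of_ndimLT hE.injective hd (Nat.succ_le_of_lt hlt)
    refine (subsingleton_iff_forall_eq 0).mpr fun v => ?_
    obtain ⟨w, rfl⟩ := (h1 v).mp (Subsingleton.elim _ _)
    rw [Subsingleton.elim w 0, map_zero]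

theorem isGreatest_zero_of_isNoetherian [IsNoetherian R M] [Nontrivial M] :
    IsGreatest {i : ℕ | Nontrivial (LinCpt.localHomology (maximalIdeal R) i M)} 0 := by
  obtain ⟨E, _, _, hE⟩ := exists_isSocleInjective R
  have hM : SocleFinite R M := SocleFinite.of_isNoetherian
  constructor
  · rw [Set.mem_ofPred_eq, ← not_subsingleton_iff_nontrivial,
      hM.subsingleton_localHomology_iff hE, DualLocCoh.subsingleton_zero_iff_smul_top hE]
    intro h
    have h1 : (⊤ : Submodule R M) = ⊥ := Submodule.eq_bot_of_le_smul_of_le_jacobson_bot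
      (maximalIdeal R) ⊤ Module.Finite.fg_top h.ge (maximalIdeal_le_jacobson ⊥)
    exact not_subsingleton M ((Submodule.subsingleton_iff R).mp
      (subsingleton_of_bot_eq_top h1.symm))
  · intro i hi
    rcases i with _ | i
    · exact le_rfl
    · rw [Set.mem_ofPred_eq, ← not_subsingleton_iff_nontrivial,
        hM.subsingleton_localHomology_iff hE] at hi
      exact absurd (DualLocCoh.subsingleton_of_finite (maximalIdeal R) hE.injective i M) hi

theorem SocleFinite.exists_primaryComponent_ndimLT (hM : SocleFinite R M)
    (h : (maximalIdeal R).primaryComponent M ≠ ⊥) :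
    ∃ d, NdimLT R (d + 1) ((maximalIdeal R).primaryComponent M) ∧
      ¬ NdimLT R d ((maximalIdeal R).primaryComponent M) := by
  classical
  have := hM.isArtinian_primaryComponent
  have hex := IsArtinian.exists_ndimLT (R := R) (A := (maximalIdeal R).primaryComponent M)
  rcases hn : Nat.find hex with _ | d
  · have h0 := Nat.find_spec hex
    rw [hn] at h0
    exact absurd ((Submodule.subsingleton_iff_eq_bot).mp h0) h
  · exact ⟨d, hn ▸ Nat.find_spec hex, Nat.find_min hex (by omega)⟩

/-- The shift by 2 is forced: the socle-free quotient is only known to have dimension at most 1. -/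
theorem SocleFinite.ndimLT_of_primaryComponent (hM : SocleFinite R M) {d : ℕ}
    (hd : NdimLT R (d + 2) ((maximalIdeal R).primaryComponent M)) : NdimLT R (d + 2) M := by
  let G := (maximalIdeal R).primaryComponent M
  obtain ⟨-, -, -, -, h⟩ := (hM.of_surjective G.mkQ G.mkQ_surjective).exists_smul_injective
    eq_zero_of_smul_eq_zero_quotient_primaryComponent
  exact hd.of_exact (h.mono (by omega)) G.subtype G.mkQ (LinearMap.exact_subtype_mkQ G)

end SocleFree

end

theorem theorem4p10 {R : Type u} [CommRing R] [IsLocalRing R] [IsNoetherianRing R]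
    {M : Type u} [AddCommGroup M] [Module R M] [Nontrivial M] [TopologicalSpace M]
    (hlc : LinCpt.IsLinearlyCompact R M) (hsd : LinCpt.IsSemiDiscrete R M) :
    ((IsLocalRing.maximalIdeal R).primaryComponent M ≠ ⊥ →
      ∃ d : ℕ, LinCpt.HasNdim R ((IsLocalRing.maximalIdeal R).primaryComponent M) d ∧
        IsGreatest
          {i : ℕ | Nontrivial (LinCpt.localHomology (IsLocalRing.maximalIdeal R) i M)} d) ∧
    (¬ LinCpt.HasNdim R M 1 →
      ∃ d : ℕ, LinCpt.HasNdim R M d ∧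
        IsGreatest
          {i : ℕ | Nontrivial (LinCpt.localHomology (IsLocalRing.maximalIdeal R) i M)} d) := by
  have hM : SocleFinite R M := hlc.socleFinite hsd
  refine ⟨fun h => ?_, fun h1 => ?_⟩
  · obtain ⟨d, hd, hd'⟩ := hM.exists_primaryComponent_ndimLT h
    exact ⟨d, LinCpt.hasNdim_natCast.mpr ⟨hd, hd'⟩, hM.isGreatest_primaryComponent hd hd'⟩
  -- The only use of `Ndim M ≠ 1`: dimension at most 1 then means dimension at most 0.
  · have hnoeth : NdimLT R 2 M → IsNoetherian R M := fun h2 => by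
      by_contra hN
      refine h1 ?_
      have := (LinCpt.hasNdim_natCast (R := R) (M := M) (n := 1)).mpr
        ⟨h2, fun h => hN (NdimLT.one_iff.mp h)⟩
      rwa [Nat.cast_one] at this
    have hzero : NdimLT R 2 M → ∃ d : ℕ, LinCpt.HasNdim R M d ∧ IsGreatest
        {i : ℕ | Nontrivial (LinCpt.localHomology (IsLocalRing.maximalIdeal R) i M)} d := fun h2 => by
      have := hnoeth h2
      exact ⟨0, LinCpt.hasNdim_natCast.mpr ⟨NdimLT.one_iff.mpr this, not_subsingleton M⟩,
        isGreatest_zero_of_isNoetherian⟩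
    by_cases h : (IsLocalRing.maximalIdeal R).primaryComponent M = ⊥
    · refine hzero (hM.ndimLT_of_primaryComponent (d := 0) ?_)
      have : Subsingleton ((IsLocalRing.maximalIdeal R).primaryComponent M) :=
        Submodule.subsingleton_iff_eq_bot.mpr h
      exact NdimLT.of_subsingleton
    · obtain ⟨d, hd, hd'⟩ := hM.exists_primaryComponent_ndimLT h
      -- If the torsion submodule has dimension 0, its maximum need not be read off from it: `M`
      -- itself is Noetherian. In positive dimension the torsion submodule and `M` have equal
      -- dimension.
      rcases d with _ | d
      · exact hzero (hM.ndimLT_of_primaryComponent (d := 0) hd.succ)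
      · exact ⟨d + 1, LinCpt.hasNdim_natCast.mpr ⟨hM.ndimLT_of_primaryComponent hd, fun h =>
          hd' (h.of_injective _ (Submodule.injective_subtype _))⟩, hM.isGreatest_primaryComponent hd hd'⟩
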